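/- **Proposition (spectrum of the localised Hodge Laplacian of the Heisenberg group).** Let $H=\mathbb R^3$ be the Heisenberg group with the product $(a,b,t)(a',b',t')=(a+a',b+b',t+t'+ab')$, and with the left invariant Riemannian metric for which the left invariant vector fields $X=\partial_a$, $Y=\partial_b+a\,\partial_t$, $T=\partial_t$ are orthonormal, so that $da$, $db$, $\theta=dt-a\,db$ is an orthonormal coframe; orient $H$ by $da\wedge db\wedge\theta$. Let $\Delta^{(q)}=d\delta+\delta d$ be the Hodge Laplace operator on $q$-forms, $q=0,1,2,3$, written in this coframe as a matrix of left invariant differential operators. For $h\in\mathbb R\setminus\{0\}$ let $\rho_h$ be the Schrödinger representation of $H$ on $L^2(\mathbb R)$, $(\rho_h(a,b,t)f)(x)=e^{2\pi i ht+2\pi i bx}f(x+ha)$, and let $d\rho_h(\Delta^{(q)})$ be the localisation of $\Delta^{(q)}$ at $\rho_h$: the closed operator on $L^2(\mathbb R)\otimes\Lambda^q\mathbb R^3$ that is the closure of the operator obtained on the smooth vectors of $\rho_h$ by replacing each left invariant differential operator $P$ by $d\rho_h(P)u=P\big(g\mapsto\rho_h(g)u\big)(e)$. Put $k=2\pi h$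 and, for $m=0,1,2,\dots$, $$\alpha_m=(2m+1)|k|+k^2,\qquad \beta_m^{\pm}=\left(\sqrt{|k|(2m+1)+k^2+\tfrac14}\pm\tfrac12\right)^2 .$$ Then the spectra are $$\mathrm{Sp}\,d\rho_h(\Delta^{(0)})=\{\alpha_m\}_{m\ge 0},\qquad \mathrm{Sp}\,d\rho_h(\Delta^{(1)})=\{k^2,(|k|+1)^2\}\cup\{\alpha_m\}_{m\ge0}\cup\{\beta_m^{+},\beta_m^{-}\}_{m\ge 0},$$ $$\mathrm{Sp}\,d\rho_h(\Delta^{(2)})=\mathrm{Sp}\,d\rho_h(\Delta^{(1)}),\qquad \mathrm{Sp}\,d\rho_h(\Delta^{(3)})=\mathrm{Sp}\,d\rho_h(\Delta^{(0)}).$$ For $q=0,3$ each eigenvalue has multiplicity one. For $q=1,2$ the multiplicity of each real number $\lambda$ as an eigenvalue (zero if it is not one) is the number of times $\lambda$ occurs in the three sequences $(\alpha_m)_{m\ge0}$, $(\beta^+_m)_{m\ge0}$, $(\beta^-_m)_{m\ge0}$ (where $\beta_0^-=k^2$ and $\beta_0^+=(|k|+1)^2$, so that these two numbers are not counted a second time).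 In particular, when $k$ is irrational, no two entries of these sequences coincide and each eigenvalue has multiplicity one for $q=1,2$ as well. -/

import Mathlib

open MeasureTheory
open scoped ContDiff

noncomputable section

namespace HeisenbergHodge

/-! ## The Heisenberg group -/

/-- The (polarised) three dimensional Heisenberg group, with its global coordinates `a, b, t`. -/
@[ext]
structure Heisenberg where
  a : ℝ
  b : ℝ
  t : ℝ

namespace Heisenberg

instance : Mul Heisenberg := ⟨fun g g' => ⟨g.a + g'.a, g.b + g'.b, g.t + g'.t + g.a * g'.b⟩⟩
instance : One Heisenberg := ⟨⟨0, 0, 0⟩⟩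
instance : Inv Heisenberg := ⟨fun g => ⟨-g.a, -g.b, -g.t + g.a * g.b⟩⟩

theorem mul_def (g g' : Heisenberg) :
    g * g' = ⟨g.a + g'.a, g.b + g'.b, g.t + g'.t + g.a * g'.b⟩ := rfl
theorem one_def : (1 : Heisenberg) = ⟨0, 0, 0⟩ := rfl
theorem inv_def (g : Heisenberg) : g⁻¹ = ⟨-g.a, -g.b, -g.t + g.a * g.b⟩ := rfl

instance : Group Heisenberg :=
  Group.ofLeftAxioms
    (by intro x y z; simp only [mul_def]; ext <;> simp <;> ring)
    (by intro x; simp only [mul_def, one_def]; ext <;> simp)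
    (by intro x; simp only [mul_def, one_def, inv_def]; ext <;> simp)

/-- The point of the group with given global coordinates. -/
def ofCoord (p : ℝ × ℝ × ℝ) : Heisenberg := ⟨p.1, p.2.1, p.2.2⟩

/-- The global coordinates of a point of the group. -/
def coord (g : Heisenberg) : ℝ × ℝ × ℝ := (g.a, g.b, g.t)

end Heisenberg

open Heisenberg

/-! ## Smooth functions and left invariant vector fields on the group

Functions take values in a complex normed space `E`. -/

section Smooth

variable (E : Type*) [NormedAddCommGroup E] [NormedSpace ℂ E]

/-- The space of smooth functions from the Heisenberg group to `E`. -/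
def SmoothFun : Submodule ℂ (Heisenberg → E) where
  carrier := {F | ContDiff ℝ ∞ (F ∘ ofCoord)}
  add_mem' := fun {F G} hF hG => by
    have hF' : ContDiff ℝ ∞ (F ∘ ofCoord) := hF
    have hG' : ContDiff ℝ ∞ (G ∘ ofCoord) := hG
    exact hF'.add hG'
  zero_mem' := by
    change ContDiff ℝ ∞ (fun _ : ℝ × ℝ × ℝ => (0 : E))
    exact contDiff_const
  smul_mem' := fun c F hF => by
    have hF' : ContDiff ℝ ∞ (F ∘ ofCoord) := hF
    exact hF'.const_smul c

variable {E}

theorem smoothFun_differentiableAt (F : SmoothFun E) (p : ℝ × ℝ × ℝ) :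
    DifferentiableAt ℝ (F.1 ∘ ofCoord) p :=
  (show ContDiff ℝ ∞ (F.1 ∘ ofCoord) from F.2).differentiable (by simp) p

variable (E)

/-- The first order differential operator on smooth functions given by the vector field
`x ∂_a + y (∂_b + a ∂_t) + z ∂_t`, the left invariant vector field with value
`v = (x, y, z)` at the unit element. -/
def leftField (v : ℝ × ℝ × ℝ) : Module.End ℂ (SmoothFun E) where
  toFun F := ⟨fun g => fderiv ℝ (F.1 ∘ ofCoord) (coord g) (v.1, v.2.1, v.2.2 + g.a * v.2.1), by
    have hF : ContDiff ℝ ∞ (F.1 ∘ ofCoord) := F.2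
    change ContDiff ℝ ∞ (fun p : ℝ × ℝ × ℝ =>
      fderiv ℝ (F.1 ∘ ofCoord) p (v.1, v.2.1, v.2.2 + p.1 * v.2.1))
    have h1 : ContDiff ℝ ∞ (fderiv ℝ (F.1 ∘ ofCoord)) := hF.fderiv_right (by simp)
    exact h1.clm_apply (by fun_prop)⟩
  map_add' F G := by
    ext g
    change fderiv ℝ (F.1 ∘ ofCoord + G.1 ∘ ofCoord) (coord g) _ = _
    rw [fderiv_add (smoothFun_differentiableAt F _) (smoothFun_differentiableAt G _)]
    rfl
  map_smul' c F := by
    ext g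
    change fderiv ℝ (c • (F.1 ∘ ofCoord)) (coord g) _ = _
    rw [fderiv_const_smul (smoothFun_differentiableAt F _)]
    rfl

/-- `X = ∂_a`. -/
def fieldX : Module.End ℂ (SmoothFun E) := leftField E (1, 0, 0)
/-- `Y = ∂_b + a ∂_t`. -/
def fieldY : Module.End ℂ (SmoothFun E) := leftField E (0, 1, 0)
/-- `T = ∂_t`. -/
def fieldT : Module.End ℂ (SmoothFun E) := leftField E (0, 0, 1)

end Smooth

/-! ## The Hodge Laplace operator of the group

Smooth differential forms are given by their components with respect to the left invariant
orthonormal coframe `da, db, θ = dt - a db`, whose only nontrivial structure equation is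
`dθ = - da ∧ db`. The frames of the bundles of forms are
* degree 0: `1`;
* degree 1: `da, db, θ`;
* degree 2: `da ∧ db, da ∧ θ, db ∧ θ`;
* degree 3: `da ∧ db ∧ θ` (the Riemannian volume form).

Operators between forms are matrices of left invariant differential operators. -/

section Hodge

variable (E : Type*) [NormedAddCommGroup E] [NormedSpace ℂ E]

/-- The exterior derivative from functions to 1-forms. -/
def extD0 : Matrix (Fin 3) (Fin 1) (Module.End ℂ (SmoothFun E)) :=
  !![fieldX E; fieldY E; fieldT E]

/-- The exterior derivative from 1-forms to 2-forms. -/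
def extD1 : Matrix (Fin 3) (Fin 3) (Module.End ℂ (SmoothFun E)) :=
  !![-fieldY E, fieldX E, -1;
     -fieldT E, 0, fieldX E;
     0, -fieldT E, fieldY E]

/-- The exterior derivative from 2-forms to 3-forms. -/
def extD2 : Matrix (Fin 1) (Fin 3) (Module.End ℂ (SmoothFun E)) :=
  !![fieldT E, -fieldY E, fieldX E]

/-- The Hodge star between 1-forms and 2-forms (in both directions):
`⋆da = db ∧ θ`, `⋆db = - da ∧ θ`, `⋆θ = da ∧ db`, and `⋆⋆ = 1`. -/
def hodgeStar : Matrix (Fin 3) (Fin 3) (Module.End ℂ (SmoothFun E)) :=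
  !![0, 0, 1;
     0, -1, 0;
     1, 0, 0]

/-- The Hodge star between functions and 3-forms (in both directions):
`⋆1 = da ∧ db ∧ θ`. -/
def hodgeStarTop : Matrix (Fin 1) (Fin 1) (Module.End ℂ (SmoothFun E)) := 1

/-- The codifferential `δ = - ⋆ d ⋆` from 1-forms to functions. -/
def codiff1 : Matrix (Fin 1) (Fin 3) (Module.End ℂ (SmoothFun E)) :=
  -(hodgeStarTop E * extD2 E * hodgeStar E)

/-- The codifferential `δ = ⋆ d ⋆` from 2-forms to 1-forms
(in dimension 3, the formal adjoint of `d` on `q`-forms is `(-1)^q ⋆ d ⋆`). -/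
def codiff2 : Matrix (Fin 3) (Fin 3) (Module.End ℂ (SmoothFun E)) :=
  hodgeStar E * extD1 E * hodgeStar E

/-- The codifferential `δ = - ⋆ d ⋆` from 3-forms to 2-forms. -/
def codiff3 : Matrix (Fin 3) (Fin 1) (Module.End ℂ (SmoothFun E)) :=
  -(hodgeStar E * extD0 E * hodgeStarTop E)

/-- The Hodge Laplace operator `δ d` on functions. -/
def hodgeLaplacian0 : Matrix (Fin 1) (Fin 1) (Module.End ℂ (SmoothFun E)) :=
  codiff1 E * extD0 E

/-- The Hodge Laplace operator `d δ + δ d` on 1-forms. -/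
def hodgeLaplacian1 : Matrix (Fin 3) (Fin 3) (Module.End ℂ (SmoothFun E)) :=
  extD0 E * codiff1 E + codiff2 E * extD1 E

/-- The Hodge Laplace operator `d δ + δ d` on 2-forms. -/
def hodgeLaplacian2 : Matrix (Fin 3) (Fin 3) (Module.End ℂ (SmoothFun E)) :=
  extD1 E * codiff2 E + codiff3 E * extD2 E

/-- The Hodge Laplace operator `d δ` on 3-forms. -/
def hodgeLaplacian3 : Matrix (Fin 1) (Fin 1) (Module.End ℂ (SmoothFun E)) :=
  extD2 E * codiff3 E

end Hodge

/-! ## The Schrödinger representation -/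

/-- The Hilbert space `L²(ℝ)`. -/
abbrev L2R : Type := Lp ℂ 2 (volume : Measure ℝ)

/-- The phase `exp (2 π i h t + 2 π i b x)`. -/
def phase (h : ℝ) (g : Heisenberg) (x : ℝ) : ℂ :=
  Complex.exp ((2 * Real.pi * (h * g.t + g.b * x) : ℝ) * Complex.I)

theorem norm_phase (h : ℝ) (g : Heisenberg) (x : ℝ) : ‖phase h g x‖ = 1 :=
  Complex.norm_exp_ofReal_mul_I _

theorem continuous_phase (h : ℝ) (g : Heisenberg) : Continuous (phase h g) := by
  unfold phase; fun_prop

/-- `x ↦ exp (2 π i h t + 2 π i b x) f (x + h a)`. -/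
def schrodingerFun (h : ℝ) (g : Heisenberg) (f : ℝ → ℂ) (x : ℝ) : ℂ :=
  phase h g x * f (x + h * g.a)

theorem memLp_schrodingerFun (h : ℝ) (g : Heisenberg) {f : ℝ → ℂ} (hf : MemLp f 2 volume) :
    MemLp (schrodingerFun h g f) 2 volume := by
  have h1 : MemLp (fun x => f (x + h * g.a)) 2 volume :=
    hf.comp_measurePreserving (measurePreserving_add_right volume (h * g.a))
  refine h1.of_le ((continuous_phase h g).aestronglyMeasurable.mul h1.1) ?_
  exact Filter.Eventually.of_forall fun x => by simp [schrodingerFun, norm_phase]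

theorem schrodingerFun_congr (h : ℝ) (g : Heisenberg) {f f' : ℝ → ℂ} (hf : f =ᵐ[volume] f') :
    schrodingerFun h g f =ᵐ[volume] schrodingerFun h g f' := by
  have h1 := (measurePreserving_add_right (volume : Measure ℝ)
    (h * g.a)).quasiMeasurePreserving.ae_eq_comp hf
  filter_upwards [h1] with x hx
  have hx' : f (x + h * g.a) = f' (x + h * g.a) := hx
  simp [schrodingerFun, hx']

/-- The operator `ρ_h(g)` on `L²(ℝ)`. -/
def schrodingerOp (h : ℝ) (g : Heisenberg) : L2R →ₗᵢ[ℂ] L2R where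
  toFun f := (memLp_schrodingerFun h g (Lp.memLp f)).toLp _
  map_add' f f' := by
    rw [← MemLp.toLp_add]
    refine MemLp.toLp_congr _ _ ((schrodingerFun_congr h g (Lp.coeFn_add f f')).trans ?_)
    exact Filter.Eventually.of_forall fun x => by simp [schrodingerFun, mul_add]
  map_smul' c f := by
    rw [RingHom.id_apply, ← MemLp.toLp_const_smul]
    refine MemLp.toLp_congr _ _ ((schrodingerFun_congr h g (Lp.coeFn_smul c f)).trans ?_)
    exact Filter.Eventually.of_forall fun x => by simp [schrodingerFun, mul_left_comm]
  norm_map' f := by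
    change ‖(memLp_schrodingerFun h g (Lp.memLp f)).toLp _‖ = ‖f‖
    have h1 := Lp.memLp f
    rw [Lp.norm_toLp, Lp.norm_def]
    congr 1
    have h2 : eLpNorm (schrodingerFun h g f) 2 volume
        = eLpNorm (fun x => f (x + h * g.a)) 2 volume :=
      eLpNorm_congr_norm_ae (Filter.Eventually.of_forall fun x => by
        simp [schrodingerFun, norm_phase])
    rw [h2]
    exact eLpNorm_comp_measurePreserving h1.1 (measurePreserving_add_right volume (h * g.a))

theorem coeFn_schrodingerOp (h : ℝ) (g : Heisenberg) (f : L2R) :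
    schrodingerOp h g f =ᵐ[volume] schrodingerFun h g f :=
  MemLp.coeFn_toLp (memLp_schrodingerFun h g (Lp.memLp f))

theorem schrodingerOp_one (h : ℝ) (f : L2R) : schrodingerOp h 1 f = f := by
  refine Lp.ext ((coeFn_schrodingerOp h 1 f).trans ?_)
  exact Filter.Eventually.of_forall fun x => by simp [schrodingerFun, phase, one_def]

theorem schrodingerOp_mul (h : ℝ) (g g' : Heisenberg) (f : L2R) :
    schrodingerOp h (g * g') f = schrodingerOp h g (schrodingerOp h g' f) := by
  refine Lp.ext ((coeFn_schrodingerOp h (g * g') f).trans (Filter.EventuallyEq.symm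
    ((coeFn_schrodingerOp h g _).trans
      ((schrodingerFun_congr h g (coeFn_schrodingerOp h g' f)).trans ?_))))
  refine Filter.Eventually.of_forall fun x => ?_
  simp only [schrodingerFun, phase, mul_def]
  rw [← mul_assoc, ← Complex.exp_add]
  congr 2
  · push_cast; ring
  · ring

/-- The Schrödinger representation `ρ_h` of the Heisenberg group by unitary operators on `L²(ℝ)`,
`(ρ_h(a, b, t) f)(x) = exp (2 π i h t + 2 π i b x) f (x + h a)`. -/
def schrodinger (h : ℝ) : Heisenberg →* (L2R ≃ₗᵢ[ℂ] L2R) where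
  toFun g := LinearIsometryEquiv.mk
    (LinearEquiv.ofLinearMap (schrodingerOp h g).toLinearMap (schrodingerOp h g⁻¹).toLinearMap
      (by ext1 f
          change schrodingerOp h g (schrodingerOp h g⁻¹ f) = f
          rw [← schrodingerOp_mul, mul_inv_cancel, schrodingerOp_one])
      (by ext1 f
          change schrodingerOp h g⁻¹ (schrodingerOp h g f) = f
          rw [← schrodingerOp_mul, inv_mul_cancel, schrodingerOp_one]))
    (fun f => (schrodingerOp h g).norm_map f)
  map_one' := by
    refine LinearIsometryEquiv.ext fun f => ?_
    exact schrodingerOp_one h f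
  map_mul' g g' := by
    refine LinearIsometryEquiv.ext fun f => ?_
    exact schrodingerOp_mul h g g' f

/-! ## Localisation at `ρ_h`

A left invariant differential operator `P` on the group acts on the smooth vectors of a
representation `ρ` by `dρ(P) u = P (g ↦ ρ(g) u) (1)`; for `P = X_1 ⋯ X_r` a product of left
invariant vector fields this is `dρ(X_1) ⋯ dρ(X_r) u`, where
`dρ(X) u` is the derivative at `0` of `s ↦ ρ(exp(s X)) u`. -/

/-- The orbit map `g ↦ ρ_h(g) u`. -/
def orbit (h : ℝ) (u : L2R) : Heisenberg → L2R := fun g => schrodinger h g u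

/-- The Hilbert space `L²(ℝ) ⊗ ℂⁿ` of vectors with `n` components in `L²(ℝ)`. -/
abbrev L2Forms (n : ℕ) : Type := PiLp 2 (fun _ : Fin n => L2R)

/-- The vectors all of whose components are smooth vectors of `ρ_h`. -/
def smoothVectors (h : ℝ) (n : ℕ) : Submodule ℂ (L2Forms n) where
  carrier := {u | ∀ i, orbit h (u i) ∈ SmoothFun L2R}
  add_mem' := fun {u v} hu hv i => by
    have : orbit h ((u + v) i) = orbit h (u i) + orbit h (v i) := by
      funext g; simp [orbit]
    rw [this]; exact (SmoothFun L2R).add_mem (hu i) (hv i)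
  zero_mem' := fun i => by
    have : orbit h ((0 : L2Forms n) i) = 0 := by
      funext g; simp [orbit]
    rw [this]; exact (SmoothFun L2R).zero_mem
  smul_mem' := fun c u hu i => by
    have : orbit h ((c • u) i) = c • orbit h (u i) := by
      funext g; simp [orbit]
    rw [this]; exact (SmoothFun L2R).smul_mem c (hu i)

/-- The tuple of orbit maps of a tuple of smooth vectors, a tuple of smooth functions on the
group. -/
def orbitTuple (h : ℝ) (n : ℕ) : smoothVectors h n →ₗ[ℂ] (Fin n → SmoothFun L2R) where
  toFun u := fun i => ⟨orbit h (u.1 i), u.2 i⟩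
  map_add' u v := by
    funext i; apply Subtype.ext; funext g
    change schrodinger h g ((u.1 + v.1) i) = schrodinger h g (u.1 i) + schrodinger h g (v.1 i)
    simp
  map_smul' c u := by
    funext i; apply Subtype.ext; funext g
    change schrodinger h g ((c • u.1) i) = c • schrodinger h g (u.1 i)
    simp

/-- Evaluation at the unit element. -/
def evalOne : SmoothFun L2R →ₗ[ℂ] L2R where
  toFun F := F.1 1
  map_add' _ _ := rfl
  map_smul' _ _ := rfl

/-- The operator `dρ_h(P)` on the smooth vectors, for a matrix `P` of left invariant differential
operators: the `i`-th component of `dρ_h(P) u` is the value at the unit element of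
`∑ j, P i j (g ↦ ρ_h(g) u_j)`. -/
def localiseSmooth (h : ℝ) {n : ℕ}
    (P : Matrix (Fin n) (Fin n) (Module.End ℂ (SmoothFun L2R))) :
    L2Forms n →ₗ.[ℂ] L2Forms n where
  domain := smoothVectors h n
  toFun := (WithLp.linearEquiv 2 ℂ (Fin n → L2R)).symm.toLinearMap ∘ₗ
    LinearMap.pi (fun i => evalOne ∘ₗ ∑ j, P i j ∘ₗ LinearMap.proj j) ∘ₗ orbitTuple h n

/-- The localisation of `P` at `ρ_h`: the closure of `dρ_h(P)` on the smooth vectors. -/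
def localise (h : ℝ) {n : ℕ}
    (P : Matrix (Fin n) (Fin n) (Module.End ℂ (SmoothFun L2R))) :
    L2Forms n →ₗ.[ℂ] L2Forms n :=
  (localiseSmooth h P).closure

/-! ## Spectrum of unbounded operators -/

section Spectrum

variable {K : Type*} [NormedAddCommGroup K] [NormedSpace ℂ K]

/-- `z` is in the resolvent set of `A` if `A - z` is a bijection of the domain of `A` onto the
whole space with bounded inverse. -/
def InResolventSet (A : K →ₗ.[ℂ] K) (z : ℂ) : Prop :=
  ∃ R : K →L[ℂ] K,
    (∀ y, ∃ hy : R y ∈ A.domain, A ⟨R y, hy⟩ - z • R y = y) ∧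
    ∀ x : A.domain, R (A x - z • (x : K)) = x

/-- The spectrum of an unbounded operator. -/
def unboundedSpectrum (A : K →ₗ.[ℂ] K) : Set ℂ := {z | ¬ InResolventSet A z}

/-- The eigenspace `{x ∈ D(A) | A x = z x}`. -/
def eigenspace (A : K →ₗ.[ℂ] K) (z : ℂ) : Submodule ℂ A.domain :=
  LinearMap.ker (A.toFun - z • A.domain.subtype)

/-- The (geometric) multiplicity of `z` as an eigenvalue of `A`. -/
def eigenMultiplicity (A : K →ₗ.[ℂ] K) (z : ℂ) : ℕ := Module.finrank ℂ (eigenspace A z)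

end Spectrum

/-! ## The lists of eigenvalues -/

/-- `(2 m + 1) |k| + k²`. -/
def eigA (k : ℝ) (m : ℕ) : ℝ := (2 * m + 1) * |k| + k ^ 2

/-- `(√(|k| (2 m + 1) + k² + 1/4) + 1/2)²`. -/
def eigPlus (k : ℝ) (m : ℕ) : ℝ := (√(|k| * (2 * m + 1) + k ^ 2 + 1 / 4) + 1 / 2) ^ 2

/-- `(√(|k| (2 m + 1) + k² + 1/4) - 1/2)²`. -/
def eigMinus (k : ℝ) (m : ℕ) : ℝ := (√(|k| * (2 * m + 1) + k ^ 2 + 1 / 4) - 1 / 2) ^ 2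

/-- The set of eigenvalues on functions. -/
def functionSpectrum (k : ℝ) : Set ℝ := {x | ∃ m : ℕ, x = eigA k m}

/-- The set of eigenvalues on 1-forms. -/
def oneFormSpectrum (k : ℝ) : Set ℝ :=
  {k ^ 2, (|k| + 1) ^ 2} ∪ {x | ∃ m : ℕ, x = eigA k m} ∪
    {x | ∃ m : ℕ, x = eigPlus k m ∨ x = eigMinus k m}

/-- The number of indices at which `x` occurs in the three sequences `eigA`, `eigPlus` and
`eigMinus`. As `eigMinus k 0 = k²` and `eigPlus k 0 = (|k| + 1)²`, these three sequences
list all the elements of `oneFormSpectrum k`. -/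
def oneFormCount (k x : ℝ) : ℕ :=
  {m : ℕ | eigA k m = x}.ncard + {m : ℕ | eigPlus k m = x}.ncard +
    {m : ℕ | eigMinus k m = x}.ncard

end HeisenbergHodge

end

/-! On smooth vectors of `ρ_h` the centre acts by `i k`, and `X ∓ i s Y`-type combinations (with `s`
the sign of `h`) are lowering and raising operators. A Gaussian of the right width is killed by the
lowering operator, and raising it gives Hermite functions `f n`: smooth vectors, total in `L²(ℝ)`,
on which `-X² - Y²` has eigenvalue `(2n+1)|k|`. Adding `-T² = k²` gives `α_n` on functions.

On 1-forms write `curl = ⋆d`, which is symmetric, so that the Laplacian is `grad ∘ codiff + curl²`.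
Exact forms `grad (f n)` contribute `α_n` again. On a coclosed form the Laplacian is `curl²`, so
eigenvectors of `curl` suffice. The identity `curl² (f θ) = i k grad f - curl (f θ) + α_n f θ` for
`f = f n`, whose middle term comes from `dθ = -da ∧ db`, gives a coclosed vector with
`curl`-eigenvalue `μ` whenever `μ² + μ = α_n`. The roots are `-1/2 ± √(α_n + 1/4)`, and their
squares are `β_n^∓`. One case degenerates: at level `0` the root `μ = |k|` gives the zero vector.
Its place is taken by a horizontal form built from the ground state, with `curl`-eigenvalue `-|k|`
and hence the same square `k² = β_0^-`. Degree 2 is degree 1 conjugated by the Hodge star, and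
degree 3 has the same matrix as degree 0.

The analysis is reduced to this algebra by `IsDiagonal`: if a symmetric operator has a total
orthogonal family of eigenvectors in its domain, its closure is the maximal diagonal operator. When
only finitely many eigenvalues lie in each bounded set, the spectrum is exactly the list of
eigenvalues (`IsDiagonal.unboundedSpectrum_closure`) and the multiplicities are counts of indices
(`IsDiagonal.eigenMultiplicity_closure`). The inputs are `exists_isLadder`,
`IsLadder.act_formVector`, `IsLadder.formVector_orthogonal` and `IsLadder.formVector_total`. For
irrational `k`, `formValue_injective` excludes coincidences in the list: each would be an integer
linear relation for `|k|`. -/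

namespace HeisenbergHodge

open Heisenberg

/-! ### Diagonal unbounded operators: closure, spectrum, multiplicities. -/

section Diagonal

variable {K ι : Type*} [NormedAddCommGroup K] [InnerProductSpace ℂ K]

/-- The unbounded operator `S` is symmetric and diagonal with respect to the total orthogonal
family `v` of eigenvectors with eigenvalues `l`, only finitely many of which lie in any bounded
set. -/
structure IsDiagonal (S : K →ₗ.[ℂ] K) (v : ι → K) (l : ι → ℝ) : Prop where
  mem_graph : ∀ j, (v j, (l j : ℂ) • v j) ∈ S.graph
  symm : ∀ j, ∀ u : S.domain, inner ℂ (v j) (S u) = (l j : ℂ) * inner ℂ (v j) (u : K)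
  ne_zero : ∀ j, v j ≠ 0
  orthogonal : Pairwise fun i j => inner ℂ (v i) (v j) = 0
  total : ∀ x, (∀ j, inner ℂ (v j) x = 0) → x = 0
  finite : ∀ C : ℝ, {j | |l j| ≤ C}.Finite

variable {S : K →ₗ.[ℂ] K} {v : ι → K} {l : ι → ℝ}

/-- The normalised family of eigenvectors as a Hilbert basis. -/
theorem IsDiagonal.exists_basis [CompleteSpace K] (H : IsDiagonal S v l) :
    ∃ b : HilbertBasis ι ℂ K, IsDiagonal S b l := by
  have hn : ∀ j, (‖v j‖ : ℂ) ≠ 0 := fun j => by simpa using H.ne_zero j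
  let w : ι → K := fun j => (‖v j‖ : ℂ)⁻¹ • v j
  have hw : Orthonormal ℂ w := by
    refine ⟨fun j => ?_, fun i j hij => ?_⟩
    · simp [w, norm_smul, H.ne_zero j]
    · simp [w, inner_smul_left, inner_smul_right, H.orthogonal hij]
  have ht : (Submodule.span ℂ (Set.range w))ᗮ = ⊥ := by
    rw [Submodule.eq_bot_iff]
    intro x hx
    refine H.total x fun j => ?_
    have h1 : inner ℂ (w j) x = 0 :=
      Submodule.inner_right_of_mem_orthogonal (Submodule.subset_span (Set.mem_range_self j)) hx
    simpa [w, inner_smul_left, H.ne_zero j] using h1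
  have hb : ⇑(HilbertBasis.mkOfOrthogonalEqBot hw ht) = w :=
    HilbertBasis.coe_mkOfOrthogonalEqBot hw ht
  refine ⟨HilbertBasis.mkOfOrthogonalEqBot hw ht, ?_⟩
  rw [hb]
  exact
    { mem_graph := fun j => by
        have := S.graph.smul_mem (‖v j‖ : ℂ)⁻¹ (H.mem_graph j)
        rwa [Prod.smul_mk, smul_comm] at this
      symm := fun j u => by
        simp only [w, inner_smul_left, H.symm]; ring
      ne_zero := fun j => hw.ne_zero j
      orthogonal := fun i j hij => hw.2 hij
      total := fun x hx => H.total x fun j => by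
        simpa [w, inner_smul_left, H.ne_zero j] using hx j
      finite := H.finite }

/-- The graph of the maximal operator that multiplies the coefficients with respect to `v`
by `l`. -/
def maximalGraph (v : ι → K) (l : ι → ℝ) : Submodule ℂ (K × K) where
  carrier := {p | ∀ j, inner ℂ (v j) p.2 = (l j : ℂ) * inner ℂ (v j) p.1}
  add_mem' := fun {p q} hp hq j => by
    have h1 := hp j
    have h2 := hq j
    simp only [Prod.fst_add, Prod.snd_add, inner_add_right, h1, h2]; ring
  zero_mem' := fun j => by simp
  smul_mem' := fun c p hp j => by
    have h1 := hp j
    simp only [Prod.smul_fst, Prod.smul_snd, inner_smul_right, h1]; ring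

theorem mem_maximalGraph {x y : K} :
    (x, y) ∈ maximalGraph v l ↔ ∀ j, inner ℂ (v j) y = (l j : ℂ) * inner ℂ (v j) x := Iff.rfl

theorem isClosed_maximalGraph (v : ι → K) (l : ι → ℝ) :
    IsClosed (maximalGraph v l : Set (K × K)) := by
  have : (maximalGraph v l : Set (K × K)) =
      ⋂ j, {p : K × K | inner ℂ (v j) p.2 = (l j : ℂ) * inner ℂ (v j) p.1} := by
    ext p; simp [maximalGraph]
  rw [this]
  refine isClosed_iInter fun j => isClosed_eq ?_ ?_
  · exact continuous_const.inner continuous_snd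
  · exact continuous_const.mul (continuous_const.inner continuous_fst)

theorem IsDiagonal.graph_le (H : IsDiagonal S v l) : S.graph ≤ maximalGraph v l := by
  rintro ⟨x, y⟩ hxy
  obtain ⟨u, rfl, rfl⟩ := (LinearPMap.mem_graph_iff S).1 hxy
  exact fun j => H.symm j u

/-- Symmetry puts the graph inside the closed maximal one. Conversely, the finite partial sums of
the expansions of `x` and `y` give points of the graph of `S` converging to `(x, y)`. -/
theorem IsDiagonal.graph_closure {b : HilbertBasis ι ℂ K} (H : IsDiagonal S b l) :
    S.closure.graph = maximalGraph b l := by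
  have hle : S.graph.topologicalClosure = maximalGraph b l := by
    refine le_antisymm
      (Submodule.topologicalClosure_minimal _ H.graph_le (isClosed_maximalGraph _ _)) ?_
    rintro ⟨x, y⟩ hxy
    have hx := b.hasSum_repr x
    have hy := b.hasSum_repr y
    have h1 := hx.prodMk hy
    refine mem_closure_of_tendsto h1 (Filter.Eventually.of_forall fun s => ?_)
    refine Submodule.sum_mem _ fun j _ => ?_
    have h2 := S.graph.smul_mem (b.repr x j) (H.mem_graph j)
    have h3 : b.repr y j = l j * b.repr x j := by
      simpa [HilbertBasis.repr_apply_apply] using hxy j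
    rw [h3]
    rwa [Prod.smul_mk, smul_smul, mul_comm] at h2
  -- Closability has to be shown, because `LinearPMap.closure` returns the operator itself when it
  -- fails.
  have hcl : S.IsClosable := by
    refine ⟨(maximalGraph b l).toLinearPMap, ?_⟩
    rw [hle, Submodule.toLinearPMap_graph_eq]
    rintro ⟨x, y⟩ hxy hx
    refine H.total _ fun j => ?_
    have := hxy j
    simp only at hx
    simpa [hx] using this
  rw [← hcl.graph_closure_eq_closure_graph, hle]

theorem IsDiagonal.mem_graph_closure_iff {b : HilbertBasis ι ℂ K} (H : IsDiagonal S b l)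
    {x y : K} :
    (x, y) ∈ S.closure.graph ↔ ∀ j, b.repr y j = (l j : ℂ) * b.repr x j := by
  simp only [H.graph_closure, mem_maximalGraph, HilbertBasis.repr_apply_apply]

theorem hilbertBasis_ext (b : HilbertBasis ι ℂ K) {x y : K}
    (hxy : ∀ j, b.repr x j = b.repr y j) : x = y :=
  b.repr.injective (lp.ext (funext hxy))

/-- The bounded operator with diagonal matrix `m` with respect to a Hilbert basis. -/
theorem exists_diagonal_clm (b : HilbertBasis ι ℂ K) (m : ι → ℂ) (C : ℝ) (hm : ∀ j, ‖m j‖ ≤ C) :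
    ∃ R : K →L[ℂ] K, ∀ y j, b.repr (R y) j = m j * b.repr y j := by
  rcases isEmpty_or_nonempty ι with hι | ⟨⟨j₀⟩⟩
  · exact ⟨0, fun y j => (hι.false j).elim⟩
  have hC : 0 ≤ C := (norm_nonneg _).trans (hm j₀)
  have hp : 0 < (2 : ENNReal).toReal := by norm_num
  have hle : ∀ y : K, ∀ j, ‖m j * b.repr y j‖ ≤ C * ‖b.repr y j‖ := fun y j => by
    rw [norm_mul]; exact mul_le_mul_of_nonneg_right (hm j) (norm_nonneg _)
  have hle2 : ∀ y : K, ∀ s : Finset ι, ∑ j ∈ s, ‖m j * b.repr y j‖ ^ (2 : ENNReal).toReal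
      ≤ (C * ‖y‖) ^ (2 : ENNReal).toReal := fun y s => by
    calc ∑ j ∈ s, ‖m j * b.repr y j‖ ^ (2 : ENNReal).toReal
        ≤ ∑ j ∈ s, C ^ (2 : ENNReal).toReal * ‖b.repr y j‖ ^ (2 : ENNReal).toReal := by
          refine Finset.sum_le_sum fun j _ => ?_
          rw [← Real.mul_rpow hC (norm_nonneg _)]
          exact Real.rpow_le_rpow (norm_nonneg _) (hle y j) hp.le
      _ = C ^ (2 : ENNReal).toReal * ∑ j ∈ s, ‖b.repr y j‖ ^ (2 : ENNReal).toReal := by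
          rw [Finset.mul_sum]
      _ ≤ C ^ (2 : ENNReal).toReal * ‖b.repr y‖ ^ (2 : ENNReal).toReal := by
          refine mul_le_mul_of_nonneg_left (lp.sum_rpow_le_norm_rpow hp _ s) (by positivity)
      _ = (C * ‖y‖) ^ (2 : ENNReal).toReal := by
          rw [LinearIsometryEquiv.norm_map, Real.mul_rpow hC (norm_nonneg _)]
  let r : K → lp (fun _ : ι => ℂ) 2 := fun y => ⟨fun j => m j * b.repr y j, memℓp_gen' (hle2 y)⟩
  have hr : ∀ y j, r y j = m j * b.repr y j := fun _ _ => rfl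
  have hnorm : ∀ y, ‖r y‖ ≤ C * ‖y‖ := fun y =>
    lp.norm_le_of_forall_sum_le hp (by positivity) (hle2 y)
  let L : K →ₗ[ℂ] K :=
    { toFun := fun y => b.repr.symm (r y)
      map_add' := fun x y => by
        rw [← map_add]; congr 1; ext j
        simp only [hr, map_add, lp.coeFn_add, Pi.add_apply]; ring
      map_smul' := fun c y => by
        rw [RingHom.id_apply, ← map_smul]; congr 1; ext j
        simp only [hr, map_smul, lp.coeFn_smul, Pi.smul_apply, smul_eq_mul]; ring }
  refine ⟨L.mkContinuous C fun y => ?_, fun y j => ?_⟩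
  · change ‖b.repr.symm (r y)‖ ≤ _
    rw [LinearIsometryEquiv.norm_map]; exact hnorm y
  · change b.repr (b.repr.symm (r y)) j = _
    rw [LinearIsometryEquiv.apply_symm_apply, hr]

/-- Values of modulus greater than `‖z‖ + 1` are at distance at least `1` from `z`, and only
finitely many remain. This bounds the resolvent. -/
theorem exists_pos_le_norm_sub (hl : ∀ C : ℝ, {j | |l j| ≤ C}.Finite) {z : ℂ}
    (hz : ∀ j, (l j : ℂ) ≠ z) : ∃ e > 0, ∀ j, e ≤ ‖(l j : ℂ) - z‖ := by
  have hfin := hl (‖z‖ + 1)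
  have hpos : ∀ j, 0 < ‖(l j : ℂ) - z‖ := fun j => norm_pos_iff.2 (sub_ne_zero.2 (hz j))
  obtain ⟨e, he, hle⟩ : ∃ e > 0, ∀ j ∈ {j | |l j| ≤ ‖z‖ + 1}, e ≤ ‖(l j : ℂ) - z‖ := by
    rcases Set.eq_empty_or_nonempty {j | |l j| ≤ ‖z‖ + 1} with h0 | h0
    · exact ⟨1, one_pos, fun j hj => by simp [h0] at hj⟩
    · obtain ⟨j, -, hj⟩ := Set.exists_min_image _ (fun j => ‖(l j : ℂ) - z‖) hfin h0
      exact ⟨_, hpos j, hj⟩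
  refine ⟨min e 1, lt_min he one_pos, fun j => ?_⟩
  by_cases hj : |l j| ≤ ‖z‖ + 1
  · exact (min_le_left _ _).trans (hle j hj)
  · refine (min_le_right _ _).trans ?_
    have h1 := norm_sub_norm_le (l j : ℂ) z
    have h2 : ‖(l j : ℂ)‖ = |l j| := by simp
    rw [h2] at h1
    linarith

/-- Off the eigenvalues the resolvent is multiplication of coefficients by the bounded sequence `(l
j - z)⁻¹`; at an eigenvalue a resolvent would send `0` to an eigenvector. -/
theorem IsDiagonal.unboundedSpectrum_closure [CompleteSpace K] (H : IsDiagonal S v l) :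
    unboundedSpectrum S.closure = (fun x : ℝ => (x : ℂ)) '' Set.range l := by
  obtain ⟨b, Hb⟩ := H.exists_basis
  ext z
  constructor
  · intro hz
    by_contra hne
    refine hz ?_
    have hne' : ∀ j, (l j : ℂ) ≠ z := fun j hj => hne ⟨l j, ⟨j, rfl⟩, hj⟩
    obtain ⟨e, he, hle⟩ := exists_pos_le_norm_sub H.finite hne'
    obtain ⟨R, hR⟩ := exists_diagonal_clm b (fun j => ((l j : ℂ) - z)⁻¹) e⁻¹ (fun j => by
      rw [norm_inv]; exact inv_anti₀ he (hle j))
    refine ⟨R, fun y => ?_, fun x => ?_⟩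
    · have hg : (R y, y + z • R y) ∈ S.closure.graph := by
        rw [Hb.mem_graph_closure_iff]
        intro j
        have h0 : (l j : ℂ) - z ≠ 0 := sub_ne_zero.2 (hne' j)
        simp only [map_add, map_smul, lp.coeFn_add, lp.coeFn_smul, Pi.add_apply, Pi.smul_apply,
          smul_eq_mul, hR]
        field_simp
        ring
      obtain ⟨u, hu, hu'⟩ := (LinearPMap.mem_graph_iff _).1 hg
      have hmem : R y ∈ S.closure.domain := by
        have h3 : (u : K) = R y := hu
        exact h3 ▸ u.2
      have hue : u = ⟨R y, hmem⟩ := Subtype.ext hu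
      refine ⟨hmem, ?_⟩
      rw [← hue, hu']; simp
    · refine hilbertBasis_ext b fun j => ?_
      have h1 := (Hb.mem_graph_closure_iff (x := x) (y := S.closure x)).1
        (LinearPMap.mem_graph _ x) j
      have h0 : (l j : ℂ) - z ≠ 0 := sub_ne_zero.2 (hne' j)
      simp only [hR, map_sub, map_smul, lp.coeFn_sub, lp.coeFn_smul, Pi.sub_apply, Pi.smul_apply,
        smul_eq_mul, h1]
      field_simp
  · rintro ⟨_, ⟨j, rfl⟩, rfl⟩ ⟨R, -, hR⟩
    have h1 := LinearPMap.le_graph_of_le S.le_closure (Hb.mem_graph j)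
    obtain ⟨u, hu, hu'⟩ := (LinearPMap.mem_graph_iff _).1 h1
    have h2 := hR u
    rw [hu', hu, sub_self, map_zero] at h2
    exact Hb.ne_zero j h2.symm

/-- Coefficients of an eigenvector vanish away from the indices with `l j = x`. There are finitely
many of these, so every choice of coefficients on them is realised by a finite sum in the domain. -/
theorem IsDiagonal.eigenMultiplicity_closure [CompleteSpace K] (H : IsDiagonal S v l) (x : ℝ) :
    eigenMultiplicity S.closure (x : ℂ) = {j | l j = x}.ncard := by
  obtain ⟨b, Hb⟩ := H.exists_basis
  have hfin : {j | l j = x}.Finite := (H.finite |x|).subset fun j hj => by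
    have : l j = x := hj
    simp [this]
  have := hfin.fintype
  have key : ∀ u : S.closure.domain, u ∈ eigenspace S.closure (x : ℂ) ↔
      ∀ j, l j ≠ x → b.repr (u : K) j = 0 := by
    intro u
    have h1 := (Hb.mem_graph_closure_iff (x := u) (y := S.closure u)).1 (LinearPMap.mem_graph _ u)
    have h2 : u ∈ eigenspace S.closure (x : ℂ) ↔ S.closure u = (x : ℂ) • (u : K) := by
      rw [eigenspace, LinearMap.mem_ker, LinearMap.sub_apply, sub_eq_zero]; rfl
    rw [h2]
    constructor
    · intro h3 j hj
      have h4 := h1 j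
      rw [h3] at h4
      simp only [map_smul, lp.coeFn_smul, Pi.smul_apply, smul_eq_mul] at h4
      have h5 : ((l j : ℂ) - x) * b.repr (u : K) j = 0 := by rw [sub_mul, h4, sub_self]
      rcases mul_eq_zero.1 h5 with h6 | h6
      · exact absurd (by exact_mod_cast sub_eq_zero.1 h6) hj
      · exact h6
    · intro h3
      refine hilbertBasis_ext b fun j => ?_
      simp only [h1, map_smul, lp.coeFn_smul, Pi.smul_apply, smul_eq_mul]
      by_cases hj : l j = x
      · rw [hj]
      · simp [h3 j hj]
  let L : eigenspace S.closure (x : ℂ) →ₗ[ℂ] ({j | l j = x} → ℂ) :=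
    { toFun := fun u j => b.repr (u.1 : K) j
      map_add' := fun u w => by ext j; simp
      map_smul' := fun c u => by ext j; simp }
  have hL : Function.Bijective L := by
    constructor
    · refine (injective_iff_map_eq_zero L).2 fun u hu => ?_
      refine Subtype.ext (Subtype.ext (hilbertBasis_ext b fun j => ?_))
      have hz : b.repr (((0 : eigenspace S.closure (x : ℂ)) : S.closure.domain) : K) j = 0 := by
        simp
      rw [hz]
      by_cases hj : l j = x
      · exact congrFun hu ⟨j, hj⟩
      · exact (key u.1).1 u.2 j hj
    · classical
      intro c
      have hg : (∑ j : {j | l j = x}, c j • b j.1, (x : ℂ) • ∑ j : {j | l j = x}, c j • b j.1)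
          ∈ S.closure.graph := by
        have hs : (∑ j : {j | l j = x}, c j • b j.1, (x : ℂ) • ∑ j : {j | l j = x}, c j • b j.1)
            = ∑ j : {j | l j = x}, (c j • b j.1, (x : ℂ) • c j • b j.1) := by
          simp [Prod.ext_iff, Prod.fst_sum, Prod.snd_sum, Finset.smul_sum]
        rw [hs]
        refine Submodule.sum_mem _ fun j _ => ?_
        have h1 := S.closure.graph.smul_mem (c j)
          (LinearPMap.le_graph_of_le S.le_closure (Hb.mem_graph j))
        rwa [Prod.smul_mk, smul_comm, show l j.1 = x from j.2] at h1
      obtain ⟨u, hu, hu'⟩ := (LinearPMap.mem_graph_iff _).1 hg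
      have hmem : u ∈ eigenspace S.closure (x : ℂ) := by
        rw [eigenspace, LinearMap.mem_ker, LinearMap.sub_apply, sub_eq_zero]
        change S.closure u = (x : ℂ) • (u : K)
        rw [hu', hu]
      refine ⟨⟨u, hmem⟩, ?_⟩
      ext j
      change b.repr (u : K) j = c j
      rw [hu, HilbertBasis.repr_apply_apply, inner_sum, Finset.sum_eq_single j]
      · rw [inner_smul_right, inner_self_eq_norm_sq_to_K, b.orthonormal.1]; simp
      · intro i _ hij
        rw [inner_smul_right, b.orthonormal.2 (fun h => hij (Subtype.ext h.symm)), mul_zero]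
      · simp
  rw [eigenMultiplicity, (LinearEquiv.ofBijective L hL).finrank_eq, Module.finrank_fintype_fun_eq_card,
    Set.ncard_eq_toFinset_card', Set.toFinset_card]

end Diagonal

/-! ### Smooth vectors and the infinitesimal representation. -/

section SmoothVectors

variable (h : ℝ)

/-- The smooth vectors of `ρ_h`. -/
def smoothSubspace : Submodule ℂ L2R where
  carrier := {u | orbit h u ∈ SmoothFun L2R}
  add_mem' := fun {u v} hu hv => by
    have : orbit h (u + v) = orbit h u + orbit h v := by
      funext g; simp [orbit]
    change orbit h (u + v) ∈ SmoothFun L2R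
    rw [this]; exact (SmoothFun L2R).add_mem hu hv
  zero_mem' := by
    have : orbit h (0 : L2R) = 0 := by
      funext g; simp [orbit]
    change orbit h (0 : L2R) ∈ SmoothFun L2R
    rw [this]; exact (SmoothFun L2R).zero_mem
  smul_mem' := fun c u hu => by
    have : orbit h (c • u) = c • orbit h u := by
      funext g; simp [orbit]
    change orbit h (c • u) ∈ SmoothFun L2R
    rw [this]; exact (SmoothFun L2R).smul_mem c hu

/-- The orbit map of a smooth vector as a smooth function. -/
noncomputable def smoothOrbit : smoothSubspace h →ₗ[ℂ] SmoothFun L2R where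
  toFun u := ⟨orbit h u, u.2⟩
  map_add' u v := by
    apply Subtype.ext; funext g; simp [orbit]
  map_smul' c u := by
    apply Subtype.ext; funext g; simp [orbit]

theorem orbit_mul (g g' : Heisenberg) (u : L2R) :
    orbit h u (g * g') = schrodinger h g (orbit h u g') := by
  simp [orbit, map_mul]

@[simp] theorem orbit_one (u : L2R) : orbit h u 1 = u := by
  simp [orbit]

theorem coord_one : coord 1 = 0 := rfl

theorem ofCoord_zero : ofCoord 0 = 1 := rfl

/-- The derivative of left translation by `g` in coordinates. -/
theorem hasFDerivAt_leftMul (g : Heisenberg) (p : ℝ × ℝ × ℝ) :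
    HasFDerivAt (fun p : ℝ × ℝ × ℝ => coord (g * ofCoord p))
      ((ContinuousLinearMap.fst ℝ ℝ (ℝ × ℝ)).prod
        (((ContinuousLinearMap.fst ℝ ℝ ℝ).comp (ContinuousLinearMap.snd ℝ ℝ (ℝ × ℝ))).prod
          ((ContinuousLinearMap.snd ℝ ℝ ℝ).comp (ContinuousLinearMap.snd ℝ ℝ (ℝ × ℝ)) +
            g.a • (ContinuousLinearMap.fst ℝ ℝ ℝ).comp
              (ContinuousLinearMap.snd ℝ ℝ (ℝ × ℝ))))) p := by
  have h1 : HasFDerivAt (fun p : ℝ × ℝ × ℝ => p.1) (ContinuousLinearMap.fst ℝ ℝ (ℝ × ℝ)) p :=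
    hasFDerivAt_fst
  have h2 : HasFDerivAt (fun p : ℝ × ℝ × ℝ => p.2.1)
      ((ContinuousLinearMap.fst ℝ ℝ ℝ).comp (ContinuousLinearMap.snd ℝ ℝ (ℝ × ℝ))) p :=
    ((ContinuousLinearMap.fst ℝ ℝ ℝ).comp (ContinuousLinearMap.snd ℝ ℝ (ℝ × ℝ))).hasFDerivAt
  have h3 : HasFDerivAt (fun p : ℝ × ℝ × ℝ => p.2.2)
      ((ContinuousLinearMap.snd ℝ ℝ ℝ).comp (ContinuousLinearMap.snd ℝ ℝ (ℝ × ℝ))) p :=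
    ((ContinuousLinearMap.snd ℝ ℝ ℝ).comp (ContinuousLinearMap.snd ℝ ℝ (ℝ × ℝ))).hasFDerivAt
  exact (h1.const_add g.a).prodMk ((h2.const_add g.b).prodMk
    ((h3.const_add g.t).add (h2.const_mul g.a)))

/-- Left invariance: left translation of the orbit map by `g` is composition with the bounded
operator `ρ_h(g)`, which commutes with differentiation. The two sides are the derivatives of one
function computed by two chain rules. -/
theorem leftField_orbit (v : ℝ × ℝ × ℝ) (u : smoothSubspace h) (g : Heisenberg) :
    (leftField L2R v (smoothOrbit h u)).1 g =
      schrodinger h g ((leftField L2R v (smoothOrbit h u)).1 1) := by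
  let F : ℝ × ℝ × ℝ → L2R := orbit h (u : L2R) ∘ ofCoord
  have hF : ∀ p, HasFDerivAt F (fderiv ℝ F p) p := fun p =>
    (smoothFun_differentiableAt (smoothOrbit h u) p).hasFDerivAt
  have hg : coord (g * ofCoord 0) = coord g := by rw [ofCoord_zero, mul_one]
  have h1 : HasFDerivAt (F ∘ fun p : ℝ × ℝ × ℝ => coord (g * ofCoord p)) _ (0 : ℝ × ℝ × ℝ) :=
    HasFDerivAt.comp (f := fun p : ℝ × ℝ × ℝ => coord (g * ofCoord p)) (0 : ℝ × ℝ × ℝ)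
      (hF (coord (g * ofCoord 0))) (hasFDerivAt_leftMul g 0)
  have h2 : HasFDerivAt (fun p => schrodinger h g (F p))
      (((schrodinger h g).toContinuousLinearEquiv.toContinuousLinearMap.restrictScalars ℝ).comp
        (fderiv ℝ F 0)) 0 :=
    ((schrodinger h g).toContinuousLinearEquiv.toContinuousLinearMap.restrictScalars
      ℝ).hasFDerivAt.comp (0 : ℝ × ℝ × ℝ) (hF 0)
  have h3 : (F ∘ fun p : ℝ × ℝ × ℝ => coord (g * ofCoord p)) =
      fun p => schrodinger h g (F p) := by
    funext p
    exact orbit_mul h g (ofCoord p) u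
  rw [h3] at h1
  have h4 := DFunLike.congr_fun (h1.unique h2) v
  rw [hg] at h4
  have h5 : (v.1, v.2.1, v.2.2 + g.a * v.2.1) = (v.1, v.2.1, v.2.2 + g.a • v.2.1) := rfl
  change fderiv ℝ F (coord g) (v.1, v.2.1, v.2.2 + g.a * v.2.1) =
    schrodinger h g (fderiv ℝ F 0 (v.1, v.2.1, v.2.2 + 0 * v.2.1))
  rw [h5, zero_mul, add_zero]
  exact h4

/-- The operator `dρ_h(v)` on smooth vectors. -/
noncomputable def opField (v : ℝ × ℝ × ℝ) : Module.End ℂ (smoothSubspace h) where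
  toFun u := ⟨(leftField L2R v (smoothOrbit h u)).1 1, by
    have : orbit h ((leftField L2R v (smoothOrbit h u)).1 1) =
        (leftField L2R v (smoothOrbit h u)).1 :=
      funext fun g => (leftField_orbit h v u g).symm
    change orbit h _ ∈ SmoothFun L2R
    rw [this]
    exact (leftField L2R v (smoothOrbit h u)).2⟩
  map_add' u w := by
    apply Subtype.ext
    simp only [map_add]; rfl
  map_smul' c u := by
    apply Subtype.ext
    simp only [map_smul]; rfl

/-- This intertwining lets products of invariant fields be localised factor by factor. -/
theorem leftField_smoothOrbit (v : ℝ × ℝ × ℝ) (u : smoothSubspace h) :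
    leftField L2R v (smoothOrbit h u) = smoothOrbit h (opField h v u) :=
  Subtype.ext (funext fun g => leftField_orbit h v u g)

/-- The operator `dρ_h(v)` is the derivative of the orbit map at the unit element. -/
theorem coe_opField (v : ℝ × ℝ × ℝ) (u : smoothSubspace h) :
    (opField h v u : L2R) = fderiv ℝ (orbit h (u : L2R) ∘ ofCoord) 0 v := by
  change fderiv ℝ (orbit h (u : L2R) ∘ ofCoord) 0 (v.1, v.2.1, v.2.2 + 0 * v.2.1) = _
  rw [zero_mul, add_zero]

theorem hasFDerivAt_orbit_zero (u : smoothSubspace h) :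
    HasFDerivAt (orbit h (u : L2R) ∘ ofCoord) (fderiv ℝ (orbit h (u : L2R) ∘ ofCoord) 0) 0 :=
  (smoothFun_differentiableAt (smoothOrbit h u) 0).hasFDerivAt

/-- `dρ_h(v)` is skew symmetric. -/
theorem inner_opField_left (v : ℝ × ℝ × ℝ) (u w : smoothSubspace h) :
    inner ℂ (opField h v u : L2R) (w : L2R) = - inner ℂ (u : L2R) (opField h v w : L2R) := by
  have h1 := (hasFDerivAt_orbit_zero h u).inner ℂ (hasFDerivAt_orbit_zero h w)
  -- By unitarity the pairing of two orbit maps is constant, so its derivative vanishes.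
  have h2 : (fun p => inner ℂ ((orbit h (u : L2R) ∘ ofCoord) p) ((orbit h (w : L2R) ∘ ofCoord) p))
      = fun _ => inner ℂ (u : L2R) (w : L2R) := by
    funext p
    exact (schrodinger h (ofCoord p)).inner_map_map _ _
  rw [h2] at h1
  have h3 := DFunLike.congr_fun (h1.unique (hasFDerivAt_const _ _)) v
  simp only [ContinuousLinearMap.comp_apply, ContinuousLinearMap.prod_apply,
    fderivInnerCLM_apply, ← coe_opField, Function.comp_apply, ofCoord_zero, orbit_one,
    zero_apply] at h3
  exact eq_neg_of_add_eq_zero_right h3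

theorem schrodinger_central (t : ℝ) (u : L2R) :
    schrodinger h ⟨0, 0, t⟩ u = Complex.exp ((2 * Real.pi * h * t : ℝ) * Complex.I) • u := by
  refine Lp.ext ((coeFn_schrodingerOp h ⟨0, 0, t⟩ u).trans
    (Filter.EventuallyEq.trans ?_ (Lp.coeFn_smul _ _).symm))
  refine Filter.Eventually.of_forall fun x => ?_
  simp [schrodingerFun, phase, mul_assoc]

theorem hasDerivAt_centralCharacter :
    HasDerivAt (fun t : ℝ => Complex.exp ((2 * Real.pi * h * t : ℝ) * Complex.I))
      ((2 * Real.pi * h : ℝ) * Complex.I) 0 := by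
  have h5 : HasDerivAt (fun t : ℝ => ((2 * Real.pi * h * t : ℝ) * Complex.I : ℂ))
      ((2 * Real.pi * h : ℝ) * Complex.I) 0 := by
    have := ((hasDerivAt_id (0 : ℝ)).const_mul (2 * Real.pi * h)).ofReal_comp.mul_const
      Complex.I
    simpa using this
  simpa using h5.cexp

theorem opField_central (u : smoothSubspace h) :
    opField h (0, 0, 1) u = ((2 * Real.pi * h : ℝ) * Complex.I : ℂ) • u := by
  apply Subtype.ext
  rw [coe_opField]
  have h1 : HasDerivAt (fun t : ℝ => ((0, 0, t) : ℝ × ℝ × ℝ)) (0, 0, 1) 0 :=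
    (hasDerivAt_const _ _).prodMk ((hasDerivAt_const _ _).prodMk (hasDerivAt_id _))
  have h2 := HasFDerivAt.comp_hasDerivAt (f := fun t : ℝ => ((0, 0, t) : ℝ × ℝ × ℝ)) (0 : ℝ)
    (hasFDerivAt_orbit_zero h u) h1
  have h3 : ((orbit h (u : L2R) ∘ ofCoord) ∘ fun t : ℝ => ((0, 0, t) : ℝ × ℝ × ℝ)) =
      fun t : ℝ => Complex.exp ((2 * Real.pi * h * t : ℝ) * Complex.I) • (u : L2R) := by
    funext t; exact schrodinger_central h t u
  rw [h3] at h2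
  exact h2.unique ((hasDerivAt_centralCharacter h).smul_const (u : L2R))

end SmoothVectors

/-! ### Matrices of operators: localisation and formal adjoints. -/

section Matrices

/-- The action of a matrix of operators on tuples of vectors. -/
def act {W : Type*} [AddCommGroup W] [Module ℂ W] {m n : ℕ}
    (Q : Matrix (Fin m) (Fin n) (Module.End ℂ W)) (u : Fin n → W) : Fin m → W :=
  fun i => ∑ j, Q i j (u j)

section

variable {W : Type*} [AddCommGroup W] [Module ℂ W] {l m n : ℕ}

theorem act_add_left (P Q : Matrix (Fin m) (Fin n) (Module.End ℂ W)) (u : Fin n → W) :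
    act (P + Q) u = act P u + act Q u := by
  funext i; simp [act, Finset.sum_add_distrib]

theorem act_mul (P : Matrix (Fin l) (Fin m) (Module.End ℂ W))
    (Q : Matrix (Fin m) (Fin n) (Module.End ℂ W)) (u : Fin n → W) :
    act (P * Q) u = act P (act Q u) := by
  funext i
  simp only [act, Matrix.mul_apply, LinearMap.sum_apply, map_sum, Module.End.mul_apply]
  exact Finset.sum_comm

theorem act_add (P : Matrix (Fin m) (Fin n) (Module.End ℂ W)) (u w : Fin n → W) :
    act P (u + w) = act P u + act P w := by
  funext i; simp [act, Finset.sum_add_distrib]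

theorem act_smul (P : Matrix (Fin m) (Fin n) (Module.End ℂ W)) (c : ℂ) (u : Fin n → W) :
    act P (c • u) = c • act P u := by
  funext i; simp [act, Finset.smul_sum]

end

variable {h : ℝ} {l m n : ℕ}

/-- The matrix `P` of operators on smooth functions restricts to the matrix `Q` of operators on
orbit maps of smooth vectors. -/
def Localises (h : ℝ) (P : Matrix (Fin m) (Fin n) (Module.End ℂ (SmoothFun L2R)))
    (Q : Matrix (Fin m) (Fin n) (Module.End ℂ (smoothSubspace h))) : Prop :=
  ∀ i j u, P i j (smoothOrbit h u) = smoothOrbit h (Q i j u)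

theorem Localises.add {P P' : Matrix (Fin m) (Fin n) (Module.End ℂ (SmoothFun L2R))}
    {Q Q' : Matrix (Fin m) (Fin n) (Module.End ℂ (smoothSubspace h))}
    (hP : Localises h P Q) (hP' : Localises h P' Q') : Localises h (P + P') (Q + Q') := by
  intro i j u
  simp only [Matrix.add_apply, LinearMap.add_apply, hP i j u, hP' i j u, map_add]

theorem Localises.mul {P : Matrix (Fin l) (Fin m) (Module.End ℂ (SmoothFun L2R))}
    {P' : Matrix (Fin m) (Fin n) (Module.End ℂ (SmoothFun L2R))}
    {Q : Matrix (Fin l) (Fin m) (Module.End ℂ (smoothSubspace h))}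
    {Q' : Matrix (Fin m) (Fin n) (Module.End ℂ (smoothSubspace h))}
    (hP : Localises h P Q) (hP' : Localises h P' Q') : Localises h (P * P') (Q * Q') := by
  intro i j u
  simp only [Matrix.mul_apply, LinearMap.sum_apply, Module.End.mul_apply, map_sum]
  exact Finset.sum_congr rfl fun s _ => by rw [hP' s j u, hP i s]

/-- `Q'` is the formal adjoint of `Q`. -/
def IsFormalAdjoint (Q : Matrix (Fin m) (Fin n) (Module.End ℂ (smoothSubspace h)))
    (Q' : Matrix (Fin n) (Fin m) (Module.End ℂ (smoothSubspace h))) : Prop :=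
  ∀ i j (u w : smoothSubspace h),
    inner ℂ (w : L2R) (Q i j u : L2R) = inner ℂ (Q' j i w : L2R) (u : L2R)

theorem IsFormalAdjoint.add {P Q : Matrix (Fin m) (Fin n) (Module.End ℂ (smoothSubspace h))}
    {P' Q' : Matrix (Fin n) (Fin m) (Module.End ℂ (smoothSubspace h))}
    (hP : IsFormalAdjoint P P') (hQ : IsFormalAdjoint Q Q') :
    IsFormalAdjoint (P + Q) (P' + Q') := by
  intro i j u w
  simp only [Matrix.add_apply, LinearMap.add_apply, Submodule.coe_add, inner_add_left,
    inner_add_right, hP i j u w, hQ i j u w]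

theorem IsFormalAdjoint.mul {P : Matrix (Fin l) (Fin m) (Module.End ℂ (smoothSubspace h))}
    {Q : Matrix (Fin m) (Fin n) (Module.End ℂ (smoothSubspace h))}
    {P' : Matrix (Fin m) (Fin l) (Module.End ℂ (smoothSubspace h))}
    {Q' : Matrix (Fin n) (Fin m) (Module.End ℂ (smoothSubspace h))}
    (hP : IsFormalAdjoint P P') (hQ : IsFormalAdjoint Q Q') :
    IsFormalAdjoint (P * Q) (Q' * P') := by
  intro i j u w
  simp only [Matrix.mul_apply, LinearMap.sum_apply, Module.End.mul_apply,
    Submodule.coe_sum, inner_sum, sum_inner]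
  exact Finset.sum_congr rfl fun s _ => by rw [hP i s, hQ s j]

/-- A tuple of smooth vectors as an element of the Hilbert space. -/
noncomputable def toForms (u : Fin n → smoothSubspace h) : L2Forms n :=
  WithLp.toLp 2 fun i => (u i : L2R)

theorem toForms_apply (u : Fin n → smoothSubspace h) (i : Fin n) : toForms u i = (u i : L2R) := rfl

theorem toForms_smul (c : ℂ) (u : Fin n → smoothSubspace h) :
    toForms (c • u) = c • toForms u := rfl

theorem toForms_eq_zero {u : Fin n → smoothSubspace h} : toForms u = 0 ↔ u = 0 := by
  constructor
  · intro hu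
    funext i
    exact Subtype.ext (congrArg (fun x : L2Forms n => x i) hu)
  · rintro rfl; rfl

theorem inner_toForms (x : L2Forms n) (u : Fin n → smoothSubspace h) :
    inner ℂ (toForms u) x = ∑ i, inner ℂ (u i : L2R) (x i) := rfl

theorem IsFormalAdjoint.inner_act {Q : Matrix (Fin m) (Fin n) (Module.End ℂ (smoothSubspace h))}
    {Q' : Matrix (Fin n) (Fin m) (Module.End ℂ (smoothSubspace h))}
    (hQ : IsFormalAdjoint Q Q') (w : Fin m → smoothSubspace h) (u : Fin n → smoothSubspace h) :
    inner ℂ (toForms w) (toForms (act Q u)) = inner ℂ (toForms (act Q' w)) (toForms u) := by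
  simp only [inner_toForms, toForms_apply, act, Submodule.coe_sum, inner_sum, sum_inner]
  rw [Finset.sum_comm]
  exact Finset.sum_congr rfl fun j _ => Finset.sum_congr rfl fun i _ => hQ i j (u j) (w i)

theorem mem_graph_localiseSmooth {P : Matrix (Fin n) (Fin n) (Module.End ℂ (SmoothFun L2R))}
    {Q : Matrix (Fin n) (Fin n) (Module.End ℂ (smoothSubspace h))} (hP : Localises h P Q)
    (u : Fin n → smoothSubspace h) :
    (toForms u, toForms (act Q u)) ∈ (localiseSmooth h P).graph := by
  have hu : toForms u ∈ (localiseSmooth h P).domain := fun i => (u i).2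
  rw [LinearPMap.mem_graph_iff]
  refine ⟨⟨toForms u, hu⟩, rfl, ?_⟩
  refine PiLp.ext fun i => ?_
  change evalOne ((∑ j, P i j ∘ₗ LinearMap.proj j) (fun j => smoothOrbit h (u j))) =
    ((act Q u i : smoothSubspace h) : L2R)
  simp only [LinearMap.sum_apply, LinearMap.comp_apply, LinearMap.proj_apply, map_sum, hP i _ _,
    act, Submodule.coe_sum]
  exact Finset.sum_congr rfl fun j _ => orbit_one h _

theorem exists_eq_toForms {P : Matrix (Fin n) (Fin n) (Module.End ℂ (SmoothFun L2R))}
    {Q : Matrix (Fin n) (Fin n) (Module.End ℂ (smoothSubspace h))} (hP : Localises h P Q)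
    (x : (localiseSmooth h P).domain) :
    ∃ u : Fin n → smoothSubspace h, (x : L2Forms n) = toForms u ∧
      localiseSmooth h P x = toForms (act Q u) := by
  let u : Fin n → smoothSubspace h := fun i => ⟨x.1 i, x.2 i⟩
  refine ⟨u, rfl, ?_⟩
  exact LinearPMap.mem_graph_snd_inj _ (LinearPMap.mem_graph _ x)
    (mem_graph_localiseSmooth hP u) rfl

/-- A total orthogonal family of smooth eigenvectors diagonalises the localisation of a formally
selfadjoint matrix of operators. -/
theorem isDiagonal_localiseSmooth {ι : Type*}
    {P : Matrix (Fin n) (Fin n) (Module.End ℂ (SmoothFun L2R))}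
    {Q : Matrix (Fin n) (Fin n) (Module.End ℂ (smoothSubspace h))}
    (hP : Localises h P Q) (hQ : IsFormalAdjoint Q Q)
    {v : ι → Fin n → smoothSubspace h} {r : ι → ℝ}
    (hv : ∀ j, act Q (v j) = (r j : ℂ) • v j) (h0 : ∀ j, v j ≠ 0)
    (ho : Pairwise fun i j => inner ℂ (toForms (v i)) (toForms (v j)) = 0)
    (ht : ∀ x, (∀ j, inner ℂ (toForms (v j)) x = 0) → x = 0)
    (hf : ∀ C : ℝ, {j | |r j| ≤ C}.Finite) :
    IsDiagonal (localiseSmooth h P) (fun j => toForms (v j)) r where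
  mem_graph j := by
    have := mem_graph_localiseSmooth hP (v j)
    rwa [hv, toForms_smul] at this
  symm j u := by
    obtain ⟨w, hw, hw'⟩ := exists_eq_toForms hP u
    rw [hw, hw', hQ.inner_act, hv, toForms_smul, inner_smul_left, Complex.conj_ofReal]
  ne_zero j := fun h1 => h0 j (toForms_eq_zero.1 h1)
  orthogonal := ho
  total := ht
  finite := hf

end Matrices

/-! ### Polynomials times a Gaussian: decay and Taylor estimates. -/

section PolynomialGaussian

open Polynomial

/-- The function `x ↦ p(x) exp (- c x² / 2)`. -/
noncomputable def polyGauss (c : ℝ) (p : ℂ[X]) (x : ℝ) : ℂ :=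
  p.eval (x : ℂ) * (Real.exp (-(c / 2) * x ^ 2) : ℂ)

variable {c : ℝ}

/-- Uses `|x|ⁿ ≤ 1 + x²ⁿ` together with `yⁿ / n! ≤ exp y` at `y = c x² / 2`. -/
theorem norm_pow_mul_exp_le (hc : 0 < c) (n : ℕ) :
    ∃ C : ℝ, ∀ x : ℝ, |x| ^ n * Real.exp (-(c / 2) * x ^ 2) ≤ C := by
  refine ⟨1 + n.factorial / (c / 2) ^ n, fun x => ?_⟩
  have hx : (0 : ℝ) ≤ c / 2 * x ^ 2 := by positivity
  have h1 := Real.pow_div_factorial_le_exp (c / 2 * x ^ 2) hx n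
  have hf : (0 : ℝ) < n.factorial := by exact_mod_cast n.factorial_pos
  have hcn : 0 < (c / 2) ^ n := by positivity
  have hE : 0 < Real.exp (-(c / 2) * x ^ 2) := Real.exp_pos _
  have hEE : Real.exp (c / 2 * x ^ 2) * Real.exp (-(c / 2) * x ^ 2) = 1 := by
    rw [← Real.exp_add]; simp
  have h2 : (x ^ 2) ^ n * Real.exp (-(c / 2) * x ^ 2) ≤ n.factorial / (c / 2) ^ n := by
    rw [le_div_iff₀ hcn]
    rw [div_le_iff₀ hf, mul_pow] at h1
    calc (x ^ 2) ^ n * Real.exp (-(c / 2) * x ^ 2) * (c / 2) ^ n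
        = ((c / 2) ^ n * (x ^ 2) ^ n) * Real.exp (-(c / 2) * x ^ 2) := by ring
      _ ≤ (Real.exp (c / 2 * x ^ 2) * n.factorial) * Real.exp (-(c / 2) * x ^ 2) := by gcongr
      _ = n.factorial := by rw [mul_right_comm, hEE, one_mul]
  have h3 : |x| ^ n ≤ 1 + (x ^ 2) ^ n := by
    rw [← sq_abs, ← pow_mul, mul_comm, pow_mul]
    nlinarith [sq_nonneg (|x| ^ n - 1), sq_nonneg (|x| ^ n)]
  have h4 : Real.exp (-(c / 2) * x ^ 2) ≤ 1 := by
    rw [Real.exp_le_one_iff]; linarith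
  nlinarith

theorem polyGauss_add (p q : ℂ[X]) (x : ℝ) :
    polyGauss c (p + q) x = polyGauss c p x + polyGauss c q x := by
  simp [polyGauss, add_mul]

theorem polyGauss_C_mul (a : ℂ) (p : ℂ[X]) (x : ℝ) :
    polyGauss c (C a * p) x = a * polyGauss c p x := by
  simp [polyGauss, mul_assoc]

theorem polyGauss_X_mul (p : ℂ[X]) (x : ℝ) :
    polyGauss c (X * p) x = x * polyGauss c p x := by
  simp [polyGauss, mul_assoc]

theorem continuous_polyGauss (p : ℂ[X]) : Continuous (polyGauss c p) := by
  unfold polyGauss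
  have h1 : Continuous fun x : ℝ => p.eval (x : ℂ) := p.continuous.comp Complex.continuous_ofReal
  exact h1.mul (by fun_prop)

theorem exists_norm_polyGauss_le (hc : 0 < c) (p : ℂ[X]) :
    ∃ C : ℝ, ∀ x : ℝ, ‖polyGauss c p x‖ ≤ C := by
  induction p using Polynomial.induction_on' with
  | add p q hp hq =>
    obtain ⟨A, hA⟩ := hp
    obtain ⟨B, hB⟩ := hq
    refine ⟨A + B, fun x => ?_⟩
    rw [polyGauss_add]
    exact (norm_add_le _ _).trans (add_le_add (hA x) (hB x))
  | monomial n a =>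
    obtain ⟨C, hC⟩ := norm_pow_mul_exp_le hc n
    refine ⟨‖a‖ * C, fun x => ?_⟩
    have h1 : ‖polyGauss c (monomial n a) x‖ =
        ‖a‖ * (|x| ^ n * Real.exp (-(c / 2) * x ^ 2)) := by
      rw [polyGauss, eval_monomial, norm_mul, norm_mul, norm_pow, Complex.norm_real,
        Complex.norm_real, Real.norm_eq_abs, Real.norm_eq_abs, Real.abs_exp, mul_assoc]
    rw [h1]
    exact mul_le_mul_of_nonneg_left (hC x) (norm_nonneg a)

/-- The uniform bound is applied to the polynomial `(1 + X²) p`. -/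
theorem exists_norm_polyGauss_le_inv (hc : 0 < c) (p : ℂ[X]) :
    ∃ C : ℝ, 0 ≤ C ∧ ∀ x : ℝ, ‖polyGauss c p x‖ ≤ C * (1 + x ^ 2)⁻¹ := by
  obtain ⟨C, hC⟩ := exists_norm_polyGauss_le hc (p + X * (X * p))
  refine ⟨C, (norm_nonneg _).trans (hC 0), fun x => ?_⟩
  have h1 : polyGauss c (p + X * (X * p)) x = ((1 + x ^ 2 : ℝ) : ℂ) * polyGauss c p x := by
    rw [polyGauss_add, polyGauss_X_mul, polyGauss_X_mul]; push_cast; ring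
  have h2 := hC x
  have hpos : (0 : ℝ) < 1 + x ^ 2 := by positivity
  rw [h1, norm_mul, Complex.norm_real, Real.norm_of_nonneg hpos.le] at h2
  rw [← div_eq_mul_inv, le_div_iff₀ hpos]
  linarith

theorem memLp_inv_one_add_sq : MemLp (fun x : ℝ => ((1 + x ^ 2)⁻¹ : ℝ)) 2 volume := by
  have hm : AEStronglyMeasurable (fun x : ℝ => ((1 + x ^ 2)⁻¹ : ℝ)) volume :=
    integrable_inv_one_add_sq.1
  rw [memLp_two_iff_integrable_sq hm]
  refine integrable_inv_one_add_sq.mono (hm.pow 2) (Filter.Eventually.of_forall fun x => ?_)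
  have h0 : (0 : ℝ) < 1 + x ^ 2 := by positivity
  have h1 : (1 + x ^ 2 : ℝ)⁻¹ ≤ 1 := inv_le_one_of_one_le₀ (by nlinarith [sq_nonneg x])
  have h2 : (0 : ℝ) ≤ (1 + x ^ 2)⁻¹ := by positivity
  rw [Real.norm_of_nonneg (by positivity), Real.norm_of_nonneg h2]
  nlinarith

theorem memLp_polyGauss (hc : 0 < c) (p : ℂ[X]) : MemLp (polyGauss c p) 2 volume := by
  obtain ⟨C, -, hC⟩ := exists_norm_polyGauss_le_inv hc p
  refine memLp_inv_one_add_sq.of_le_mul (c := C) (continuous_polyGauss p).aestronglyMeasurable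
    (Filter.Eventually.of_forall fun x => ?_)
  rw [Real.norm_of_nonneg (by positivity : (0 : ℝ) ≤ (1 + x ^ 2)⁻¹)]
  exact hC x

/-- The constant in the comparison of the `L²` norm with the weighted supremum norm. -/
noncomputable def weightNorm : ℝ := ‖memLp_inv_one_add_sq.toLp _‖

/-- The weight `(1 + x²)⁻¹` is square integrable, so pointwise estimates against it give `L²`
estimates with the same dependence on the parameter. -/
theorem norm_le_mul_weightNorm {f : L2R} {C : ℝ} (hf : ∀ᵐ x, ‖f x‖ ≤ C * (1 + x ^ 2)⁻¹) :
    ‖f‖ ≤ C * weightNorm := by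
  refine Lp.norm_le_mul_norm_of_ae_le_mul ?_
  filter_upwards [hf, memLp_inv_one_add_sq.coeFn_toLp] with x h1 h2
  rw [h2, Real.norm_of_nonneg (by positivity : (0 : ℝ) ≤ (1 + x ^ 2)⁻¹)]
  exact h1

/-- Polynomials times a Gaussian as elements of `L²(ℝ)`. -/
noncomputable def polyGaussLp (hc : 0 < c) : ℂ[X] →ₗ[ℂ] L2R where
  toFun p := (memLp_polyGauss hc p).toLp _
  map_add' p q := by
    rw [← MemLp.toLp_add]
    exact MemLp.toLp_congr _ _ (Filter.Eventually.of_forall fun x => polyGauss_add p q x)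
  map_smul' a p := by
    rw [RingHom.id_apply, ← MemLp.toLp_const_smul]
    refine MemLp.toLp_congr _ _ (Filter.Eventually.of_forall fun x => ?_)
    rw [smul_eq_C_mul, polyGauss_C_mul]; rfl

theorem coeFn_polyGaussLp (hc : 0 < c) (p : ℂ[X]) :
    polyGaussLp hc p =ᵐ[volume] polyGauss c p :=
  MemLp.coeFn_toLp (memLp_polyGauss hc p)

/-- The derivative on polynomials times a Gaussian. -/
noncomputable def gaussDeriv (c : ℝ) (p : ℂ[X]) : ℂ[X] := derivative p - C (c : ℂ) * (X * p)

theorem hasDerivAt_polyGauss (p : ℂ[X]) (x : ℝ) :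
    HasDerivAt (polyGauss c p) (polyGauss c (gaussDeriv c p) x) x := by
  have h1 : HasDerivAt (fun x : ℝ => p.eval (x : ℂ)) ((derivative p).eval (x : ℂ)) x :=
    (p.hasDerivAt (x : ℂ)).comp_ofReal
  have h2 : HasDerivAt (fun x : ℝ => Real.exp (-(c / 2) * x ^ 2))
      (Real.exp (-(c / 2) * x ^ 2) * (-(c / 2) * (2 * x))) x := by
    have h3 : HasDerivAt (fun x : ℝ => -(c / 2) * x ^ 2) (-(c / 2) * (2 * x)) x := by
      simpa using (hasDerivAt_pow 2 x).const_mul (-(c / 2))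
    exact h3.exp
  have h4 := h1.mul h2.ofReal_comp
  refine h4.congr_deriv ?_
  simp only [polyGauss, gaussDeriv, eval_sub, eval_mul, eval_C, eval_X]
  push_cast
  ring

/-- Two applications of the mean value inequality on the ball of radius `|s|` around `x`: first to
the derivative, then to the function minus its linear part. -/
theorem exists_norm_taylor_polyGauss_le (hc : 0 < c) (p : ℂ[X]) :
    ∃ C : ℝ, 0 ≤ C ∧ ∀ x s : ℝ, |s| ≤ 1 →
      ‖polyGauss c p (x + s) - polyGauss c p x - s * polyGauss c (gaussDeriv c p) x‖ ≤
        C * s ^ 2 * (1 + x ^ 2)⁻¹ := by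
  obtain ⟨C, hC0, hC⟩ := exists_norm_polyGauss_le_inv hc (gaussDeriv c (gaussDeriv c p))
  refine ⟨3 * C, by positivity, fun x s hs => ?_⟩
  have hpos : (0 : ℝ) < 1 + x ^ 2 := by positivity
  have hmem : ∀ y ∈ Metric.closedBall x |s|, |y - x| ≤ |s| := fun y hy => by
    simpa [Real.dist_eq] using hy
  have h2 : ∀ y ∈ Metric.closedBall x |s|,
      ‖polyGauss c (gaussDeriv c (gaussDeriv c p)) y‖ ≤ 3 * C * (1 + x ^ 2)⁻¹ := by
    intro y hy
    refine (hC y).trans ?_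
    have hy1 : |y - x| ≤ 1 := (hmem y hy).trans hs
    have hy2 : (y - x) ^ 2 ≤ 1 := by
      rw [← sq_abs]; exact pow_le_one₀ (abs_nonneg _) hy1
    -- Moving the base point by at most `1` changes the weight by a factor of at most `3`: `x² ≤ 2
    -- y² + 2 (y - x)²`.
    have h3 : 1 + x ^ 2 ≤ 3 * (1 + y ^ 2) := by nlinarith [sq_nonneg (2 * y - x)]
    have hpos' : (0 : ℝ) < 1 + y ^ 2 := by positivity
    have h4 : (1 + y ^ 2 : ℝ)⁻¹ ≤ 3 * (1 + x ^ 2)⁻¹ := by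
      rw [← div_eq_mul_inv, le_div_iff₀ hpos, inv_mul_le_iff₀ hpos']
      linarith
    calc C * (1 + y ^ 2)⁻¹ ≤ C * (3 * (1 + x ^ 2)⁻¹) := by gcongr
      _ = 3 * C * (1 + x ^ 2)⁻¹ := by ring
  have hx : x ∈ Metric.closedBall x |s| := Metric.mem_closedBall_self (abs_nonneg s)
  have hxs : x + s ∈ Metric.closedBall x |s| := by simp
  have hconv : Convex ℝ (Metric.closedBall x |s|) := convex_closedBall x |s|
  have h5 : ∀ y ∈ Metric.closedBall x |s|,
      ‖polyGauss c (gaussDeriv c p) y - polyGauss c (gaussDeriv c p) x‖ ≤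
        3 * C * (1 + x ^ 2)⁻¹ * |s| := by
    intro y hy
    refine (hconv.norm_image_sub_le_of_norm_hasDerivWithin_le
      (fun z _ => (hasDerivAt_polyGauss (gaussDeriv c p) z).hasDerivWithinAt) h2 hx hy).trans ?_
    exact mul_le_mul_of_nonneg_left (hmem y hy) (by positivity)
  have h6 : ∀ y ∈ Metric.closedBall x |s|, HasDerivWithinAt
      (fun y : ℝ => polyGauss c p y - y * polyGauss c (gaussDeriv c p) x)
      (polyGauss c (gaussDeriv c p) y - polyGauss c (gaussDeriv c p) x)
      (Metric.closedBall x |s|) y := by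
    intro y _
    have h7 : HasDerivAt (fun y : ℝ => (y : ℂ) * polyGauss c (gaussDeriv c p) x)
        (polyGauss c (gaussDeriv c p) x) y := by
      simpa using ((hasDerivAt_id y).ofReal_comp.mul_const (polyGauss c (gaussDeriv c p) x))
    exact ((hasDerivAt_polyGauss p y).sub h7).hasDerivWithinAt
  have h8 := hconv.norm_image_sub_le_of_norm_hasDerivWithin_le h6 h5 hx hxs
  have h9 : polyGauss c p (x + s) - polyGauss c p x - s * polyGauss c (gaussDeriv c p) x =
      (polyGauss c p (x + s) - (x + s : ℝ) * polyGauss c (gaussDeriv c p) x) -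
        (polyGauss c p x - x * polyGauss c (gaussDeriv c p) x) := by
    push_cast; ring
  rw [h9]
  refine h8.trans (le_of_eq ?_)
  rw [add_sub_cancel_left, Real.norm_eq_abs, ← sq_abs s]
  ring

end PolynomialGaussian

/-! ### Derivatives of Gaussian orbit maps at the unit element. -/

section GaussOrbit

open Polynomial

variable {c : ℝ}

theorem hasDerivAt_zero_of_norm_le {E : Type*} [NormedAddCommGroup E] [NormedSpace ℝ E]
    {f : ℝ → E} {f' : E} {C d : ℝ} (hd : 0 < d)
    (hf : ∀ s, |s| ≤ d → ‖f s - f 0 - s • f'‖ ≤ C * s ^ 2) : HasDerivAt f f' 0 := by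
  rw [hasDerivAt_iff_isLittleO]
  have h1 : (fun s : ℝ => f s - f 0 - (s - 0) • f') =O[nhds 0] fun s => s ^ 2 := by
    refine Asymptotics.IsBigO.of_bound C ?_
    filter_upwards [Metric.closedBall_mem_nhds (0 : ℝ) hd] with s hs
    have hs' : |s| ≤ d := by simpa [Real.dist_eq] using hs
    simpa using hf s hs'
  refine h1.trans_isLittleO ?_
  have h2 := Asymptotics.isLittleO_pow_pow (𝕜 := ℝ) (m := 1) (n := 2) (by norm_num)
  simpa using h2

/-- The operator `dρ_h(X)` on polynomials times a Gaussian. -/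
noncomputable def polyOpX (h c : ℝ) (p : ℂ[X]) : ℂ[X] := C (h : ℂ) * gaussDeriv c p

/-- The operator `dρ_h(Y)` on polynomials times a Gaussian. -/
noncomputable def polyOpY (p : ℂ[X]) : ℂ[X] := C (2 * Real.pi * Complex.I) * (X * p)

theorem hasDerivAt_orbit_a (hc : 0 < c) (h : ℝ) (p : ℂ[X]) :
    HasDerivAt (fun a : ℝ => schrodinger h ⟨a, 0, 0⟩ (polyGaussLp hc p))
      (polyGaussLp hc (polyOpX h c p)) 0 := by
  obtain ⟨C, hC0, hC⟩ := exists_norm_taylor_polyGauss_le hc p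
  -- The translation is by `h s`; this radius keeps `|h s| ≤ 1`, as the Taylor estimate requires.
  refine hasDerivAt_zero_of_norm_le (C := C * h ^ 2 * weightNorm) (d := (1 + |h|)⁻¹)
    (by positivity) fun s hs => ?_
  have hs1 : |h * s| ≤ 1 := by
    have h0 : 0 < 1 + |h| := by positivity
    rw [← one_div, le_div_iff₀ h0] at hs
    rw [abs_mul]
    nlinarith [abs_nonneg s, abs_nonneg h]
  have h1 : schrodinger h ⟨0, 0, 0⟩ (polyGaussLp hc p) = polyGaussLp hc p :=
    schrodingerOp_one h _
  rw [h1]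
  refine (norm_le_mul_weightNorm (C := C * (h * s) ^ 2) ?_).trans (le_of_eq (by ring))
  have e1 := (coeFn_schrodingerOp h ⟨s, 0, 0⟩ (polyGaussLp hc p)).trans
    (schrodingerFun_congr h ⟨s, 0, 0⟩ (coeFn_polyGaussLp hc p))
  filter_upwards [Lp.coeFn_sub (schrodinger h ⟨s, 0, 0⟩ (polyGaussLp hc p) - polyGaussLp hc p)
    (s • polyGaussLp hc (polyOpX h c p)),
    Lp.coeFn_sub (schrodinger h ⟨s, 0, 0⟩ (polyGaussLp hc p)) (polyGaussLp hc p),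
    Lp.coeFn_smul s (polyGaussLp hc (polyOpX h c p)), coeFn_polyGaussLp hc p,
    coeFn_polyGaussLp hc (polyOpX h c p), e1] with x a1 a2 a3 a4 a5 a6
  have a6' : (schrodinger h ⟨s, 0, 0⟩ (polyGaussLp hc p)) x =
    schrodingerFun h ⟨s, 0, 0⟩ (polyGauss c p) x := a6
  rw [a1, Pi.sub_apply, a2, Pi.sub_apply, a3, Pi.smul_apply, a4, a5, a6']
  have h2 : schrodingerFun h ⟨s, 0, 0⟩ (polyGauss c p) x - polyGauss c p x -
      s • polyGauss c (polyOpX h c p) x = polyGauss c p (x + h * s) - polyGauss c p x -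
      (h * s : ℝ) * polyGauss c (gaussDeriv c p) x := by
    simp only [schrodingerFun, phase, polyOpX, polyGauss_C_mul, Complex.real_smul]
    push_cast
    simp
    ring
  rw [h2]
  exact hC x (h * s) hs1

/-- For `|y| ≤ 1` this is the Taylor remainder; for `|y| > 1` the triangle inequality gives `2 + |y|
≤ 3 y²`. A bound for all `y` is needed because `x` is unbounded in the phase. -/
theorem norm_exp_ofReal_mul_I_sub_one_sub_le (y : ℝ) :
    ‖Complex.exp (y * Complex.I) - 1 - y * Complex.I‖ ≤ 3 * y ^ 2 := by
  have hn : ‖(y * Complex.I : ℂ)‖ = |y| := by simp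
  rcases le_or_gt |y| 1 with hy | hy
  · have h1 := Complex.norm_exp_sub_one_sub_id_le (x := y * Complex.I) (by rw [hn]; exact hy)
    rw [hn, sq_abs] at h1
    nlinarith [sq_nonneg y]
  · have h1 := norm_sub_le (Complex.exp (y * Complex.I) - 1) (y * Complex.I)
    have h2 := norm_sub_le (Complex.exp (y * Complex.I)) 1
    rw [Complex.norm_exp_ofReal_mul_I, norm_one] at h2
    rw [hn] at h1
    nlinarith [sq_abs y]

theorem hasDerivAt_orbit_b (hc : 0 < c) (h : ℝ) (p : ℂ[X]) :
    HasDerivAt (fun b : ℝ => schrodinger h ⟨0, b, 0⟩ (polyGaussLp hc p))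
      (polyGaussLp hc (polyOpY p)) 0 := by
  -- The quadratic remainder of the phase carries a factor `x²`, absorbed here into the polynomial.
  obtain ⟨C, hC0, hC⟩ := exists_norm_polyGauss_le_inv hc (X * (X * p))
  refine hasDerivAt_zero_of_norm_le (C := 3 * C * (2 * Real.pi) ^ 2 * weightNorm) (d := 1)
    one_pos fun s hs => ?_
  have h1 : schrodinger h ⟨0, 0, 0⟩ (polyGaussLp hc p) = polyGaussLp hc p :=
    schrodingerOp_one h _
  rw [h1]
  refine (norm_le_mul_weightNorm (C := 3 * C * (2 * Real.pi * s) ^ 2) ?_).trans (le_of_eq (by ring))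
  have e1 := (coeFn_schrodingerOp h ⟨0, s, 0⟩ (polyGaussLp hc p)).trans
    (schrodingerFun_congr h ⟨0, s, 0⟩ (coeFn_polyGaussLp hc p))
  filter_upwards [Lp.coeFn_sub (schrodinger h ⟨0, s, 0⟩ (polyGaussLp hc p) - polyGaussLp hc p)
    (s • polyGaussLp hc (polyOpY p)),
    Lp.coeFn_sub (schrodinger h ⟨0, s, 0⟩ (polyGaussLp hc p)) (polyGaussLp hc p),
    Lp.coeFn_smul s (polyGaussLp hc (polyOpY p)), coeFn_polyGaussLp hc p,
    coeFn_polyGaussLp hc (polyOpY p), e1] with x a1 a2 a3 a4 a5 a6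
  have a6' : (schrodinger h ⟨0, s, 0⟩ (polyGaussLp hc p)) x =
    schrodingerFun h ⟨0, s, 0⟩ (polyGauss c p) x := a6
  rw [a1, Pi.sub_apply, a2, Pi.sub_apply, a3, Pi.smul_apply, a4, a5, a6']
  have h2 : schrodingerFun h ⟨0, s, 0⟩ (polyGauss c p) x - polyGauss c p x -
      s • polyGauss c (polyOpY p) x =
      (Complex.exp ((2 * Real.pi * s * x : ℝ) * Complex.I) - 1 -
        (2 * Real.pi * s * x : ℝ) * Complex.I) * polyGauss c p x := by
    simp only [schrodingerFun, phase, polyOpY, polyGauss_C_mul, polyGauss_X_mul,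
      Complex.real_smul]
    push_cast
    simp
    ring_nf
  rw [h2, norm_mul]
  have h3 := hC x
  rw [polyGauss_X_mul, polyGauss_X_mul, norm_mul, norm_mul, Complex.norm_real,
    Real.norm_eq_abs] at h3
  have h4 : ‖Complex.exp ((2 * Real.pi * s * x : ℝ) * Complex.I) - 1 -
        (2 * Real.pi * s * x : ℝ) * Complex.I‖ ≤ 3 * (2 * Real.pi * s * x) ^ 2 :=
    norm_exp_ofReal_mul_I_sub_one_sub_le _
  calc _ ≤ 3 * (2 * Real.pi * s * x) ^ 2 * ‖polyGauss c p x‖ := by gcongr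
    _ = 3 * (2 * Real.pi * s) ^ 2 * (|x| * (|x| * ‖polyGauss c p x‖)) := by
      rw [← mul_assoc |x|, abs_mul_abs_self]; ring
    _ ≤ 3 * (2 * Real.pi * s) ^ 2 * (C * (1 + x ^ 2)⁻¹) := by gcongr
    _ = _ := by ring

/-- In this order of the factors the cocycle `a b'` vanishes, so no correction to the central
coordinate appears. -/
theorem ofCoord_eq_mul (p : ℝ × ℝ × ℝ) :
    ofCoord p = (⟨0, 0, p.2.2⟩ : Heisenberg) * (⟨0, p.2.1, 0⟩ * ⟨p.1, 0, 0⟩) := by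
  simp [ofCoord, mul_def]

/-- The derivative at the unit element of an orbit map in terms of the derivatives along the three
coordinate axes. -/
noncomputable def orbitDeriv (x y z : L2R) : ℝ × ℝ × ℝ →L[ℝ] L2R :=
  (ContinuousLinearMap.fst ℝ ℝ (ℝ × ℝ)).smulRight x +
    ((ContinuousLinearMap.fst ℝ ℝ ℝ).comp (ContinuousLinearMap.snd ℝ ℝ (ℝ × ℝ))).smulRight y +
    ((ContinuousLinearMap.snd ℝ ℝ ℝ).comp (ContinuousLinearMap.snd ℝ ℝ (ℝ × ℝ))).smulRight z

theorem orbitDeriv_apply (x y z : L2R) (v : ℝ × ℝ × ℝ) :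
    orbitDeriv x y z v = v.1 • x + v.2.1 • y + v.2.2 • z := rfl

theorem hasFDerivAt_orbit_gauss_zero (hc : 0 < c) (h : ℝ) (p : ℂ[X]) :
    HasFDerivAt (orbit h (polyGaussLp hc p) ∘ ofCoord)
      (orbitDeriv (polyGaussLp hc (polyOpX h c p)) (polyGaussLp hc (polyOpY p))
        (((2 * Real.pi * h : ℝ) * Complex.I : ℂ) • polyGaussLp hc p)) 0 := by
  set u := polyGaussLp hc p with hu
  set x := polyGaussLp hc (polyOpX h c p) with hx
  set y := polyGaussLp hc (polyOpY p) with hy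
  have hA : HasFDerivAt (fun q : ℝ × ℝ × ℝ => schrodinger h ⟨q.1, 0, 0⟩ u) _
      (0 : ℝ × ℝ × ℝ) :=
    HasFDerivAt.comp (f := fun q : ℝ × ℝ × ℝ => q.1) (0 : ℝ × ℝ × ℝ)
      (hasDerivAt_orbit_a hc h p).hasFDerivAt hasFDerivAt_fst
  have hsnd1 : HasFDerivAt (fun q : ℝ × ℝ × ℝ => q.2.1)
      ((ContinuousLinearMap.fst ℝ ℝ ℝ).comp (ContinuousLinearMap.snd ℝ ℝ (ℝ × ℝ))) 0 :=
    ((ContinuousLinearMap.fst ℝ ℝ ℝ).comp (ContinuousLinearMap.snd ℝ ℝ (ℝ × ℝ))).hasFDerivAt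
  have hsnd2 : HasFDerivAt (fun q : ℝ × ℝ × ℝ => q.2.2)
      ((ContinuousLinearMap.snd ℝ ℝ ℝ).comp (ContinuousLinearMap.snd ℝ ℝ (ℝ × ℝ))) 0 :=
    ((ContinuousLinearMap.snd ℝ ℝ ℝ).comp (ContinuousLinearMap.snd ℝ ℝ (ℝ × ℝ))).hasFDerivAt
  have hB : ∀ r : ℂ[X], HasFDerivAt
      (fun q : ℝ × ℝ × ℝ => schrodinger h ⟨0, q.2.1, 0⟩ (polyGaussLp hc r)) _
      (0 : ℝ × ℝ × ℝ) := fun r =>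
    HasFDerivAt.comp (f := fun q : ℝ × ℝ × ℝ => q.2.1) (0 : ℝ × ℝ × ℝ)
      (hasDerivAt_orbit_b hc h r).hasFDerivAt hsnd1
  have h1 : ∀ v : L2R, schrodinger h ⟨0, 0, 0⟩ v = v := fun v => schrodingerOp_one h v
  -- Joint differentiability from the axis derivatives. The remainder splits as `ρ_b (ρ_a u - u - a
  -- x) + a (ρ_b x - x) + (ρ_b u - u - b y)`: the first term is small since `ρ_b` is isometric, the
  -- second by strong continuity.
  have hAB : HasFDerivAt
      (fun q : ℝ × ℝ × ℝ => schrodinger h ⟨0, q.2.1, 0⟩ (schrodinger h ⟨q.1, 0, 0⟩ u))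
      (orbitDeriv x y 0) 0 := by
    rw [hasFDerivAt_iff_isLittleO_nhds_zero]
    have e1 := (hasFDerivAt_iff_isLittleO_nhds_zero.1 hA)
    have e2 := (hasFDerivAt_iff_isLittleO_nhds_zero.1 (hB p))
    have e3 : (fun q : ℝ × ℝ × ℝ => q.1 • (schrodinger h ⟨0, q.2.1, 0⟩ x - x)) =o[nhds 0]
        fun q => q := by
      have e4 : Filter.Tendsto (fun q : ℝ × ℝ × ℝ => schrodinger h ⟨0, q.2.1, 0⟩ x - x)
          (nhds 0) (nhds 0) := by
        have := (hB (polyOpX h c p)).continuousAt.tendsto.sub_const x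
        simpa [h1, ← hx] using this
      have e5 : (fun q : ℝ × ℝ × ℝ => q.1) =O[nhds 0] fun q => ‖q‖ :=
        Asymptotics.IsBigO.of_bound 1 (Filter.Eventually.of_forall fun q => by
          simpa using norm_fst_le q)
      have e6 := e5.smul_isLittleO ((Asymptotics.isLittleO_one_iff ℝ).2 e4)
      refine Asymptotics.IsLittleO.of_norm_right ?_
      simpa using e6
    have e7 : (fun q : ℝ × ℝ × ℝ => schrodinger h ⟨0, q.2.1, 0⟩
        (schrodinger h ⟨q.1, 0, 0⟩ u - u - q.1 • x)) =o[nhds 0] fun q => q := by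
      refine Asymptotics.IsLittleO.of_norm_left (e1.norm_left.congr_left fun q => ?_)
      rw [LinearIsometryEquiv.norm_map]
      simp [h1, ← hx]
    refine ((e7.add e3).add e2).congr_left fun q => ?_
    have hs : ∀ g (r : ℝ) (v : L2R), schrodinger h g (r • v) = r • schrodinger h g v :=
      fun g r v => (schrodinger h g).toLinearEquiv.toLinearMap.map_smul_of_tower r v
    simp [h1, orbitDeriv_apply, hs, smul_sub, ← hu, ← hy]
    abel
  have hE : HasFDerivAt (fun q : ℝ × ℝ × ℝ =>
      Complex.exp ((2 * Real.pi * h * q.2.2 : ℝ) * Complex.I)) _ (0 : ℝ × ℝ × ℝ) :=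
    HasFDerivAt.comp (f := fun q : ℝ × ℝ × ℝ => q.2.2) (0 : ℝ × ℝ × ℝ)
      (hasDerivAt_centralCharacter h).hasFDerivAt hsnd2
  have h2 := hE.smul hAB
  have h3 : orbit h u ∘ ofCoord = fun q : ℝ × ℝ × ℝ =>
      Complex.exp ((2 * Real.pi * h * q.2.2 : ℝ) * Complex.I) •
        schrodinger h ⟨0, q.2.1, 0⟩ (schrodinger h ⟨q.1, 0, 0⟩ u) := by
    funext q
    rw [← schrodinger_central, Function.comp_apply, ofCoord_eq_mul, orbit_mul, orbit_mul]
    rfl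
  rw [h3]
  refine h2.congr_fderiv ?_
  refine ContinuousLinearMap.ext fun v => ?_
  simp [orbitDeriv_apply, h1]
  rw [← smul_smul, Complex.coe_smul]
  rfl

end GaussOrbit

/-! ### Smoothness of Gaussian vectors. -/

section GaussSmooth

open Polynomial

variable {c : ℝ}

/-- The scalar `2 π i h` by which the centre acts infinitesimally. -/
noncomputable def centralScalar (h : ℝ) : ℂ := (2 * Real.pi * h : ℝ) * Complex.I

/-- Translation by `g = ofCoord q` reduces to the unit element. The correction in the `b` slot
expresses `∂_b = Y - a T`. -/
theorem hasFDerivAt_orbit_gauss (hc : 0 < c) (h : ℝ) (p : ℂ[X]) (q : ℝ × ℝ × ℝ) :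
    HasFDerivAt (orbit h (polyGaussLp hc p) ∘ ofCoord)
      (orbitDeriv ((orbit h (polyGaussLp hc (polyOpX h c p)) ∘ ofCoord) q)
        ((orbit h (polyGaussLp hc (polyOpY p)) ∘ ofCoord) q -
          q.1 • centralScalar h • (orbit h (polyGaussLp hc p) ∘ ofCoord) q)
        (centralScalar h • (orbit h (polyGaussLp hc p) ∘ ofCoord) q)) q := by
  set g := ofCoord q with hg
  have h0 : coord (g⁻¹ * ofCoord q) = 0 := by rw [hg, inv_mul_cancel, coord_one]
  have h1 := hasFDerivAt_orbit_gauss_zero hc h p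
  rw [← h0] at h1
  have h2 := HasFDerivAt.comp (f := fun p : ℝ × ℝ × ℝ => coord (g⁻¹ * ofCoord p)) q h1
    (hasFDerivAt_leftMul g⁻¹ q)
  have h3 := ((schrodinger h g).toContinuousLinearEquiv.toContinuousLinearMap.restrictScalars
      ℝ).hasFDerivAt.comp q h2
  have h4 : orbit h (polyGaussLp hc p) ∘ ofCoord =
      ((schrodinger h g).toContinuousLinearEquiv.toContinuousLinearMap.restrictScalars ℝ) ∘
      ((orbit h (polyGaussLp hc p) ∘ ofCoord) ∘
        fun p : ℝ × ℝ × ℝ => coord (g⁻¹ * ofCoord p)) := by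
    funext r
    have : ofCoord r = g * (g⁻¹ * ofCoord r) := by rw [mul_inv_cancel_left]
    rw [Function.comp_apply, this, orbit_mul]
    rfl
  rw [← h4] at h3
  refine h3.congr_fderiv (ContinuousLinearMap.ext fun v => ?_)
  have hga : g⁻¹.a = -q.1 := rfl
  have hcs : ((2 * Real.pi * h : ℝ) * Complex.I : ℂ) = centralScalar h := rfl
  simp only [hcs, ContinuousLinearMap.comp_apply, orbitDeriv_apply,
    ContinuousLinearMap.coe_restrictScalars', ContinuousLinearEquiv.coe_coe,
    LinearIsometryEquiv.coe_toContinuousLinearEquiv, map_add, map_smul,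
    ContinuousLinearMap.prod_apply, add_apply, smul_apply,
    ContinuousLinearMap.coe_fst', ContinuousLinearMap.coe_snd', smul_eq_mul, hga,
    Function.comp_apply, ← hg]
  simp only [orbit]
  module

/-- Induction works for all polynomials at once, because the derivative of one Gaussian orbit map is
built from orbit maps of other polynomials and the coordinate `a`. -/
theorem contDiff_orbit_gauss (hc : 0 < c) (h : ℝ) (n : ℕ) (p : ℂ[X]) :
    ContDiff ℝ n (orbit h (polyGaussLp hc p) ∘ ofCoord) := by
  induction n generalizing p with
  | zero =>
    refine contDiff_zero.2 ?_
    exact continuous_iff_continuousAt.2 fun q => (hasFDerivAt_orbit_gauss hc h p q).continuousAt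
  | succ n ih =>
    refine contDiff_succ_iff_hasFDerivAt.2 ⟨_, ?_, hasFDerivAt_orbit_gauss hc h p⟩
    have h1 : ContDiff ℝ n fun q : ℝ × ℝ × ℝ =>
        centralScalar h • (orbit h (polyGaussLp hc p) ∘ ofCoord) q := (ih p).const_smul _
    have h2 := (ih (polyOpY p)).sub ((contDiff_fst (𝕜 := ℝ) (E := ℝ) (F := ℝ × ℝ)).smul h1)
    exact ((contDiff_const.smulRight (ih (polyOpX h c p))).add
      (contDiff_const.smulRight h2)).add (contDiff_const.smulRight h1)

/-- Polynomials times a Gaussian as smooth vectors. -/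
noncomputable def gaussVector (hc : 0 < c) (h : ℝ) : ℂ[X] →ₗ[ℂ] smoothSubspace h :=
  (polyGaussLp hc).codRestrict (smoothSubspace h) fun p =>
    contDiff_infty.2 fun n => contDiff_orbit_gauss hc h n p

theorem coe_gaussVector (hc : 0 < c) (h : ℝ) (p : ℂ[X]) :
    (gaussVector hc h p : L2R) = polyGaussLp hc p := rfl

theorem opField_gaussVector (hc : 0 < c) (h : ℝ) (p : ℂ[X]) (v : ℝ × ℝ × ℝ) :
    (opField h v (gaussVector hc h p) : L2R) =
      v.1 • polyGaussLp hc (polyOpX h c p) + v.2.1 • polyGaussLp hc (polyOpY p) +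
        v.2.2 • centralScalar h • polyGaussLp hc p := by
  rw [coe_opField, coe_gaussVector, (hasFDerivAt_orbit_gauss_zero hc h p).fderiv,
    orbitDeriv_apply]
  rfl

theorem opField_X_gaussVector (hc : 0 < c) (h : ℝ) (p : ℂ[X]) :
    opField h (1, 0, 0) (gaussVector hc h p) = gaussVector hc h (polyOpX h c p) := by
  apply Subtype.ext
  rw [opField_gaussVector, coe_gaussVector]
  simp

theorem opField_Y_gaussVector (hc : 0 < c) (h : ℝ) (p : ℂ[X]) :
    opField h (0, 1, 0) (gaussVector hc h p) = gaussVector hc h (polyOpY p) := by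
  apply Subtype.ext
  rw [opField_gaussVector, coe_gaussVector]
  simp

end GaussSmooth

/-! ### Totality of polynomials times a Gaussian. -/

section Totality

open Polynomial FourierTransform

variable {c : ℝ}

/-- An integrable function whose Fourier transform vanishes is zero almost everywhere. -/
theorem ae_eq_zero_of_fourier_eq_zero {w : ℝ → ℂ} (hw : Integrable w)
    (h0 : ∀ y, 𝓕 w y = 0) : ∀ᵐ x, w x = 0 := by
  refine ae_eq_zero_of_integral_contDiff_smul_eq_zero hw.locallyIntegrable fun g hg hgc => ?_
  have h1 : HasCompactSupport fun x => (g x : ℂ) := hgc.comp_left (g := Complex.ofReal) rfl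
  have h2 : ContDiff ℝ ∞ fun x => (g x : ℂ) := Complex.ofRealCLM.contDiff.comp hg
  -- The test function is written as the Fourier transform of a Schwartz function, and the transform
  -- is then moved onto `w`.
  let G : SchwartzMap ℝ ℂ := h1.toSchwartzMap h2
  let H : SchwartzMap ℝ ℂ := 𝓕⁻ G
  have h3 : ∀ x, 𝓕 (H : ℝ → ℂ) x = g x := fun x => by
    rw [← SchwartzMap.fourier_coe, FourierTransform.fourier_fourierInv_eq]
    rfl
  have h4 := VectorFourier.integral_fourierIntegral_smul_eq_flip (L := innerₗ ℝ)
    (μ := volume) (ν := volume) Real.continuous_fourierChar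
    (by exact continuous_inner) H.integrable hw
  have h5 : ∀ x, g x • w x = (𝓕 (H : ℝ → ℂ) x) • w x := fun x => by
    rw [h3]; rfl
  simp only [h5]
  refine h4.trans ?_
  have h6 : ∀ x, VectorFourier.fourierIntegral Real.fourierChar volume (innerₗ ℝ).flip w x = 0 :=
    fun x => by
      rw [flip_innerₗ]
      exact h0 x
  simp only [h6, smul_zero, integral_zero]

/-- Half of the Gaussian absorbs the exponential by completing the square; the other half remains to
pair with an `L²` function. -/
theorem exp_mul_abs_le (hc : 0 < c) (K x : ℝ) :
    Real.exp (K * |x|) * Real.exp (-(c / 2) * x ^ 2) ≤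
      Real.exp (K ^ 2 / c) * Real.exp (-(c / 2 / 2) * x ^ 2) := by
  rw [← Real.exp_add, ← Real.exp_add, Real.exp_le_exp]
  have h1 : K * |x| ≤ K ^ 2 / c + c / 4 * x ^ 2 := by
    rw [← sq_abs x]
    have h2 : K ^ 2 / c + c / 4 * |x| ^ 2 - K * |x| = (K - c / 2 * |x|) ^ 2 / c := by
      field_simp; ring
    have h3 : 0 ≤ (K - c / 2 * |x|) ^ 2 / c := by positivity
    linarith
  linarith

theorem polyGauss_one (x : ℝ) : polyGauss c 1 x = (Real.exp (-(c / 2) * x ^ 2) : ℂ) := by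
  simp [polyGauss]

/-- Polynomials times a Gaussian are total in `L²(ℝ)`. -/
theorem eq_zero_of_inner_polyGaussLp (hc : 0 < c) (f : L2R)
    (hf : ∀ p : ℂ[X], inner ℂ (polyGaussLp hc p) f = 0) : f = 0 := by
  let w : ℝ → ℂ := fun x => (Real.exp (-(c / 2) * x ^ 2) : ℂ) * f x
  have hmom : ∀ n : ℕ, ∫ x : ℝ, (x : ℂ) ^ n * w x = 0 := fun n => by
    have h1 := hf (X ^ n)
    rw [L2.inner_def] at h1
    rw [← h1]
    refine integral_congr_ae ?_
    filter_upwards [coeFn_polyGaussLp hc (X ^ n)] with x hx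
    rw [hx, RCLike.inner_apply]
    simp only [w, polyGauss, eval_pow, eval_X, map_mul, map_pow, Complex.conj_ofReal]
    ring
  have hprod : ∀ d : ℝ, 0 < d → Integrable fun x : ℝ => (Real.exp (-(d / 2) * x ^ 2) : ℂ) * f x :=
    fun d hd => by
      have h1 := MemLp.integrable_mul (memLp_polyGauss hd 1) (Lp.memLp f)
      refine h1.congr (Filter.Eventually.of_forall fun x => ?_)
      simp [polyGauss_one]
  have hw : Integrable w := hprod c hc
  have hdom : ∀ K : ℝ, Integrable fun x : ℝ => Real.exp (K * |x|) * ‖w x‖ := fun K => by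
    refine ((hprod (c / 2) (by positivity)).norm.const_mul (Real.exp (K ^ 2 / c))).mono ?_ ?_
    · exact (by fun_prop : Continuous fun x : ℝ => Real.exp (K * |x|)).aestronglyMeasurable.mul
        hw.1.norm
    · refine Filter.Eventually.of_forall fun x => ?_
      have h1 := exp_mul_abs_le hc K x
      simp only [w, norm_mul, Complex.norm_real, Real.norm_eq_abs, Real.abs_exp, abs_norm]
      rw [← mul_assoc, ← mul_assoc]
      exact mul_le_mul_of_nonneg_right h1 (norm_nonneg _)
  -- Expand the character in its power series and integrate termwise: every term is a moment, hence
  -- zero. The sum of absolute values is `exp (2π|y||x|) |w x|`, which `hdom` makes integrable.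
  have hfour : ∀ y, 𝓕 w y = 0 := fun y => by
    have h1 : 𝓕 w y = ∫ x : ℝ, Complex.exp ((-2 * Real.pi * y * Complex.I) * x) * w x := by
      rw [Real.fourier_eq']
      refine integral_congr_ae (Filter.Eventually.of_forall fun x => ?_)
      simp only [smul_eq_mul]
      congr 2
      simp
      ring
    have h2 := hasSum_integral_of_dominated_convergence (μ := volume)
      (F := fun (n : ℕ) (x : ℝ) => ((-2 * Real.pi * y * Complex.I) * x) ^ n / n.factorial * w x)
      (f := fun x : ℝ => Complex.exp ((-2 * Real.pi * y * Complex.I) * x) * w x)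
      (fun (n : ℕ) (x : ℝ) => (2 * Real.pi * |y| * |x|) ^ n / n.factorial * ‖w x‖)
      (fun n => (by fun_prop : Continuous fun x : ℝ =>
        ((-2 * Real.pi * y * Complex.I) * x) ^ n / n.factorial).aestronglyMeasurable.mul hw.1)
      (fun n => Filter.Eventually.of_forall fun x => le_of_eq (by
        simp [abs_of_pos Real.pi_pos]))
      (Filter.Eventually.of_forall fun x => (Real.summable_pow_div_factorial _).mul_right _)
      ((hdom (2 * Real.pi * |y|)).congr (Filter.Eventually.of_forall fun x => by
        simp only [tsum_mul_right]
        rw [Real.exp_eq_exp_ℝ, NormedSpace.exp_eq_tsum_div]))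
      (Filter.Eventually.of_forall fun x => by
        refine HasSum.mul_right _ ?_
        rw [Complex.exp_eq_exp_ℂ]
        exact NormedSpace.expSeries_div_hasSum_exp _)
    have h3 : ∀ n : ℕ, ∫ x : ℝ, ((-2 * Real.pi * y * Complex.I) * x) ^ n / n.factorial * w x = 0 :=
      fun n => by
        have h4 : ∀ x : ℝ, ((-2 * Real.pi * y * Complex.I) * x) ^ n / n.factorial * w x =
            ((-2 * Real.pi * y * Complex.I) ^ n / n.factorial) * ((x : ℂ) ^ n * w x) := fun x => by
          rw [mul_pow]; ring
        simp only [h4]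
        rw [integral_const_mul, hmom, mul_zero]
    simp only [h3] at h2
    rw [h1]
    exact h2.unique hasSum_zero
  refine Lp.ext ?_
  filter_upwards [ae_eq_zero_of_fourier_eq_zero hw hfour, Lp.coeFn_zero ℂ 2 volume] with x h1 h2
  rw [h2]
  have h3 : (Real.exp (-(c / 2) * x ^ 2) : ℂ) ≠ 0 := by exact_mod_cast (Real.exp_pos _).ne'
  exact (mul_eq_zero.1 h1).resolve_left h3

end Totality

/-! ### Matrix identities for the Hodge Laplacians over an arbitrary ring. -/

section HodgeAlgebra

variable {R : Type*} [Ring R] (x y t : R)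

/-- The gradient matrix. -/
def gradMatrix : Matrix (Fin 3) (Fin 1) R := !![x; y; t]

/-- The matrix of the exterior derivative from 1-forms to 2-forms. -/
def extMatrix1 : Matrix (Fin 3) (Fin 3) R := !![-y, x, -1; -t, 0, x; 0, -t, y]

/-- The matrix of the exterior derivative from 2-forms to 3-forms. -/
def extMatrix2 : Matrix (Fin 1) (Fin 3) R := !![t, -y, x]

/-- The matrix of the codifferential on 1-forms. -/
def codiffMatrix : Matrix (Fin 1) (Fin 3) R := !![-x, -y, -t]

/-- The matrix of `⋆ d` on 1-forms. -/
def curlMatrix : Matrix (Fin 3) (Fin 3) R := !![0, -t, y; t, 0, -x; -y, x, -1]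

variable (R) in
/-- The matrix of the Hodge star between 1-forms and 2-forms. -/
def starMatrix : Matrix (Fin 3) (Fin 3) R := !![0, 0, 1; 0, -1, 0; 1, 0, 0]

variable (R) in
theorem starMatrix_mul_self : starMatrix R * starMatrix R = 1 := by
  ext i j
  fin_cases i <;> fin_cases j <;> simp [starMatrix, Matrix.mul_apply, Fin.sum_univ_three]

theorem starMatrix_mul_extMatrix1 : starMatrix R * extMatrix1 x y t = curlMatrix x y t := by
  ext i j
  fin_cases i <;> fin_cases j <;>
    simp [starMatrix, extMatrix1, curlMatrix, Matrix.mul_apply, Fin.sum_univ_three]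

theorem neg_extMatrix2_mul_starMatrix :
    -(extMatrix2 x y t * starMatrix R) = codiffMatrix x y t := by
  ext i j
  fin_cases i; fin_cases j <;>
    simp [starMatrix, extMatrix2, codiffMatrix]

/-- The Hodge Laplace operator on functions. -/
def lapMatrix0 : Matrix (Fin 1) (Fin 1) R := codiffMatrix x y t * gradMatrix x y t

/-- The Hodge Laplace operator on 1-forms. -/
def lapMatrix1 : Matrix (Fin 3) (Fin 3) R :=
  gradMatrix x y t * codiffMatrix x y t + curlMatrix x y t * curlMatrix x y t

theorem extMatrix2_mul_neg_star_grad :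
    extMatrix2 x y t * -(starMatrix R * gradMatrix x y t * (1 : Matrix (Fin 1) (Fin 1) R)) = lapMatrix0 x y t := by
  rw [lapMatrix0, ← neg_extMatrix2_mul_starMatrix, Matrix.mul_one, Matrix.mul_neg, Matrix.neg_mul,
    ← Matrix.mul_assoc]

theorem lapMatrix0_eq :
    -((1 : Matrix (Fin 1) (Fin 1) R) * extMatrix2 x y t * starMatrix R) * gradMatrix x y t = lapMatrix0 x y t := by
  rw [lapMatrix0, ← neg_extMatrix2_mul_starMatrix, Matrix.one_mul]

/-- Since `δ = ⋆ d ⋆` on 2-forms, `δ d` is the square of `⋆ d`. -/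
theorem lapMatrix1_eq :
    gradMatrix x y t * -((1 : Matrix (Fin 1) (Fin 1) R) * extMatrix2 x y t * starMatrix R) +
      starMatrix R * extMatrix1 x y t * starMatrix R * extMatrix1 x y t = lapMatrix1 x y t := by
  rw [lapMatrix1, ← neg_extMatrix2_mul_starMatrix, ← starMatrix_mul_extMatrix1, Matrix.one_mul,
    ← Matrix.mul_assoc]

/-- The Hodge star commutes with the Laplacian and squares to one, so degree 2 is conjugate to
degree 1. -/
theorem star_lapMatrix1_star :
    extMatrix1 x y t * (starMatrix R * extMatrix1 x y t * starMatrix R) +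
      -(starMatrix R * gradMatrix x y t * (1 : Matrix (Fin 1) (Fin 1) R)) * extMatrix2 x y t =
      starMatrix R * lapMatrix1 x y t * starMatrix R := by
  have h5 := starMatrix_mul_self R
  have h6 : ∀ M : Matrix (Fin 3) (Fin 3) R, starMatrix R * (starMatrix R * M) = M := fun M => by
    rw [← Matrix.mul_assoc, h5, Matrix.one_mul]
  rw [lapMatrix1, ← neg_extMatrix2_mul_starMatrix, ← starMatrix_mul_extMatrix1, Matrix.mul_one]
  simp only [Matrix.mul_add, Matrix.add_mul, Matrix.mul_neg, Matrix.neg_mul, Matrix.mul_assoc,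
    h5, h6, Matrix.mul_one]
  exact add_comm _ _

variable (E : Type*) [NormedAddCommGroup E] [NormedSpace ℂ E]

theorem hodgeLaplacian0_eq :
    hodgeLaplacian0 E = lapMatrix0 (fieldX E) (fieldY E) (fieldT E) :=
  lapMatrix0_eq (fieldX E) (fieldY E) (fieldT E)

theorem hodgeLaplacian1_eq :
    hodgeLaplacian1 E = lapMatrix1 (fieldX E) (fieldY E) (fieldT E) :=
  lapMatrix1_eq (fieldX E) (fieldY E) (fieldT E)

theorem hodgeLaplacian2_eq :
    hodgeLaplacian2 E = starMatrix _ * lapMatrix1 (fieldX E) (fieldY E) (fieldT E) *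
      starMatrix _ :=
  star_lapMatrix1_star (fieldX E) (fieldY E) (fieldT E)

theorem hodgeLaplacian3_eq :
    hodgeLaplacian3 E = lapMatrix0 (fieldX E) (fieldY E) (fieldT E) :=
  extMatrix2_mul_neg_star_grad (fieldX E) (fieldY E) (fieldT E)

end HodgeAlgebra

/-! ### Gradient, curl and codifferential on smooth vectors. -/

section Localisation

variable (h : ℝ)

/-- `dρ_h(X)` on smooth vectors. -/
noncomputable def opX : Module.End ℂ (smoothSubspace h) := opField h (1, 0, 0)
/-- `dρ_h(Y)` on smooth vectors. -/
noncomputable def opY : Module.End ℂ (smoothSubspace h) := opField h (0, 1, 0)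
/-- `dρ_h(T)` on smooth vectors. -/
noncomputable def opT : Module.End ℂ (smoothSubspace h) := opField h (0, 0, 1)

theorem opT_apply (u : smoothSubspace h) : opT h u = centralScalar h • u := opField_central h u

theorem localises_gradMatrix :
    Localises h (gradMatrix (fieldX L2R) (fieldY L2R) (fieldT L2R))
      (gradMatrix (opX h) (opY h) (opT h)) := by
  intro i j u
  fin_cases j
  fin_cases i <;> exact leftField_smoothOrbit h _ u

theorem localises_codiffMatrix :
    Localises h (codiffMatrix (fieldX L2R) (fieldY L2R) (fieldT L2R))
      (codiffMatrix (opX h) (opY h) (opT h)) := by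
  intro i j u
  fin_cases i
  fin_cases j <;>
    simp [codiffMatrix, fieldX, fieldY, fieldT, opX, opY, opT, leftField_smoothOrbit]

theorem localises_curlMatrix :
    Localises h (curlMatrix (fieldX L2R) (fieldY L2R) (fieldT L2R))
      (curlMatrix (opX h) (opY h) (opT h)) := by
  intro i j u
  fin_cases i <;> fin_cases j <;>
    simp [curlMatrix, fieldX, fieldY, fieldT, opX, opY, opT, leftField_smoothOrbit]

theorem localises_starMatrix : Localises h (starMatrix _) (starMatrix _) := by
  intro i j u
  fin_cases i <;> fin_cases j <;> simp [starMatrix]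

theorem localises_lapMatrix0 :
    Localises h (lapMatrix0 (fieldX L2R) (fieldY L2R) (fieldT L2R))
      (lapMatrix0 (opX h) (opY h) (opT h)) :=
  (localises_codiffMatrix h).mul (localises_gradMatrix h)

theorem localises_lapMatrix1 :
    Localises h (lapMatrix1 (fieldX L2R) (fieldY L2R) (fieldT L2R))
      (lapMatrix1 (opX h) (opY h) (opT h)) :=
  ((localises_gradMatrix h).mul (localises_codiffMatrix h)).add
    ((localises_curlMatrix h).mul (localises_curlMatrix h))

variable {h}

theorem inner_opX (u w : smoothSubspace h) :
    inner ℂ (w : L2R) (opX h u : L2R) = -inner ℂ (opX h w : L2R) (u : L2R) := by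
  rw [opX, inner_opField_left, neg_neg]

theorem inner_opY (u w : smoothSubspace h) :
    inner ℂ (w : L2R) (opY h u : L2R) = -inner ℂ (opY h w : L2R) (u : L2R) := by
  rw [opY, inner_opField_left, neg_neg]

theorem inner_opT (u w : smoothSubspace h) :
    inner ℂ (w : L2R) (opT h u : L2R) = -inner ℂ (opT h w : L2R) (u : L2R) := by
  rw [opT, inner_opField_left, neg_neg]

variable (h)

theorem isFormalAdjoint_grad_codiff :
    IsFormalAdjoint (gradMatrix (opX h) (opY h) (opT h)) (codiffMatrix (opX h) (opY h) (opT h)) := by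
  intro i j u w
  fin_cases j
  fin_cases i <;>
    simp [gradMatrix, codiffMatrix, inner_opX, inner_opY, inner_opT]

theorem isFormalAdjoint_codiff_grad :
    IsFormalAdjoint (codiffMatrix (opX h) (opY h) (opT h)) (gradMatrix (opX h) (opY h) (opT h)) := by
  intro i j u w
  fin_cases i
  fin_cases j <;>
    simp [gradMatrix, codiffMatrix, inner_opX, inner_opY, inner_opT]

/-- The off-diagonal part is an antisymmetric arrangement of skew operators, hence symmetric; the
remaining entry is the real constant `-1`. -/
theorem isFormalAdjoint_curl :
    IsFormalAdjoint (curlMatrix (opX h) (opY h) (opT h)) (curlMatrix (opX h) (opY h) (opT h)) := by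
  intro i j u w
  fin_cases i <;> fin_cases j <;> simp [curlMatrix, inner_opX, inner_opY, inner_opT]

theorem isFormalAdjoint_star :
    IsFormalAdjoint (h := h) (starMatrix _) (starMatrix _) := by
  intro i j u w
  fin_cases i <;> fin_cases j <;> simp [starMatrix]

theorem isFormalAdjoint_lapMatrix0 :
    IsFormalAdjoint (lapMatrix0 (opX h) (opY h) (opT h)) (lapMatrix0 (opX h) (opY h) (opT h)) :=
  (isFormalAdjoint_codiff_grad h).mul (isFormalAdjoint_grad_codiff h)

theorem isFormalAdjoint_lapMatrix1 :
    IsFormalAdjoint (lapMatrix1 (opX h) (opY h) (opT h)) (lapMatrix1 (opX h) (opY h) (opT h)) :=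
  ((isFormalAdjoint_grad_codiff h).mul (isFormalAdjoint_codiff_grad h)).add
    ((isFormalAdjoint_curl h).mul (isFormalAdjoint_curl h))

/-- The gradient of a smooth vector. -/
noncomputable def grad (f : smoothSubspace h) : Fin 3 → smoothSubspace h :=
  act (gradMatrix (opX h) (opY h) (opT h)) ![f]

/-- The operator `⋆ d` on triples of smooth vectors. -/
noncomputable def curl (u : Fin 3 → smoothSubspace h) : Fin 3 → smoothSubspace h :=
  act (curlMatrix (opX h) (opY h) (opT h)) u

/-- The codifferential on triples of smooth vectors. -/
noncomputable def codiff (u : Fin 3 → smoothSubspace h) : smoothSubspace h :=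
  act (codiffMatrix (opX h) (opY h) (opT h)) u 0

variable {h}

theorem grad_eq (f : smoothSubspace h) : grad h f = ![opX h f, opY h f, centralScalar h • f] := by
  funext i
  fin_cases i <;> simp [grad, act, gradMatrix, opT_apply]

theorem curl_eq (a b c : smoothSubspace h) :
    curl h ![a, b, c] = ![opY h c - centralScalar h • b, centralScalar h • a - opX h c,
      opX h b - opY h a - c] := by
  funext i
  fin_cases i <;> simp [curl, act, curlMatrix, opT_apply, Fin.sum_univ_three]
  all_goals abel

theorem codiff_eq (a b c : smoothSubspace h) :
    codiff h ![a, b, c] = -opX h a - opY h b - centralScalar h • c := by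
  simp [codiff, act, codiffMatrix, opT_apply, Fin.sum_univ_three]
  abel

theorem act_codiff (u : Fin 3 → smoothSubspace h) :
    act (codiffMatrix (opX h) (opY h) (opT h)) u = ![codiff h u] := by
  funext i; fin_cases i; rfl

theorem act_lapMatrix0 (f : smoothSubspace h) :
    act (lapMatrix0 (opX h) (opY h) (opT h)) ![f] = ![codiff h (grad h f)] := by
  rw [lapMatrix0, act_mul, act_codiff]; rfl

theorem act_lapMatrix1 (u : Fin 3 → smoothSubspace h) :
    act (lapMatrix1 (opX h) (opY h) (opT h)) u =
      grad h (codiff h u) + curl h (curl h u) := by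
  rw [lapMatrix1, act_add_left, act_mul, act_mul, act_codiff]; rfl

theorem grad_smul (c : ℂ) (f : smoothSubspace h) : grad h (c • f) = c • grad h f := by
  rw [grad, grad, ← act_smul]; simp

theorem curl_add (u w : Fin 3 → smoothSubspace h) : curl h (u + w) = curl h u + curl h w :=
  act_add _ _ _

theorem curl_smul (c : ℂ) (u : Fin 3 → smoothSubspace h) : curl h (c • u) = c • curl h u :=
  act_smul _ _ _

theorem codiff_add (u w : Fin 3 → smoothSubspace h) :
    codiff h (u + w) = codiff h u + codiff h w := by
  rw [codiff, act_add]; rfl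

theorem codiff_smul (c : ℂ) (u : Fin 3 → smoothSubspace h) :
    codiff h (c • u) = c • codiff h u := by
  rw [codiff, act_smul]; rfl

theorem inner_grad (f : smoothSubspace h) (u : Fin 3 → smoothSubspace h) :
    inner ℂ (toForms (grad h f)) (toForms u) = inner ℂ (f : L2R) (codiff h u : L2R) := by
  have h1 := (isFormalAdjoint_codiff_grad h).inner_act ![f] u
  rw [act_codiff] at h1
  refine h1.symm.trans ?_
  simp [inner_toForms, toForms_apply]

theorem inner_curl (u w : Fin 3 → smoothSubspace h) :
    inner ℂ (toForms (curl h u)) (toForms w) = inner ℂ (toForms u) (toForms (curl h w)) :=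
  ((isFormalAdjoint_curl h).inner_act u w).symm

end Localisation

/-! ### Construction of the ladder from Hermite functions. -/

section Ladder

open Polynomial

variable {h : ℝ}

/-- A sequence of smooth vectors on which `X - i s Y` and `-X - i s Y`, with `s` the sign of `h`,
act as lowering and raising operators. -/
structure IsLadder (h k s : ℝ) (f : ℕ → smoothSubspace h) : Prop where
  sq_sign : s ^ 2 = 1
  sign_mul : s * k = |k|
  scalar : centralScalar h = k * Complex.I
  ne_zero : k ≠ 0
  -- At `n = 0` truncated subtraction gives `f 0` with coefficient zero: the ground state is
  -- annihilated.
  lower : ∀ n, opX h (f n) - (Complex.I * s) • opY h (f n) = (2 * |k| * n : ℂ) • f (n - 1)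
  raise : ∀ n, -opX h (f n) - (Complex.I * s) • opY h (f n) = f (n + 1)
  zero_ne : f 0 ≠ 0
  total : ∀ x : L2R, (∀ n, inner ℂ (f n : L2R) x = 0) → x = 0

variable (h) in
/-- The polynomials in Hermite functions, up to normalisation. -/
noncomputable def hermitePoly (s : ℝ) : ℕ → ℂ[X]
  | 0 => 1
  | n + 1 => C (4 * Real.pi * s : ℂ) * (X * hermitePoly s n) -
      C (h : ℂ) * derivative (hermitePoly s n)

/-- On polynomial parts the lowering operator is `h d/dx`, so this is the lowering relation of the
ladder. The induction differentiates the recursion and regroups it into `hermitePoly` of the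
previous level. -/
theorem derivative_hermitePoly (s : ℝ) (n : ℕ) :
    C (h : ℂ) * derivative (hermitePoly h s n) =
      C (4 * Real.pi * (s * h) * n : ℂ) * hermitePoly h s (n - 1) := by
  induction n with
  | zero => simp [hermitePoly]
  | succ n ih =>
    have e1 : derivative (hermitePoly h s (n + 1)) =
        C (4 * Real.pi * s : ℂ) * (hermitePoly h s n + X * derivative (hermitePoly h s n)) -
          derivative (C (4 * Real.pi * (s * h) * n : ℂ) * hermitePoly h s (n - 1)) := by
      rw [hermitePoly, ih]
      simp
    rw [e1, Nat.add_sub_cancel]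
    cases n with
    | zero => simp [hermitePoly]; ring
    | succ n =>
      rw [Nat.add_sub_cancel] at ih ⊢
      have e2 : hermitePoly h s (n + 1) = C (4 * Real.pi * s : ℂ) * (X * hermitePoly h s n) -
          C (h : ℂ) * derivative (hermitePoly h s n) := rfl
      simp only [derivative_mul, derivative_C, zero_mul, zero_add]
      calc _ = C (h * (4 * Real.pi * s) : ℂ) * hermitePoly h s (n + 1) +
            C (4 * Real.pi * s : ℂ) * (X * (C (h : ℂ) * derivative (hermitePoly h s (n + 1)))) -
            C (4 * Real.pi * (s * h) * (n + 1 : ℕ) : ℂ) *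
              (C (h : ℂ) * derivative (hermitePoly h s n)) := by
            simp only [C_mul]; ring
        _ = C (h * (4 * Real.pi * s) : ℂ) * hermitePoly h s (n + 1) +
            C (4 * Real.pi * (s * h) * (n + 1 : ℕ) : ℂ) * hermitePoly h s (n + 1) := by
            rw [ih, e2]; simp only [C_mul]; ring
        _ = _ := by
            rw [← add_mul, ← C_add]; congr 2; push_cast; ring

theorem exists_isLadder (k : ℝ) (hh : h ≠ 0) (hk : k = 2 * Real.pi * h) :
    ∃ s f, IsLadder h k s f := by
  obtain ⟨s, hs2, hsh⟩ : ∃ s : ℝ, s ^ 2 = 1 ∧ s * h = |h| := by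
    rcases le_or_gt 0 h with h0 | h0
    · exact ⟨1, by norm_num, by rw [abs_of_nonneg h0, one_mul]⟩
    · exact ⟨-1, by norm_num, by rw [abs_of_neg h0]; ring⟩
  have habs : 0 < |h| := abs_pos.2 hh
  -- With this width the Gaussian factor contributes `-2πs x` to `X`, which cancels the contribution
  -- of `-i s Y`, so the lowering operator is pure differentiation.
  have hc : 0 < 2 * Real.pi / |h| := by positivity
  have hhc : h * (2 * Real.pi / |h|) = 2 * Real.pi * s := by
    rw [← hsh]
    have : s ≠ 0 := by rintro rfl; norm_num at hs2
    field_simp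
    rw [hs2]
  have habsk : |k| = 2 * Real.pi * (s * h) := by
    rw [hk, hsh, abs_mul, abs_of_pos (by positivity : 0 < 2 * Real.pi)]
  have hhc' : (h : ℂ) * ((2 * Real.pi / |h| : ℝ) : ℂ) = 2 * Real.pi * s := by
    exact_mod_cast hhc
  have hI : Complex.I * s * (2 * Real.pi * Complex.I) = -(2 * Real.pi * s : ℂ) := by
    linear_combination (2 * Real.pi * s : ℂ) * Complex.I_sq
  have hX : ∀ p, polyOpX h (2 * Real.pi / |h|) p =
      C (h : ℂ) * derivative p - C (2 * Real.pi * s : ℂ) * (X * p) := fun p => by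
    rw [polyOpX, gaussDeriv, mul_sub, ← mul_assoc (C (h : ℂ)) (C _), ← C_mul, hhc']
  have hY : ∀ p, C (Complex.I * s) * polyOpY p = -(C (2 * Real.pi * s : ℂ) * (X * p)) := fun p => by
    rw [polyOpY, ← mul_assoc, ← C_mul, hI, C_neg, neg_mul]
  let f : ℕ → smoothSubspace h := fun n => gaussVector hc h (hermitePoly h s n)
  have hraise : ∀ p, -opX h (gaussVector hc h p) - (Complex.I * s) • opY h (gaussVector hc h p) =
      gaussVector hc h (C (4 * Real.pi * s : ℂ) * (X * p) - C (h : ℂ) * derivative p) := fun p => by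
    rw [opX, opY, opField_X_gaussVector, opField_Y_gaussVector, ← map_smul, ← map_neg, ← map_sub,
      smul_eq_C_mul, hX, hY]
    congr 1
    have : C (4 * Real.pi * s : ℂ) = C (2 * Real.pi * s : ℂ) + C (2 * Real.pi * s : ℂ) := by
      rw [← C_add]; congr 1; ring
    rw [this]; ring
  have hlower : ∀ p, opX h (gaussVector hc h p) - (Complex.I * s) • opY h (gaussVector hc h p) =
      gaussVector hc h (C (h : ℂ) * derivative p) := fun p => by
    rw [opX, opY, opField_X_gaussVector, opField_Y_gaussVector, ← map_smul, ← map_sub,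
      smul_eq_C_mul, hX, hY]
    congr 1; ring
  refine ⟨s, f, hs2, ?_, ?_, ?_, fun n => ?_, fun n => ?_, fun h0 => ?_, fun x hx => ?_⟩
  · rw [habsk, hk]; ring
  · rw [centralScalar, hk]
  · rw [hk]; positivity
  · rw [hlower, derivative_hermitePoly, ← smul_eq_C_mul, map_smul, habsk]
    congr 1; push_cast; ring
  · exact hraise _
  · have h1 : polyGaussLp hc 1 = 0 := congrArg Subtype.val h0
    have h2 := coeFn_polyGaussLp hc 1
    rw [h1] at h2
    have h3 : ∀ᵐ x : ℝ, False := by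
      filter_upwards [h2, Lp.coeFn_zero ℂ 2 volume] with x e1 e2
      rw [e2, polyGauss_one] at e1
      have : (Real.exp (-((2 * Real.pi / |h|) / 2) * x ^ 2) : ℂ) ≠ 0 := by
        exact_mod_cast (Real.exp_pos _).ne'
      exact this e1.symm
    exact h3.exists.elim fun _ hx => hx
  · refine eq_zero_of_inner_polyGaussLp hc x fun p => ?_
    let N : Submodule ℂ ℂ[X] :=
      { carrier := {p | inner ℂ (polyGaussLp hc p) x = 0}
        add_mem' := fun {p q} hp hq => by
          have hp' : inner ℂ (polyGaussLp hc p) x = 0 := hp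
          have hq' : inner ℂ (polyGaussLp hc q) x = 0 := hq
          change inner ℂ (polyGaussLp hc (p + q)) x = 0
          rw [map_add, inner_add_left, hp', hq', add_zero]
        zero_mem' := by
          change inner ℂ (polyGaussLp hc 0) x = 0
          rw [map_zero, inner_zero_left]
        smul_mem' := fun a p hp => by
          have hp' : inner ℂ (polyGaussLp hc p) x = 0 := hp
          change inner ℂ (polyGaussLp hc (a • p)) x = 0
          rw [map_smul, inner_smul_left, hp', mul_zero] }
    have hN : Submodule.span ℂ (Set.range (hermitePoly h s)) ≤ N := by
      rw [Submodule.span_le]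
      rintro _ ⟨n, rfl⟩
      exact hx n
    -- The recursion solved for `X * hermitePoly h s n` shows that the span is stable under
    -- multiplication by `X`; as it contains `1`, it is everything.
    have hXmem : ∀ p ∈ Submodule.span ℂ (Set.range (hermitePoly h s)),
        X * p ∈ Submodule.span ℂ (Set.range (hermitePoly h s)) := by
      intro p hp
      induction hp using Submodule.span_induction with
      | mem p hp =>
        obtain ⟨n, rfl⟩ := hp
        have hne : (4 * Real.pi * s : ℂ) ≠ 0 := by
          have : s ≠ 0 := by rintro rfl; norm_num at hs2
          have hpi := Real.pi_ne_zero
          exact_mod_cast (by positivity : (4 * Real.pi * s : ℝ) ≠ 0)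
        have e1 : X * hermitePoly h s n = (4 * Real.pi * s : ℂ)⁻¹ • (hermitePoly h s (n + 1) +
            (4 * Real.pi * (s * h) * n : ℂ) • hermitePoly h s (n - 1)) := by
          rw [smul_eq_C_mul (4 * Real.pi * (s * h) * n : ℂ), ← derivative_hermitePoly, hermitePoly,
            sub_add_cancel, ← smul_eq_C_mul, smul_smul, inv_mul_cancel₀ hne, one_smul]
        rw [e1]
        exact Submodule.smul_mem _ _ (Submodule.add_mem _ (Submodule.subset_span ⟨_, rfl⟩)
          (Submodule.smul_mem _ _ (Submodule.subset_span ⟨_, rfl⟩)))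
      | zero => simp
      | add p q _ _ hp hq => rw [mul_add]; exact Submodule.add_mem _ hp hq
      | smul a p _ hp => rw [mul_smul_comm]; exact Submodule.smul_mem _ _ hp
    have hpow : ∀ n : ℕ, (X ^ n : ℂ[X]) ∈ Submodule.span ℂ (Set.range (hermitePoly h s)) := by
      intro n
      induction n with
      | zero => exact Submodule.subset_span ⟨0, by simp [hermitePoly]⟩
      | succ n ih => rw [pow_succ']; exact hXmem _ ih
    refine hN ?_
    rw [p.as_sum_range_C_mul_X_pow]
    refine Submodule.sum_mem _ fun i _ => ?_
    rw [← smul_eq_C_mul]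
    exact Submodule.smul_mem _ _ (hpow i)

end Ladder

/-! ### Consequences of the ladder relations. -/

section LadderAlgebra

variable {h k s : ℝ} {f : ℕ → smoothSubspace h}

theorem IsLadder.sign_sq_complex (L : IsLadder h k s f) : (s : ℂ) ^ 2 = 1 := by
  exact_mod_cast L.sq_sign

theorem IsLadder.opX_apply (L : IsLadder h k s f) (n : ℕ) :
    opX h (f n) = (|k| * n : ℂ) • f (n - 1) - (1 / 2 : ℂ) • f (n + 1) := by
  have h1 := L.lower n
  have h2 := L.raise n
  have h3 : opX h (f n) = (1 / 2 : ℂ) • ((opX h (f n) - (Complex.I * s) • opY h (f n)) -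
      (-opX h (f n) - (Complex.I * s) • opY h (f n))) := by module
  rw [h3, h1, h2]
  module

theorem IsLadder.opY_apply (L : IsLadder h k s f) (n : ℕ) :
    opY h (f n) = (Complex.I * s) • ((|k| * n : ℂ) • f (n - 1) + (1 / 2 : ℂ) • f (n + 1)) := by
  have h1 := L.lower n
  have h2 := L.raise n
  have hI : (Complex.I * s) * (Complex.I * s) = -1 := by
    linear_combination (s : ℂ) ^ 2 * Complex.I_sq - L.sign_sq_complex
  have h3 : opY h (f n) = (Complex.I * s) • (1 / 2 : ℂ) • ((opX h (f n) -
      (Complex.I * s) • opY h (f n)) + (-opX h (f n) - (Complex.I * s) • opY h (f n))) := by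
    have h4 : opY h (f n) = -(((Complex.I * s) * (Complex.I * s)) • opY h (f n)) := by
      rw [hI]; module
    nth_rewrite 1 [h4]
    module
  rw [h3, h1, h2]
  module

theorem IsLadder.commutator (L : IsLadder h k s f) (n : ℕ) :
    opX h (opY h (f n)) - opY h (opX h (f n)) = centralScalar h • f n := by
  have hsc : centralScalar h = Complex.I * s * |k| := by
    rw [L.scalar, ← L.sign_mul]
    push_cast
    linear_combination (-(k : ℂ) * Complex.I) * L.sign_sq_complex
  rw [L.opY_apply n, L.opX_apply n, hsc]
  simp only [map_smul, map_add, map_sub, L.opX_apply, L.opY_apply]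
  cases n with
  | zero => simp; module
  | succ n => simp; module

theorem IsLadder.sublaplacian (L : IsLadder h k s f) (n : ℕ) :
    opX h (opX h (f n)) + opY h (opY h (f n)) = (-((2 * n + 1) * |k|) : ℂ) • f n := by
  have hI : (Complex.I * s) * (Complex.I * s) = -1 := by
    linear_combination (s : ℂ) ^ 2 * Complex.I_sq - L.sign_sq_complex
  rw [L.opY_apply n, L.opX_apply n]
  simp only [map_smul, map_add, map_sub, L.opX_apply, L.opY_apply]
  have hE : ∀ (a b : ℂ) (u v : smoothSubspace h), (Complex.I * s : ℂ) • (a • (Complex.I * s : ℂ) • u +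
      b • (Complex.I * s : ℂ) • v) = -(a • u + b • v) := fun a b u v => by
    calc _ = ((Complex.I * s) * (Complex.I * s) : ℂ) • (a • u + b • v) := by module
      _ = _ := by rw [hI, neg_one_smul]
  rw [hE]
  cases n with
  | zero => simp; module
  | succ n => simp; module

/-- Lowering `f (n + 1)` returns a nonzero multiple of `f n`, so no level can vanish after the
ground state. -/
theorem IsLadder.ne_zero_vector (L : IsLadder h k s f) (n : ℕ) : f n ≠ 0 := by
  induction n with
  | zero => exact L.zero_ne
  | succ n ih =>
    intro h0
    have h1 := L.lower (n + 1)
    rw [h0, map_zero, map_zero, smul_zero, sub_zero, Nat.add_sub_cancel] at h1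
    have h2 : (2 * |k| * (n + 1 : ℕ) : ℂ) ≠ 0 := by
      have : 0 < |k| := abs_pos.2 L.ne_zero
      exact_mod_cast (by positivity : (2 * |k| * (n + 1 : ℕ) : ℝ) ≠ 0)
    exact ih ((smul_eq_zero.1 h1.symm).resolve_left h2)

/-- Eigenvectors of the symmetric operator `X² + Y²` with distinct eigenvalues. -/
theorem IsLadder.inner_eq_zero (L : IsLadder h k s f) {m n : ℕ} (hmn : m ≠ n) :
    inner ℂ (f m : L2R) (f n : L2R) = 0 := by
  have h1 : inner ℂ (f m : L2R) ((opX h (opX h (f n)) + opY h (opY h (f n)) :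
      smoothSubspace h) : L2R) =
      inner ℂ ((opX h (opX h (f m)) + opY h (opY h (f m)) : smoothSubspace h) : L2R)
        (f n : L2R) := by
    simp only [Submodule.coe_add, inner_add_left, inner_add_right, inner_opX, inner_opY, neg_neg]
  rw [L.sublaplacian, L.sublaplacian, Submodule.coe_smul, Submodule.coe_smul, inner_smul_left,
    inner_smul_right] at h1
  have h2 : (starRingEnd ℂ) (-((2 * m + 1) * |k|) : ℂ) = (-((2 * m + 1) * |k|) : ℂ) := by
    have h3 : (-((2 * m + 1) * |k|) : ℂ) = ((-((2 * m + 1) * |k|) : ℝ) : ℂ) := by push_cast; ring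
    rw [h3, Complex.conj_ofReal]
  rw [h2, ← sub_eq_zero, ← sub_mul] at h1
  refine (mul_eq_zero.1 h1).resolve_left ?_
  have h3 : (-((2 * n + 1) * |k|) : ℂ) - (-((2 * m + 1) * |k|) : ℂ) =
      ((2 * |k| * ((m : ℝ) - n) : ℝ) : ℂ) := by push_cast; ring
  rw [h3]
  refine Complex.ofReal_ne_zero.2 ?_
  have : 0 < |k| := abs_pos.2 L.ne_zero
  have h4 : (m : ℝ) - n ≠ 0 := sub_ne_zero.2 (by exact_mod_cast hmn)
  positivity

end LadderAlgebra

/-! ### Eigenvectors of the Laplacian on 1-forms. -/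

section Eigenvectors

variable {h k s : ℝ} {f : ℕ → smoothSubspace h}

/-- The vertical 1-form `f θ`. -/
noncomputable def vert (f : smoothSubspace h) : Fin 3 → smoothSubspace h := ![0, 0, f]

theorem eigA_pos (hk : k ≠ 0) (n : ℕ) : 0 < eigA k n := by
  have : 0 < |k| := abs_pos.2 hk
  unfold eigA; positivity

theorem codiff_vert (u : smoothSubspace h) : codiff h (vert u) = -(centralScalar h • u) := by
  rw [vert, codiff_eq]; simp

theorem curl_vert (u : smoothSubspace h) : curl h (vert u) = ![opY h u, -opX h u, -u] := by
  rw [vert, curl_eq]; simp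

theorem inner_vert (u : smoothSubspace h) (w : Fin 3 → smoothSubspace h) :
    inner ℂ (toForms (vert u)) (toForms w) = inner ℂ (u : L2R) (w 2 : L2R) := by
  simp [inner_toForms, vert, toForms_apply, Fin.sum_univ_three]

theorem IsLadder.codiff_grad (L : IsLadder h k s f) (n : ℕ) :
    codiff h (grad h (f n)) = (eigA k n : ℂ) • f n := by
  have h2 : centralScalar h * centralScalar h = -(k : ℂ) ^ 2 := by
    rw [L.scalar]; linear_combination (k : ℂ) ^ 2 * Complex.I_sq
  have h1 : -opX h (opX h (f n)) - opY h (opY h (f n)) = ((2 * n + 1) * |k| : ℂ) • f n := by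
    rw [← neg_add', L.sublaplacian]; module
  rw [grad_eq, codiff_eq, h1, smul_smul, h2, eigA]
  push_cast
  module

theorem IsLadder.curl_grad (L : IsLadder h k s f) (n : ℕ) : curl h (grad h (f n)) = 0 := by
  rw [grad_eq, curl_eq, L.commutator]
  funext i
  fin_cases i <;> simp

theorem IsLadder.codiff_curl_vert (L : IsLadder h k s f) (n : ℕ) :
    codiff h (curl h (vert (f n))) = 0 := by
  rw [curl_vert, codiff_eq]
  simp only [map_neg, smul_neg, ← L.commutator]
  abel

/-- With `curl (grad (f n)) = 0`, this makes the span of `grad`, `vert` and `curl vert` of `f n`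
invariant under `curl`, which reduces the coclosed problem to a quadratic equation. -/
theorem IsLadder.curl_curl_vert (L : IsLadder h k s f) (n : ℕ) :
    curl h (curl h (vert (f n))) = centralScalar h • grad h (f n) - curl h (vert (f n)) +
      (eigA k n : ℂ) • vert (f n) := by
  have h2 : centralScalar h * centralScalar h = -(k : ℂ) ^ 2 := by
    rw [L.scalar]; linear_combination (k : ℂ) ^ 2 * Complex.I_sq
  have h1 : -opX h (opX h (f n)) - opY h (opY h (f n)) = ((2 * n + 1) * |k| : ℂ) • f n := by
    rw [← neg_add', L.sublaplacian]; module
  rw [curl_vert, curl_eq, grad_eq, vert]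
  funext i
  fin_cases i
  · simp; abel
  · simp
  · simp only [map_neg, h1, Pi.add_apply, Pi.sub_apply, Pi.smul_apply]
    simp [smul_smul, h2, eigA]
    module

/-- The coclosed eigenvector of `⋆ d` with eigenvalue `μ` built from `f`. -/
noncomputable def coclosedVector (μ : ℝ) (f : smoothSubspace h) : Fin 3 → smoothSubspace h :=
  curl h (vert f) + (1 + μ : ℂ) • vert f + (centralScalar h / μ) • grad h f

/-- The vertical component detects whether the vector vanishes, and orthogonality between levels is
read off from it. -/
theorem coclosedVector_two (μ : ℝ) (f : smoothSubspace h) :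
    coclosedVector μ f 2 = (μ + centralScalar h / μ * centralScalar h : ℂ) • f := by
  rw [coclosedVector, curl_vert, grad_eq, vert]
  simp
  module

theorem IsLadder.codiff_coclosedVector (L : IsLadder h k s f) {n : ℕ} {μ : ℝ} (h0 : μ ≠ 0)
    (hμ : μ ^ 2 + μ = eigA k n) : codiff h (coclosedVector μ (f n)) = 0 := by
  have h1 : (eigA k n : ℂ) = μ ^ 2 + μ := by rw [← hμ]; push_cast; ring
  have h2 : (μ : ℂ) ≠ 0 := by exact_mod_cast h0
  rw [coclosedVector, codiff_add, codiff_add, codiff_smul, codiff_smul, L.codiff_curl_vert,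
    codiff_vert, L.codiff_grad, h1, zero_add, smul_neg, smul_smul, smul_smul, ← neg_smul,
    ← add_smul]
  have h3 : -((1 + μ : ℂ) * centralScalar h) + centralScalar h / μ * (μ ^ 2 + μ) = 0 := by
    field_simp; ring
  rw [h3, zero_smul]

theorem IsLadder.curl_coclosedVector (L : IsLadder h k s f) {n : ℕ} {μ : ℝ} (h0 : μ ≠ 0)
    (hμ : μ ^ 2 + μ = eigA k n) :
    curl h (coclosedVector μ (f n)) = (μ : ℂ) • coclosedVector μ (f n) := by
  have h1 : (eigA k n : ℂ) = μ ^ 2 + μ := by rw [← hμ]; push_cast; ring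
  have h2 : (μ : ℂ) ≠ 0 := by exact_mod_cast h0
  have h3 : centralScalar h = μ * (centralScalar h / μ) := by field_simp
  rw [coclosedVector, curl_add, curl_add, curl_smul, curl_smul, L.curl_curl_vert, L.curl_grad, h1,
    smul_zero, add_zero]
  nth_rewrite 1 [h3]
  module

/-- The exceptional coclosed eigenvector built from the ground state. -/
noncomputable def groundVector (s : ℝ) (f : smoothSubspace h) : Fin 3 → smoothSubspace h :=
  ![f, (-(Complex.I * s)) • f, 0]

theorem IsLadder.opX_zero (L : IsLadder h k s f) :
    opX h (f 0) = (Complex.I * s) • opY h (f 0) := by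
  have h1 := L.lower 0
  rw [Nat.cast_zero, mul_zero, zero_smul] at h1
  exact sub_eq_zero.1 h1

theorem IsLadder.codiff_groundVector (L : IsLadder h k s f) :
    codiff h (groundVector s (f 0)) = 0 := by
  rw [groundVector, codiff_eq, map_smul, L.opX_zero]
  module

/-- Annihilation of `f 0` identifies `X (f 0)` with `i s Y (f 0)`, which kills the vertical
component; the central term alone then acts, by `-|k|`. -/
theorem IsLadder.curl_groundVector (L : IsLadder h k s f) :
    curl h (groundVector s (f 0)) = ((-|k| : ℝ) : ℂ) • groundVector s (f 0) := by
  have hI : (Complex.I * s) * (Complex.I * s) = -1 := by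
    linear_combination (s : ℂ) ^ 2 * Complex.I_sq - L.sign_sq_complex
  have e1 : centralScalar h * (Complex.I * s) = ((-|k| : ℝ) : ℂ) := by
    rw [L.scalar, ← L.sign_mul]; push_cast
    linear_combination (k * s : ℂ) * Complex.I_sq
  have e2 : centralScalar h = ((-|k| : ℝ) : ℂ) * -(Complex.I * s) := by
    rw [← e1]; linear_combination centralScalar h * hI
  rw [groundVector, curl_eq, map_smul, L.opX_zero]
  funext i
  fin_cases i
  · simp only [Fin.zero_eta, Matrix.cons_val_zero, Pi.smul_apply, map_zero, ← e1]; module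
  · simp only [Fin.mk_one, Matrix.cons_val_one, Matrix.cons_val_zero, Pi.smul_apply, map_zero]
    nth_rewrite 1 [e2]; module
  · simp [smul_smul, hI]

theorem act_lapMatrix1_of_curl {u : Fin 3 → smoothSubspace h} {μ : ℝ} (h1 : codiff h u = 0)
    (h2 : curl h u = (μ : ℂ) • u) :
    act (lapMatrix1 (opX h) (opY h) (opT h)) u = ((μ ^ 2 : ℝ) : ℂ) • u := by
  have h3 : grad h (0 : smoothSubspace h) = 0 := by
    rw [grad_eq]; funext i; fin_cases i <;> simp
  rw [act_lapMatrix1, h1, h3, h2, curl_smul, h2, smul_smul, zero_add]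
  push_cast; rw [sq]

theorem IsLadder.act_lapMatrix1_grad (L : IsLadder h k s f) (n : ℕ) :
    act (lapMatrix1 (opX h) (opY h) (opT h)) (grad h (f n)) = (eigA k n : ℂ) • grad h (f n) := by
  rw [act_lapMatrix1, L.codiff_grad, L.curl_grad, grad_smul]
  have : curl h (0 : Fin 3 → smoothSubspace h) = 0 := by
    have := curl_smul (0 : ℂ) (0 : Fin 3 → smoothSubspace h)
    rwa [zero_smul, zero_smul] at this
  rw [this, add_zero]

variable (k) in
/-- `√(α_n + 1/4)`. -/
noncomputable def rootA (n : ℕ) : ℝ := √(|k| * (2 * n + 1) + k ^ 2 + 1 / 4)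

theorem rootA_sq (n : ℕ) : rootA k n ^ 2 = eigA k n + 1 / 4 := by
  rw [rootA, Real.sq_sqrt (by positivity), eigA]; ring

theorem eigPlus_eq (n : ℕ) : eigPlus k n = (rootA k n + 1 / 2) ^ 2 := rfl

theorem eigMinus_eq (n : ℕ) : eigMinus k n = (rootA k n - 1 / 2) ^ 2 := rfl

theorem half_lt_rootA (hk : k ≠ 0) (n : ℕ) : 1 / 2 < rootA k n := by
  have h1 := rootA_sq (k := k) n
  have h2 := eigA_pos hk n
  have h3 : 0 ≤ rootA k n := Real.sqrt_nonneg _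
  nlinarith

/-- At level `0` the radicand is the perfect square `(|k| + 1/2)²`, whence the closed forms `k²` and
`(|k| + 1)²`. -/
theorem rootA_zero : rootA k 0 = |k| + 1 / 2 := by
  rw [rootA, ← Real.sqrt_sq (by positivity : 0 ≤ |k| + 1 / 2)]
  congr 1
  push_cast
  nlinarith [sq_abs k]

theorem abs_lt_rootA_sub (hk : k ≠ 0) (n : ℕ) : |k| < rootA k (n + 1) - 1 / 2 := by
  have h1 := rootA_sq (k := k) (n + 1)
  have h3 : 0 ≤ rootA k (n + 1) := Real.sqrt_nonneg _
  have h4 : 0 < |k| := abs_pos.2 hk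
  rw [eigA] at h1
  push_cast at h1
  have h5 : (|k| + 1 / 2) ^ 2 < rootA k (n + 1) ^ 2 := by
    rw [h1]
    have : (0 : ℝ) ≤ n := n.cast_nonneg
    nlinarith [sq_abs k, mul_nonneg this h4.le]
  have := lt_of_pow_lt_pow_left₀ 2 h3 h5
  linarith

theorem abs_lt_rootA_add (hk : k ≠ 0) (n : ℕ) : |k| < rootA k n + 1 / 2 := by
  cases n with
  | zero => rw [rootA_zero]; linarith
  | succ n => linarith [abs_lt_rootA_sub hk n]

/-- The eigenvectors on 1-forms. -/
noncomputable def formVector (k s : ℝ) (f : ℕ → smoothSubspace h) :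
    ℕ ⊕ ℕ ⊕ ℕ → Fin 3 → smoothSubspace h
  | .inl n => grad h (f n)
  | .inr (.inl n) => coclosedVector (-(rootA k n + 1 / 2)) (f n)
  -- The generic vector with `μ = |k|` is zero here, see `IsLadder.coclosedVector_ground`.
  | .inr (.inr 0) => groundVector s (f 0)
  | .inr (.inr (n + 1)) => coclosedVector (rootA k (n + 1) - 1 / 2) (f (n + 1))

/-- The eigenvalues on 1-forms. -/
noncomputable def formValue (k : ℝ) : ℕ ⊕ ℕ ⊕ ℕ → ℝ
  | .inl n => eigA k n
  | .inr (.inl n) => eigPlus k n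
  | .inr (.inr n) => eigMinus k n

theorem plus_quadratic (n : ℕ) :
    (-(rootA k n + 1 / 2)) ^ 2 + -(rootA k n + 1 / 2) = eigA k n := by
  linear_combination rootA_sq (k := k) n

theorem minus_quadratic (n : ℕ) :
    (rootA k n - 1 / 2) ^ 2 + (rootA k n - 1 / 2) = eigA k n := by
  linear_combination rootA_sq (k := k) n

theorem plus_ne_zero (hk : k ≠ 0) (n : ℕ) : -(rootA k n + 1 / 2) ≠ 0 := by
  have := half_lt_rootA hk n
  exact (by linarith : -(rootA k n + 1 / 2) < 0).ne

theorem minus_ne_zero (hk : k ≠ 0) (n : ℕ) : rootA k n - 1 / 2 ≠ 0 :=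
  (sub_pos.2 (half_lt_rootA hk n)).ne'

theorem IsLadder.act_formVector (L : IsLadder h k s f) (j : ℕ ⊕ ℕ ⊕ ℕ) :
    act (lapMatrix1 (opX h) (opY h) (opT h)) (formVector k s f j) =
      (formValue k j : ℂ) • formVector k s f j := by
  match j with
  | .inl n => exact L.act_lapMatrix1_grad n
  | .inr (.inl n) =>
    have h1 := act_lapMatrix1_of_curl
      (L.codiff_coclosedVector (plus_ne_zero L.ne_zero n) (plus_quadratic n))
      (L.curl_coclosedVector (plus_ne_zero L.ne_zero n) (plus_quadratic n))
    rwa [neg_sq, ← eigPlus_eq] at h1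
  | .inr (.inr 0) =>
    have h1 := act_lapMatrix1_of_curl L.codiff_groundVector L.curl_groundVector
    -- The `curl`-eigenvalue is `-|k|` rather than the root `|k|`; only the square matters.
    have h2 : (-|k|) ^ 2 = eigMinus k 0 := by rw [eigMinus_eq, rootA_zero]; ring
    rwa [h2] at h1
  | .inr (.inr (n + 1)) =>
    exact act_lapMatrix1_of_curl
      (L.codiff_coclosedVector (minus_ne_zero L.ne_zero (n + 1)) (minus_quadratic (n + 1)))
      (L.curl_coclosedVector (minus_ne_zero L.ne_zero (n + 1)) (minus_quadratic (n + 1)))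

/-- The vertical component is `(μ - k²/μ) f n`, which vanishes only for `|μ| = |k|`. -/
theorem IsLadder.coclosedVector_ne_zero (L : IsLadder h k s f) (n : ℕ) {μ : ℝ} (h0 : |k| < |μ|) :
    coclosedVector μ (f n) ≠ 0 := by
  intro h1
  have h2 := coclosedVector_two μ (f n)
  rw [h1] at h2
  have hμ : μ ≠ 0 := by
    rintro rfl
    simp at h0
    linarith [abs_nonneg k]
  have h3 : (μ + centralScalar h / μ * centralScalar h : ℂ) = ((μ - k ^ 2 / μ : ℝ) : ℂ) := by
    rw [L.scalar]; push_cast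
    linear_combination (k : ℂ) ^ 2 / μ * Complex.I_sq
  rw [h3] at h2
  have h4 := (smul_eq_zero.1 h2.symm).resolve_right (L.ne_zero_vector n)
  have h5 : μ - k ^ 2 / μ = 0 := by exact_mod_cast h4
  have h6 : μ ^ 2 = k ^ 2 := by
    field_simp at h5
    linarith
  exact h0.ne' ((sq_eq_sq_iff_abs_eq_abs _ _).1 h6)

theorem IsLadder.formVector_ne_zero (L : IsLadder h k s f) (j : ℕ ⊕ ℕ ⊕ ℕ) :
    formVector k s f j ≠ 0 := by
  match j with
  | .inl n =>
    intro h1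
    have h2 := L.codiff_grad n
    change grad h (f n) = 0 at h1
    have h3 : codiff h (0 : Fin 3 → smoothSubspace h) = 0 := by
      have := codiff_smul (0 : ℂ) (0 : Fin 3 → smoothSubspace h)
      rwa [zero_smul, zero_smul] at this
    rw [h1, h3] at h2
    have h4 : (eigA k n : ℂ) ≠ 0 := by exact_mod_cast (eigA_pos L.ne_zero n).ne'
    exact L.ne_zero_vector n ((smul_eq_zero.1 h2.symm).resolve_left h4)
  | .inr (.inl n) =>
    refine L.coclosedVector_ne_zero n ?_
    rw [abs_neg]
    exact (abs_lt_rootA_add L.ne_zero n).trans_le (le_abs_self _)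
  | .inr (.inr 0) => exact fun h1 => L.ne_zero_vector 0 (congrFun h1 0)
  | .inr (.inr (n + 1)) =>
    exact L.coclosedVector_ne_zero (n + 1)
      ((abs_lt_rootA_sub L.ne_zero n).trans_le (le_abs_self _))

end Eigenvectors

/-! ### Orthogonality and totality of the eigenvectors on 1-forms. -/

section Orthogonality

variable {h k s : ℝ} {f : ℕ → smoothSubspace h}

theorem toForms_add {n : ℕ} (u w : Fin n → smoothSubspace h) :
    toForms (u + w) = toForms u + toForms w := rfl

theorem inner_grad_of_codiff (u : smoothSubspace h) {w : Fin 3 → smoothSubspace h}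
    (hw : codiff h w = 0) : inner ℂ (toForms (grad h u)) (toForms w) = 0 := by
  rw [inner_grad, hw]; exact inner_zero_right _

/-- Coclosed vectors built from different levels are orthogonal, as well as a coclosed vector and
any other coclosed eigenvector of `⋆ d` whose vertical component is orthogonal. -/
theorem inner_coclosedVector (μ ν : ℝ) (u : smoothSubspace h) {w : Fin 3 → smoothSubspace h}
    (hw : codiff h w = 0) (hc : curl h w = (ν : ℂ) • w) (hv : inner ℂ (u : L2R) (w 2 : L2R) = 0) :
    inner ℂ (toForms (coclosedVector μ u)) (toForms w) = 0 := by
  -- The gradient term is orthogonal to coclosed `w`, and `curl` moves onto `w` as the scalar `ν`;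
  -- what remains is a multiple of the pairing of `u` with `w 2`.
  rw [coclosedVector, toForms_add, toForms_add, toForms_smul, toForms_smul, inner_add_left,
    inner_add_left, inner_smul_left, inner_smul_left, inner_grad_of_codiff u hw, inner_curl, hc,
    toForms_smul, inner_smul_right, inner_vert, hv]
  simp

theorem inner_eq_zero_of_curl {μ ν : ℝ} (hμν : μ ≠ ν) {u w : Fin 3 → smoothSubspace h}
    (hu : curl h u = (μ : ℂ) • u) (hw : curl h w = (ν : ℂ) • w) :
    inner ℂ (toForms u) (toForms w) = 0 := by
  have h1 := inner_curl u w
  rw [hu, hw, toForms_smul, toForms_smul, inner_smul_left, inner_smul_right, Complex.conj_ofReal,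
    ← sub_eq_zero, ← sub_mul] at h1
  refine (mul_eq_zero.1 h1).resolve_left ?_
  exact sub_ne_zero.2 (by exact_mod_cast hμν)

theorem inner_symm_zero {n : ℕ} {u w : Fin n → smoothSubspace h}
    (h0 : inner ℂ (toForms u) (toForms w) = 0) : inner ℂ (toForms w) (toForms u) = 0 :=
  inner_eq_zero_symm.1 h0

variable (k s f) in
/-- The eigenvectors of `⋆ d` on coclosed 1-forms. -/
noncomputable def coclosedFamily (j : ℕ ⊕ ℕ) : Fin 3 → smoothSubspace h :=
  formVector k s f (.inr j)

variable (k) in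
/-- The eigenvalues of `⋆ d` on coclosed 1-forms. -/
noncomputable def curlValue : ℕ ⊕ ℕ → ℝ
  | .inl n => -(rootA k n + 1 / 2)
  | .inr 0 => -|k|
  | .inr (n + 1) => rootA k (n + 1) - 1 / 2

theorem IsLadder.codiff_coclosedFamily (L : IsLadder h k s f) (j : ℕ ⊕ ℕ) :
    codiff h (coclosedFamily k s f j) = 0 := by
  match j with
  | .inl n => exact L.codiff_coclosedVector (plus_ne_zero L.ne_zero n) (plus_quadratic n)
  | .inr 0 => exact L.codiff_groundVector
  | .inr (n + 1) =>
    exact L.codiff_coclosedVector (minus_ne_zero L.ne_zero (n + 1)) (minus_quadratic (n + 1))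

theorem IsLadder.curl_coclosedFamily (L : IsLadder h k s f) (j : ℕ ⊕ ℕ) :
    curl h (coclosedFamily k s f j) = (curlValue k j : ℂ) • coclosedFamily k s f j := by
  match j with
  | .inl n => exact L.curl_coclosedVector (plus_ne_zero L.ne_zero n) (plus_quadratic n)
  | .inr 0 => exact L.curl_groundVector
  | .inr (n + 1) =>
    exact L.curl_coclosedVector (minus_ne_zero L.ne_zero (n + 1)) (minus_quadratic (n + 1))

/-- The level of a coclosed eigenvector, which is the Hermite level of its vertical component. -/
def level : ℕ ⊕ ℕ → ℕ
  | .inl n => n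
  | .inr n => n

theorem exists_coclosedFamily_two (j : ℕ ⊕ ℕ) :
    ∃ a : ℂ, coclosedFamily k s f j 2 = a • f (level j) := by
  match j with
  | .inl n => exact ⟨_, coclosedVector_two _ _⟩
  | .inr 0 => exact ⟨0, by rw [zero_smul]; rfl⟩
  | .inr (n + 1) => exact ⟨_, coclosedVector_two _ _⟩

theorem exists_eq_coclosedVector (j : ℕ ⊕ ℕ) (hj : j ≠ .inr 0) :
    ∃ μ, coclosedFamily k s f j = coclosedVector μ (f (level j)) := by
  match j with
  | .inl n => exact ⟨_, rfl⟩
  | .inr 0 => exact absurd rfl hj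
  | .inr (n + 1) => exact ⟨_, rfl⟩

theorem IsLadder.inner_coclosedFamily_of_level (L : IsLadder h k s f) {i j : ℕ ⊕ ℕ}
    (hi : i ≠ .inr 0) (hij : level i ≠ level j) :
    inner ℂ (toForms (coclosedFamily k s f i)) (toForms (coclosedFamily k s f j)) = 0 := by
  obtain ⟨μ, hμ⟩ := exists_eq_coclosedVector (h := h) (k := k) (s := s) (f := f) i hi
  obtain ⟨a, ha⟩ := exists_coclosedFamily_two (h := h) (k := k) (s := s) (f := f) j
  rw [hμ]
  refine inner_coclosedVector μ _ _ (L.codiff_coclosedFamily j) (L.curl_coclosedFamily j) ?_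
  rw [ha, Submodule.coe_smul, inner_smul_right, L.inner_eq_zero hij, mul_zero]

theorem curlValue_ne (hk : k ≠ 0) (n : ℕ) : curlValue k (.inl n) ≠ curlValue k (.inr n) := by
  have h1 := half_lt_rootA hk n
  have h2 := abs_lt_rootA_add hk n
  cases n with
  | zero => exact (by simp only [curlValue]; linarith :
      curlValue k (.inl 0) < curlValue k (.inr 0)).ne
  | succ n => exact (by simp only [curlValue]; linarith :
      curlValue k (.inl (n + 1)) < curlValue k (.inr (n + 1))).ne

/-- Different levels are separated by their vertical components, equal levels by distinct
eigenvalues of the symmetric operator `curl`. -/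
theorem IsLadder.inner_coclosedFamily (L : IsLadder h k s f) {i j : ℕ ⊕ ℕ} (hij : i ≠ j) :
    inner ℂ (toForms (coclosedFamily k s f i)) (toForms (coclosedFamily k s f j)) = 0 := by
  by_cases hl : level i = level j
  · have hc : curlValue k i ≠ curlValue k j := by
      match i, j with
      | .inl m, .inl n => exact absurd (congrArg Sum.inl hl) hij
      | .inr m, .inr n => exact absurd (congrArg Sum.inr hl) hij
      | .inl m, .inr n =>
        obtain rfl : m = n := hl
        exact curlValue_ne L.ne_zero m
      | .inr m, .inl n =>
        obtain rfl : m = n := hl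
        exact (curlValue_ne L.ne_zero m).symm
    exact inner_eq_zero_of_curl hc (L.curl_coclosedFamily i) (L.curl_coclosedFamily j)
  -- The ground vector is not of the form `coclosedVector`, so it has to stand on the right.
  · by_cases hi : i = .inr 0
    · have hj : j ≠ .inr 0 := fun hj => hij (hi.trans hj.symm)
      exact inner_symm_zero (L.inner_coclosedFamily_of_level hj (Ne.symm hl))
    · exact L.inner_coclosedFamily_of_level hi hl

theorem IsLadder.formVector_orthogonal (L : IsLadder h k s f) :
    Pairwise fun i j => inner ℂ (toForms (formVector k s f i)) (toForms (formVector k s f j)) = 0 := by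
  intro i j hij
  match i, j with
  | .inl m, .inl n =>
    have hmn : m ≠ n := fun e => hij (congrArg Sum.inl e)
    change inner ℂ (toForms (grad h (f m))) (toForms (grad h (f n))) = 0
    rw [inner_grad, L.codiff_grad, Submodule.coe_smul, inner_smul_right, L.inner_eq_zero hmn,
      mul_zero]
  | .inl m, .inr n => exact inner_grad_of_codiff _ (L.codiff_coclosedFamily n)
  | .inr m, .inl n => exact inner_symm_zero (inner_grad_of_codiff _ (L.codiff_coclosedFamily m))
  | .inr m, .inr n => exact L.inner_coclosedFamily fun e => hij (congrArg Sum.inr e)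

/-- In the totality argument this supplies the relation for the minus root at level `0` for free. -/
theorem IsLadder.coclosedVector_ground (L : IsLadder h k s f) :
    coclosedVector (rootA k 0 - 1 / 2) (f 0) = 0 := by
  have hk : ((|k| : ℝ) : ℂ) ≠ 0 := by exact_mod_cast (abs_pos.2 L.ne_zero).ne'
  have hI : (Complex.I * s) * (Complex.I * s) = -1 := by
    linear_combination (s : ℂ) ^ 2 * Complex.I_sq - L.sign_sq_complex
  have e0 : centralScalar h = (|k| : ℝ) * (Complex.I * s) := by
    rw [L.scalar, ← L.sign_mul]; push_cast
    linear_combination (-(k : ℂ) * Complex.I) * L.sign_sq_complex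
  have e1 : centralScalar h / (|k| : ℝ) = Complex.I * s := by
    rw [e0]; field_simp
  rw [rootA_zero, add_sub_cancel_right, coclosedVector, e1, curl_vert, grad_eq, vert, L.opX_zero]
  funext i
  fin_cases i
  · simp [smul_smul, hI]
  · simp
  · simp [smul_smul, e0]
    have : (Complex.I * s * ((|k| : ℝ) * (Complex.I * s)) : ℂ) = -(|k| : ℝ) := by
      linear_combination ((|k| : ℝ) : ℂ) * hI
    rw [this]
    module

theorem inner_toForms_three (a b c : smoothSubspace h) (x : L2Forms 3) :
    inner ℂ (toForms ![a, b, c]) x = inner ℂ (a : L2R) (x 0) + inner ℂ (b : L2R) (x 1) +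
      inner ℂ (c : L2R) (x 2) := by
  simp [inner_toForms, Fin.sum_univ_three]

theorem IsLadder.formVector_total (L : IsLadder h k s f) (x : L2Forms 3)
    (hx : ∀ j, inner ℂ (toForms (formVector k s f j)) x = 0) : x = 0 := by
  have hg : ∀ n, inner ℂ (toForms (grad h (f n))) x = 0 := fun n => hx (.inl n)
  have hp : ∀ n, inner ℂ (toForms (coclosedVector (-(rootA k n + 1 / 2)) (f n))) x = 0 :=
    fun n => hx (.inr (.inl n))
  have hm : ∀ n, inner ℂ (toForms (coclosedVector (rootA k n - 1 / 2) (f n))) x = 0 := fun n => by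
    cases n with
    | zero => rw [L.coclosedVector_ground]; exact inner_zero_left _
    | succ n => exact hx (.inr (.inr (n + 1)))
  have hz : inner ℂ (toForms (groundVector s (f 0))) x = 0 := hx (.inr (.inr 0))
  simp only [coclosedVector, toForms_add, toForms_smul, inner_add_left, inner_smul_left, hg,
    mul_zero, add_zero] at hp hm
  -- Subtracting the relations for the two roots eliminates `curl (vert (f n))`; the coefficient
  -- left is the difference of the roots, `2 * rootA k n`.
  have hv : ∀ n, inner ℂ (toForms (vert (f n))) x = 0 := fun n => by
    have h1 : (starRingEnd ℂ) (1 + (rootA k n - 1 / 2 : ℝ) : ℂ) = 1 / 2 + rootA k n := by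
      rw [map_add, map_one, Complex.conj_ofReal]; push_cast; ring
    have h2 : (starRingEnd ℂ) (1 + (-(rootA k n + 1 / 2) : ℝ) : ℂ) = 1 / 2 - rootA k n := by
      rw [map_add, map_one, Complex.conj_ofReal]; push_cast; ring
    have h3 := hm n
    have h4 := hp n
    rw [h1] at h3
    rw [h2] at h4
    have h5 : (2 * rootA k n : ℂ) * inner ℂ (toForms (vert (f n))) x = 0 := by
      linear_combination h3 - h4
    refine (mul_eq_zero.1 h5).resolve_left ?_
    have := half_lt_rootA L.ne_zero n
    exact_mod_cast (by linarith : 0 < 2 * rootA k n).ne'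
  have hc : ∀ n, inner ℂ (toForms (curl h (vert (f n)))) x = 0 := fun n => by
    have h3 := hm n
    rwa [hv, mul_zero, add_zero] at h3
  have hx2 : x 2 = 0 := L.total _ fun n => by
    have := hv n
    rw [vert, inner_toForms_three] at this
    simpa using this
  simp only [grad_eq, curl_vert, groundVector, inner_toForms_three, hx2, inner_zero_right,
    add_zero] at hg hc hz
  have hXY : ∀ n, inner ℂ (opX h (f n) : L2R) (x 0) + inner ℂ (opY h (f n) : L2R) (x 1) = 0 := hg
  have hYX : ∀ n, inner ℂ (opY h (f n) : L2R) (x 0) - inner ℂ (opX h (f n) : L2R) (x 1) = 0 :=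
    fun n => by
      have := hc n
      rwa [Submodule.coe_neg, inner_neg_left, ← sub_eq_add_neg] at this
  have hs2 := L.sign_sq_complex
  have hconj : (starRingEnd ℂ) (Complex.I * s) = -(Complex.I * s) := by
    rw [map_mul, Complex.conj_I, Complex.conj_ofReal]; ring
  have hraise : ∀ n, inner ℂ (f (n + 1) : L2R) (x 0) +
      (Complex.I * s) * inner ℂ (f (n + 1) : L2R) (x 1) = 0 := fun n => by
    rw [← L.raise]
    simp only [Submodule.coe_sub, Submodule.coe_neg, Submodule.coe_smul, inner_sub_left,
      inner_neg_left, inner_smul_left, hconj]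
    linear_combination -hXY n + (Complex.I * s) * hYX n +
      (s ^ 2 * inner ℂ (opY h (f n) : L2R) (x 1)) * Complex.I_sq -
      inner ℂ (opY h (f n) : L2R) (x 1) * hs2
  -- Every `f n` is a lowered vector, so this relation holds at all levels. The raised vectors miss
  -- `f 0`, for which the ground vector provides the companion relation.
  have hlower : ∀ n, inner ℂ (f n : L2R) (x 0) -
      (Complex.I * s) * inner ℂ (f n : L2R) (x 1) = 0 := fun n => by
    have hne : (2 * |k| * (n + 1 : ℕ) : ℂ) ≠ 0 := by
      have : 0 < |k| := abs_pos.2 L.ne_zero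
      exact_mod_cast (by positivity : (2 * |k| * (n + 1 : ℕ) : ℝ) ≠ 0)
    have h1 : f n = (2 * |k| * (n + 1 : ℕ) : ℂ)⁻¹ •
        (opX h (f (n + 1)) - (Complex.I * s) • opY h (f (n + 1))) := by
      rw [L.lower, smul_smul, inv_mul_cancel₀ hne, one_smul, Nat.add_sub_cancel]
    rw [h1]
    simp only [Submodule.coe_sub, Submodule.coe_smul, inner_sub_left, inner_smul_left, hconj]
    set d := (starRingEnd ℂ) (2 * |k| * (n + 1 : ℕ) : ℂ)⁻¹
    linear_combination d * hXY (n + 1) + d * (Complex.I * s) * hYX (n + 1) -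
      d * (s ^ 2 * inner ℂ (opY h (f (n + 1)) : L2R) (x 1)) * Complex.I_sq +
      d * inner ℂ (opY h (f (n + 1)) : L2R) (x 1) * hs2
  have hground : inner ℂ (f 0 : L2R) (x 0) +
      (Complex.I * s) * inner ℂ (f 0 : L2R) (x 1) = 0 := by
    rw [Submodule.coe_smul, inner_smul_left, map_neg, hconj, neg_neg] at hz
    exact hz
  have hsum : ∀ n, inner ℂ (f n : L2R) (x 0) +
      (Complex.I * s) * inner ℂ (f n : L2R) (x 1) = 0 := fun n => by
    cases n with
    | zero => exact hground
    | succ n => exact hraise n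
  have hx0 : x 0 = 0 := L.total _ fun n => by
    linear_combination (hsum n + hlower n) / 2
  have hx1 : x 1 = 0 := L.total _ fun n => by
    linear_combination (-(Complex.I * s) / 2) * (hsum n - hlower n) +
      (s ^ 2 * inner ℂ (f n : L2R) (x 1)) * Complex.I_sq - inner ℂ (f n : L2R) (x 1) * hs2
  refine PiLp.ext fun i => ?_
  fin_cases i
  · exact hx0
  · exact hx1
  · exact hx2

end Orthogonality

/-! ### The localised Laplacians as diagonal operators. -/

section Diagonalisation

variable {h k s : ℝ} {f : ℕ → smoothSubspace h}

theorem finite_eigA_le (hk : k ≠ 0) (C : ℝ) : {n | eigA k n ≤ C}.Finite := by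
  refine (Set.finite_Iic ⌈C / |k|⌉₊).subset fun n hn => ?_
  have h0 : 0 < |k| := abs_pos.2 hk
  have h1 : (2 * n + 1) * |k| + k ^ 2 ≤ C := hn
  have h2 : (n : ℝ) ≤ C / |k| := by
    rw [le_div_iff₀ h0]
    nlinarith [mul_nonneg (n.cast_nonneg : (0 : ℝ) ≤ n) h0.le, sq_nonneg k]
  exact Nat.cast_le.1 (h2.trans (Nat.le_ceil _))

theorem finite_formValue_le (hk : k ≠ 0) (C : ℝ) : {j | |formValue k j| ≤ C}.Finite := by
  -- The minus sequence dictates the bound: with `r = rootA k n`, `r² ≤ 2 (r - 1/2)² + 1/2`, so `(r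
  -- - 1/2)² ≤ C` forces `α_n ≤ 2 C + 1/4`.
  have hS := finite_eigA_le hk (2 * |C| + 1)
  refine ((hS.image Sum.inl).union (((hS.image Sum.inl).image Sum.inr).union
    ((hS.image Sum.inr).image Sum.inr))).subset fun j hj => ?_
  have hC := le_abs_self C
  have hj' : formValue k j ≤ C := (le_abs_self _).trans hj
  match j with
  | .inl n =>
    refine Or.inl ⟨n, ?_, rfl⟩
    have h1 : eigA k n ≤ C := hj'
    change eigA k n ≤ _
    linarith [abs_nonneg C]
  | .inr (.inl n) =>
    refine Or.inr (Or.inl ⟨_, ⟨n, ?_, rfl⟩, rfl⟩)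
    have h1 : (rootA k n + 1 / 2) ^ 2 ≤ C := hj'
    have h2 := rootA_sq (k := k) n
    have h3 := half_lt_rootA hk n
    change eigA k n ≤ _
    nlinarith [abs_nonneg C]
  | .inr (.inr n) =>
    refine Or.inr (Or.inr ⟨_, ⟨n, ?_, rfl⟩, rfl⟩)
    have h1 : (rootA k n - 1 / 2) ^ 2 ≤ C := hj'
    have h2 := rootA_sq (k := k) n
    change eigA k n ≤ _
    nlinarith [sq_nonneg (rootA k n - 1)]

theorem IsLadder.isDiagonal_lapMatrix0 (L : IsLadder h k s f) :
    IsDiagonal (localiseSmooth h (lapMatrix0 (fieldX L2R) (fieldY L2R) (fieldT L2R)))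
      (fun n => toForms ![f n]) (eigA k) := by
  refine isDiagonal_localiseSmooth (localises_lapMatrix0 h) (isFormalAdjoint_lapMatrix0 h)
    (fun n => ?_) (fun n h0 => L.ne_zero_vector n (congrFun h0 0)) (fun m n hmn => ?_)
    (fun x hx => ?_) (fun C => ?_)
  · rw [act_lapMatrix0, L.codiff_grad]; simp
  · simpa [inner_toForms, toForms_apply] using L.inner_eq_zero hmn
  · refine PiLp.ext fun i => ?_
    fin_cases i
    refine L.total _ fun n => ?_
    simpa [inner_toForms] using hx n
  · refine (finite_eigA_le L.ne_zero C).subset fun n hn => (le_abs_self (eigA k n)).trans hn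

theorem IsLadder.isDiagonal_lapMatrix1 (L : IsLadder h k s f) :
    IsDiagonal (localiseSmooth h (lapMatrix1 (fieldX L2R) (fieldY L2R) (fieldT L2R)))
      (fun j => toForms (formVector k s f j)) (formValue k) :=
  isDiagonal_localiseSmooth (localises_lapMatrix1 h) (isFormalAdjoint_lapMatrix1 h)
    L.act_formVector L.formVector_ne_zero L.formVector_orthogonal L.formVector_total
    (finite_formValue_le L.ne_zero)

theorem act_star_star (u : Fin 3 → smoothSubspace h) :
    act (starMatrix _) (act (starMatrix _) u) = u := by
  funext i
  fin_cases i <;> simp [act, starMatrix, Fin.sum_univ_three]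

theorem inner_act_star (u : Fin 3 → smoothSubspace h) (x : L2Forms 3) :
    inner ℂ (toForms (act (starMatrix _) u)) x =
      inner ℂ (toForms u) (WithLp.toLp 2 ![x 2, -x 1, x 0]) := by
  simp [inner_toForms, act, starMatrix, Fin.sum_univ_three]
  ring

theorem IsLadder.isDiagonal_star_lapMatrix1_star (L : IsLadder h k s f) :
    IsDiagonal (localiseSmooth h
        (starMatrix _ * lapMatrix1 (fieldX L2R) (fieldY L2R) (fieldT L2R) * starMatrix _))
      (fun j => toForms (act (starMatrix _) (formVector k s f j))) (formValue k) := by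
  have hadj := ((isFormalAdjoint_star h).mul (isFormalAdjoint_lapMatrix1 h)).mul
    (isFormalAdjoint_star h)
  rw [← Matrix.mul_assoc] at hadj
  refine isDiagonal_localiseSmooth (((localises_starMatrix h).mul (localises_lapMatrix1 h)).mul
    (localises_starMatrix h)) hadj (fun j => ?_) (fun j h0 => ?_) (fun i j hij => ?_)
    (fun x hx => ?_) (finite_formValue_le L.ne_zero)
  · rw [act_mul, act_mul, act_star_star, L.act_formVector, act_smul]
  · refine L.formVector_ne_zero j ?_
    rw [← act_star_star (formVector k s f j), h0]
    funext i
    simp [act]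
  · refine ((isFormalAdjoint_star h).inner_act _ _).trans ?_
    rw [act_star_star]
    exact L.formVector_orthogonal hij
  · have h1 := L.formVector_total (WithLp.toLp 2 ![x 2, -x 1, x 0]) fun j => by
      rw [← inner_act_star]; exact hx j
    have h2 : x 2 = 0 := congrArg (fun y : L2Forms 3 => y 0) h1
    have h3 : -x 1 = 0 := congrArg (fun y : L2Forms 3 => y 1) h1
    have h4 : x 0 = 0 := congrArg (fun y : L2Forms 3 => y 2) h1
    refine PiLp.ext fun i => ?_
    fin_cases i
    · exact h4
    · exact neg_eq_zero.1 h3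
    · exact h2

end Diagonalisation

/-! ### Counting the eigenvalues and excluding coincidences. -/

section Counting

variable {k : ℝ}

theorem eigA_injective (hk : k ≠ 0) : Function.Injective (eigA k) := by
  intro m n hmn
  have h0 : |k| ≠ 0 := (abs_pos.2 hk).ne'
  unfold eigA at hmn
  have h1 : (2 * m + 1 : ℝ) * |k| = (2 * n + 1) * |k| := by linarith
  have h2 := mul_right_cancel₀ h0 h1
  exact_mod_cast (by linarith : (m : ℝ) = n)

theorem rootA_injective (hk : k ≠ 0) : Function.Injective (rootA k) := by
  intro m n hmn
  refine eigA_injective hk ?_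
  linear_combination (rootA k m + rootA k n) * hmn - rootA_sq (k := k) m + rootA_sq (k := k) n

theorem eigPlus_injective (hk : k ≠ 0) : Function.Injective (eigPlus k) := by
  intro m n hmn
  refine rootA_injective hk ?_
  have h1 := half_lt_rootA hk m
  have h2 := half_lt_rootA hk n
  rw [eigPlus_eq, eigPlus_eq, sq_eq_sq₀ (by linarith) (by linarith)] at hmn
  linarith

theorem eigMinus_injective (hk : k ≠ 0) : Function.Injective (eigMinus k) := by
  intro m n hmn
  refine rootA_injective hk ?_
  have h1 := half_lt_rootA hk m
  have h2 := half_lt_rootA hk n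
  rw [eigMinus_eq, eigMinus_eq, sq_eq_sq₀ (by linarith) (by linarith)] at hmn
  linarith

theorem range_formValue : Set.range (formValue k) = oneFormSpectrum k := by
  have h1 : k ^ 2 = eigMinus k 0 := by
    rw [eigMinus_eq, rootA_zero, add_sub_cancel_right, sq_abs]
  have h2 : (|k| + 1) ^ 2 = eigPlus k 0 := by
    rw [eigPlus_eq, rootA_zero]; ring
  ext x
  constructor
  · rintro ⟨j, rfl⟩
    match j with
    | .inl n => exact Or.inl (Or.inr ⟨n, rfl⟩)
    | .inr (.inl n) => exact Or.inr ⟨n, Or.inl rfl⟩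
    | .inr (.inr n) => exact Or.inr ⟨n, Or.inr rfl⟩
  · rintro (((rfl | rfl) | ⟨n, rfl⟩) | ⟨n, rfl | rfl⟩)
    · exact ⟨.inr (.inr 0), h1.symm⟩
    · exact ⟨.inr (.inl 0), h2.symm⟩
    · exact ⟨.inl n, rfl⟩
    · exact ⟨.inr (.inl n), rfl⟩
    · exact ⟨.inr (.inr n), rfl⟩

theorem ncard_setOf_sum {α β : Type*} {p : α ⊕ β → Prop} (hp : {j | p j}.Finite) :
    {j | p j}.ncard = {a | p (.inl a)}.ncard + {b | p (.inr b)}.ncard := by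
  have h1 : {j | p j} = Sum.inl '' {a | p (.inl a)} ∪ Sum.inr '' {b | p (.inr b)} := by
    ext j
    rcases j with j | j <;> simp
  rw [h1] at hp
  rw [h1, Set.ncard_union_eq ?_ (hp.subset Set.subset_union_left)
    (hp.subset Set.subset_union_right), Set.ncard_image_of_injective _ Sum.inl_injective,
    Set.ncard_image_of_injective _ Sum.inr_injective]
  rw [Set.disjoint_left]
  rintro _ ⟨a, -, rfl⟩ ⟨b, -, hb⟩
  exact Sum.inr_ne_inl hb

theorem ncard_formValue (hk : k ≠ 0) (x : ℝ) : {j | formValue k j = x}.ncard = oneFormCount k x := by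
  have hfin : {j | formValue k j = x}.Finite :=
    (finite_formValue_le hk |x|).subset fun j hj => by
      have : formValue k j = x := hj
      simp [this]
  rw [ncard_setOf_sum hfin, ncard_setOf_sum (p := fun j => formValue k (.inr j) = x)
    (hfin.preimage Sum.inr_injective.injOn), ← add_assoc]
  rfl

theorem not_irrational_of_int_mul_eq {x : ℝ} {a b : ℤ} (ha : a ≠ 0) (hab : (a : ℝ) * x = b) :
    ¬ Irrational x := by
  intro hx
  refine (irrational_iff_ne_rational x).1 hx b a ha ?_
  rw [← hab]
  field_simp

/-- The constants `1/4` cancel and one factor `|k|` divides out, leaving an integer linear relation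
for `|k|`. Every coincidence between two of the sequences is brought to this shape. -/
theorem eq_of_rootA_sq_eq (hk : k ≠ 0) {n : ℕ} {c : ℤ}
    (hc : rootA k n ^ 2 = (c * |k| - 1 / 2) ^ 2) :
    ((c ^ 2 - 1 : ℤ) : ℝ) * |k| = ((2 * n + 1 + c : ℤ) : ℝ) := by
  have h0 : |k| ≠ 0 := (abs_pos.2 hk).ne'
  refine mul_right_cancel₀ h0 ?_
  rw [rootA_sq, eigA] at hc
  push_cast
  linear_combination -hc - sq_abs k

theorem formValue_injective (hk : Irrational k) : Function.Injective (formValue k) := by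
  have hk0 : k ≠ 0 := hk.ne_zero
  have habs : Irrational |k| := by
    rcases abs_choice k with h0 | h0 <;> rw [h0]
    · exact hk
    · exact hk.neg
  -- For even `c` the coefficient `c² - 1` is odd, hence nonzero, and the relation contradicts
  -- irrationality.
  have heven : ∀ (n : ℕ) (j : ℤ), rootA k n ^ 2 ≠ (((2 * j : ℤ) : ℝ) * |k| - 1 / 2) ^ 2 := by
    intro n j hj
    refine not_irrational_of_int_mul_eq ?_ (eq_of_rootA_sq_eq hk0 hj) habs
    intro h0
    have h1 : 2 * (2 * j ^ 2) = 1 := by linear_combination h0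
    omega
  have hAP : ∀ m n, eigA k m ≠ eigPlus k n := by
    intro m n hmn
    refine heven n (m - n) ?_
    have h1 := rootA_sq (k := k) n
    rw [eigPlus_eq] at hmn
    have h2 : rootA k n = ((2 * (m - n) : ℤ) : ℝ) * |k| - 1 / 2 := by
      rw [eigA] at hmn h1; push_cast; linear_combination -hmn - h1
    rw [← h2]
  have hAM : ∀ m n, eigA k m ≠ eigMinus k n := by
    intro m n hmn
    refine heven n (m - n) ?_
    have h1 := rootA_sq (k := k) n
    rw [eigMinus_eq] at hmn
    have h2 : rootA k n = -(((2 * (m - n) : ℤ) : ℝ) * |k| - 1 / 2) := by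
      rw [eigA] at hmn h1; push_cast; linear_combination hmn + h1
    rw [h2, neg_sq]
  have hPM : ∀ m n, eigPlus k m ≠ eigMinus k n := by
    intro m n hmn
    have h1 := half_lt_rootA hk0 m
    have h2 := half_lt_rootA hk0 n
    rw [eigPlus_eq, eigMinus_eq, sq_eq_sq₀ (by linarith) (by linarith)] at hmn
    have h3 : rootA k m = ((n - m : ℤ) : ℝ) * |k| - 1 / 2 := by
      have e1 := rootA_sq (k := k) m
      have e2 := rootA_sq (k := k) n
      have e3 : rootA k n = rootA k m + 1 := by linarith
      rw [eigA] at e1 e2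
      rw [e3] at e2
      push_cast
      linear_combination (e2 - e1) / 2
    have h4 : rootA k m ^ 2 = (((n - m : ℤ) : ℝ) * |k| - 1 / 2) ^ 2 := by rw [h3]
    have h5 := eq_of_rootA_sq_eq hk0 h4
    -- Here `c = n - m` may be `±1`, making the relation trivial on the left; the right side is then
    -- `m + n + 1`, which cannot vanish.
    by_cases hc : ((n - m : ℤ) ^ 2 - 1 : ℤ) = 0
    · rw [hc, Int.cast_zero, zero_mul] at h5
      have h6 : (2 * m + 1 + (n - m) : ℤ) = 0 := by exact_mod_cast h5.symm
      omega
    · exact not_irrational_of_int_mul_eq hc h5 habs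
  intro i j hij
  match i, j with
  | .inl m, .inl n => rw [eigA_injective hk0 hij]
  | .inr (.inl m), .inr (.inl n) => rw [eigPlus_injective hk0 hij]
  | .inr (.inr m), .inr (.inr n) => rw [eigMinus_injective hk0 hij]
  | .inl m, .inr (.inl n) => exact absurd hij (hAP m n)
  | .inl m, .inr (.inr n) => exact absurd hij (hAM m n)
  | .inr (.inl m), .inl n => exact absurd hij.symm (hAP n m)
  | .inr (.inr m), .inl n => exact absurd hij.symm (hAM n m)
  | .inr (.inl m), .inr (.inr n) => exact absurd hij (hPM m n)
  | .inr (.inr m), .inr (.inl n) => exact absurd hij.symm (hPM n m)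

/-- An injective list of eigenvalues gives multiplicities one. -/
theorem IsDiagonal.eigenMultiplicity_eq_one {K ι : Type*} [NormedAddCommGroup K]
    [InnerProductSpace ℂ K] [CompleteSpace K] {S : K →ₗ.[ℂ] K} {v : ι → K} {l : ι → ℝ}
    (H : IsDiagonal S v l) (hl : Function.Injective l) {z : ℂ}
    (hz : z ∈ unboundedSpectrum S.closure) : eigenMultiplicity S.closure z = 1 := by
  rw [H.unboundedSpectrum_closure] at hz
  obtain ⟨_, ⟨j, rfl⟩, rfl⟩ := hz
  change eigenMultiplicity S.closure ((l j : ℝ) : ℂ) = 1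
  rw [H.eigenMultiplicity_closure, Set.ncard_eq_one]
  refine ⟨j, ?_⟩
  ext i
  exact hl.eq_iff

end Counting

end HeisenbergHodge

open HeisenbergHodge in
theorem mainTheorem6 (h k : ℝ) (hh : h ≠ 0) (hk : k = 2 * Real.pi * h) :
    -- the spectra
    unboundedSpectrum (localise h (hodgeLaplacian0 L2R)) =
      (fun x : ℝ => (x : ℂ)) '' functionSpectrum k ∧
    unboundedSpectrum (localise h (hodgeLaplacian1 L2R)) =
      (fun x : ℝ => (x : ℂ)) '' oneFormSpectrum k ∧
    unboundedSpectrum (localise h (hodgeLaplacian2 L2R)) =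
      unboundedSpectrum (localise h (hodgeLaplacian1 L2R)) ∧
    unboundedSpectrum (localise h (hodgeLaplacian3 L2R)) =
      unboundedSpectrum (localise h (hodgeLaplacian0 L2R)) ∧
    -- multiplicity one in degrees 0 and 3
    (∀ z ∈ unboundedSpectrum (localise h (hodgeLaplacian0 L2R)),
      eigenMultiplicity (localise h (hodgeLaplacian0 L2R)) z = 1) ∧
    (∀ z ∈ unboundedSpectrum (localise h (hodgeLaplacian3 L2R)),
      eigenMultiplicity (localise h (hodgeLaplacian3 L2R)) z = 1) ∧
    -- in degrees 1 and 2, each entry of the list of eigenvalues counts once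
    (∀ x : ℝ, eigenMultiplicity (localise h (hodgeLaplacian1 L2R)) (x : ℂ) = oneFormCount k x) ∧
    (∀ x : ℝ, eigenMultiplicity (localise h (hodgeLaplacian2 L2R)) (x : ℂ) = oneFormCount k x) ∧
    -- multiplicity one in degrees 1 and 2 when no two entries coincide
    (Irrational k →
      (∀ z ∈ unboundedSpectrum (localise h (hodgeLaplacian1 L2R)),
        eigenMultiplicity (localise h (hodgeLaplacian1 L2R)) z = 1) ∧
      (∀ z ∈ unboundedSpectrum (localise h (hodgeLaplacian2 L2R)),
        eigenMultiplicity (localise h (hodgeLaplacian2 L2R)) z = 1)) := by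
  obtain ⟨s, f, L⟩ := exists_isLadder k hh hk
  have H0 := L.isDiagonal_lapMatrix0
  have H1 := L.isDiagonal_lapMatrix1
  have H2 := L.isDiagonal_star_lapMatrix1_star
  have hk0 := L.ne_zero
  rw [hodgeLaplacian3_eq, hodgeLaplacian0_eq, hodgeLaplacian1_eq, hodgeLaplacian2_eq]
  -- After the rewriting, degrees 0 and 3 have literally the same operator.
  refine ⟨?_, ?_, ?_, rfl, fun z hz => H0.eigenMultiplicity_eq_one (eigA_injective hk0) hz,
    fun z hz => H0.eigenMultiplicity_eq_one (eigA_injective hk0) hz, fun x => ?_, fun x => ?_,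
    fun hirr => ⟨fun z hz => H1.eigenMultiplicity_eq_one (formValue_injective hirr) hz,
      fun z hz => H2.eigenMultiplicity_eq_one (formValue_injective hirr) hz⟩⟩
  · have h1 : functionSpectrum k = Set.range (eigA k) := by
      ext x; exact exists_congr fun m => eq_comm
    rw [h1]
    exact H0.unboundedSpectrum_closure
  · rw [← range_formValue]
    exact H1.unboundedSpectrum_closure
  · exact H2.unboundedSpectrum_closure.trans H1.unboundedSpectrum_closure.symm
  · exact (H1.eigenMultiplicity_closure x).trans (ncard_formValue hk0 x)
  · exact (H2.eigenMultiplicity_closure x).trans (ncard_formValue hk0 x)
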